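/- Let $n\ge 2$, let $\omega_k$ denote the volume of the Euclidean unit ball of $\mathbb{R}^k$, and put $\sigma_n^2=\omega_{n-1}/(2\pi)^n$, $\sigma_n>0$. For an integrable function $g:\mathbb{R}^n\to\mathbb{R}$ write $\widehat g(\xi)=(2\pi)^{-n/2}\int e^{-i\xi\cdot x}g(x)\,dx$ and $$\Sigma^2(g)=\int_{\mathbb{R}^n}|\widehat g(\xi)|^2\,|\xi|\,d\xi .$$ For every $\mu>0$ let $X_\infty$ (which depends on $\mu$) be the determinantal point process on $\mathbb{R}^n$ associated with the spectral projector $K_\mu=\mathbf 1_{(-\infty,\mu^2]}(-\Delta)$ of the free Laplacian on $L^2(\mathbb{R}^n)$. That is, $X_\infty=\sum_{x\in\Lambda}\delta_x$ for a random set $\Lambda\subset\mathbb{R}^n$ without accumulation points, and $\mathbb{E}\,e^{-X_\infty(f)}=\det\big(I-(1-e^{-f})K_\mu\big)$ (Fredholm determinant) for all $f\in C_c^\infty(\mathbb{R}^n;[0,\infty))$. Let $g\in H^{1/2}(\mathbb{R}^n)\cap L^1(\mathbb{R}^n)$ be real-valued. Then, for every $\mu>0$, $X_\infty(g)=\sum_{x\in\Lambda}g(x)$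 converges absolutely almost surely, and as $\mu\to\infty$ $$\frac{X_\infty(g)-\mu^n\omega_n(2\pi)^{-n}\int_{\mathbb{R}^n} g(x)\,dx}{\sigma_n\,\mu^{(n-1)/2}}\;\longrightarrow\;\mathcal N\big(0,\Sigma^2(g)\big)\quad\text{in distribution},$$ where $\mathcal N(0,0)$ is the point mass at $0$. -/

import Mathlib

open MeasureTheory ProbabilityTheory Filter

noncomputable section

/-- The volume `ω_n` of the Euclidean unit ball of `ℝⁿ`. -/
def ballVolume (n : ℕ) : ℝ :=
  volume.real (Metric.closedBall (0 : EuclideanSpace ℝ (Fin n)) 1)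

/-- The constant `σ_n`, with `σ_n ^ 2 = ω_{n-1} / (2π) ^ n` (used for `n ≥ 2`). -/
def sigmaConst (n : ℕ) : ℝ :=
  Real.sqrt (ballVolume (n - 1) / (2 * Real.pi) ^ n)

/-- The Fourier transform in its unitary normalisation,
`ĝ(ξ) = (2π)^{-n/2} ∫ e^{-i ξ·x} g(x) dx`, of an integrable function `g`. -/
def unitaryFourier {n : ℕ} (g : EuclideanSpace ℝ (Fin n) → ℝ)
    (ξ : EuclideanSpace ℝ (Fin n)) : ℂ :=
  (((2 * Real.pi) ^ (-(n : ℝ) / 2) : ℝ) : ℂ) *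
    ∫ x, Complex.exp (-Complex.I * (inner ℝ ξ x : ℝ)) * (g x : ℂ)

/-- The limiting variance `Σ²(g) = ∫ |ĝ(ξ)|² |ξ| dξ`. -/
def limitVariance {n : ℕ} (g : EuclideanSpace ℝ (Fin n) → ℝ) : NNReal :=
  ⟨∫ ξ, ‖unitaryFourier g ξ‖ ^ 2 * ‖ξ‖, integral_nonneg fun _ => by positivity⟩

/-- The Hilbert space `L²(ℝⁿ; ℂ)`. -/
abbrev L2Space (n : ℕ) : Type := Lp (α := EuclideanSpace ℝ (Fin n)) ℂ 2 volume

/-- The set of frequencies `{ξ : |2πξ|² ≤ μ²}`: in Mathlib's normalisation of the Fourier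
transform (phase `e^{-2πi x·ξ}`), `-Δ` is the multiplication by `|2πξ|²`. -/
def frequencyBall (n : ℕ) (μ : ℝ) : Set (EuclideanSpace ℝ (Fin n)) :=
  {ξ | (2 * Real.pi * ‖ξ‖) ^ 2 ≤ μ ^ 2}

lemma measurableSet_frequencyBall (n : ℕ) (μ : ℝ) : MeasurableSet (frequencyBall n μ) :=
  measurableSet_le (by fun_prop) (by fun_prop)

/-- The multiplication by the indicator function of `frequencyBall n μ`, on `L²`. -/
def frequencyCutoff (n : ℕ) (μ : ℝ) : L2Space n →L[ℂ] L2Space n :=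
  (ContinuousLinearMap.lsmul ℂ ℂ).holderL volume ⊤ 2 2
    (((memLp_top_const (1 : ℂ)).indicator (measurableSet_frequencyBall n μ)).toLp
      ((frequencyBall n μ).indicator fun _ => (1 : ℂ)))

/-- The spectral projector `1_{(-∞, μ²]}(-Δ) = 𝓕⁻¹ ∘ 1_{|2πξ|² ≤ μ²} ∘ 𝓕` on `L²(ℝⁿ)`, where
`𝓕` is the Fourier transform as a unitary operator. -/
def freeLaplacianProjector (n : ℕ) (μ : ℝ) : L2Space n →L[ℂ] L2Space n :=
  ((Lp.fourierTransformₗᵢ (EuclideanSpace ℝ (Fin n)) ℂ).symm.toContinuousLinearEquiv :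
      L2Space n →L[ℂ] L2Space n) ∘L
    frequencyCutoff n μ ∘L
    ((Lp.fourierTransformₗᵢ (EuclideanSpace ℝ (Fin n)) ℂ).toContinuousLinearEquiv :
      L2Space n →L[ℂ] L2Space n)

/-- `K` is an integral kernel of the operator `T`: `(T φ)(x) = ∫ K(x, y) φ(y) dy`. -/
def IsIntegralKernel {n : ℕ}
    (K : EuclideanSpace ℝ (Fin n) → EuclideanSpace ℝ (Fin n) → ℂ)
    (T : L2Space n →L[ℂ] L2Space n) : Prop :=
  ∀ φ : L2Space n, (T φ : EuclideanSpace ℝ (Fin n) → ℂ) =ᵐ[volume] fun x => ∫ y, K x y * φ y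

/-- The Fredholm determinant `det(I - χK)` of a continuous kernel `K` and a bounded, compactly
supported `χ` is `d`, i.e. `d` is the sum of the Fredholm series
`∑_k ((-1)^k / k!) ∫ ∏_i χ(z_i) det[K(z_i, z_j)]_{k × k} dz_1 ⋯ dz_k`. -/
def HasFredholmDet {n : ℕ} (χ : EuclideanSpace ℝ (Fin n) → ℝ)
    (K : EuclideanSpace ℝ (Fin n) → EuclideanSpace ℝ (Fin n) → ℂ) (d : ℂ) : Prop :=
  HasSum (fun k : ℕ => ((-1) ^ k / (k.factorial : ℂ)) *
    ∫ z : Fin k → EuclideanSpace ℝ (Fin n),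
      (∏ i, (χ (z i) : ℂ)) * (Matrix.of fun i j => K (z i) (z j)).det) d

/-- A (simple) point process on `ℝⁿ`: a random measure of the form `∑_{x ∈ Λ} δ_x`, where `Λ`
is a (random) set without accumulation points. -/
structure IsPointProcess {n : ℕ} {Ω : Type*} [MeasurableSpace Ω] (P : Measure Ω)
    (Ξ : Ω → Measure (EuclideanSpace ℝ (Fin n))) : Prop where
  measurable : Measurable Ξ
  simple : ∀ᵐ ω ∂P, ∃ Λ : Set (EuclideanSpace ℝ (Fin n)),
    (∀ C, IsCompact C → (Λ ∩ C).Finite) ∧ Ξ ω = Measure.sum fun x : Λ => Measure.dirac x.1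

/-- `Ξ` is a determinantal point process associated with the operator `T` (an operator with a
continuous, hence unique and everywhere defined, integral kernel `K`): its Laplace functional is
`E[e^{-Ξ(f)}] = det(I - (1 - e^{-f}) T)` for all `f ∈ C_c^∞(ℝⁿ; [0, ∞))`. -/
structure IsDeterminantalProcess {n : ℕ} {Ω : Type*} [MeasurableSpace Ω] (P : Measure Ω)
    (Ξ : Ω → Measure (EuclideanSpace ℝ (Fin n)))
    (T : L2Space n →L[ℂ] L2Space n) : Prop where
  isPointProcess : IsPointProcess P Ξ
  laplace : ∃ K : EuclideanSpace ℝ (Fin n) → EuclideanSpace ℝ (Fin n) → ℂ,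
    Continuous (Function.uncurry K) ∧ IsIntegralKernel K T ∧
    ∀ f : EuclideanSpace ℝ (Fin n) → ℝ, ContDiff ℝ ((⊤ : ℕ∞) : WithTop ℕ∞) f →
      HasCompactSupport f → (∀ x, 0 ≤ f x) →
      HasFredholmDet (fun x => 1 - Real.exp (-f x)) K
        ((∫ ω, Real.exp (-∫ x, f x ∂(Ξ ω)) ∂P : ℝ) : ℂ)

end

/-! A linear statistic of a determinantal process with projection kernel `K` has variance
`tr(f(1-K)fK)`, half the squared Hilbert–Schmidt norm of the commutator `[f, K]`. For bounded `f`
its characteristic function is Gaussian up to a third-order error that is only linear in this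
variance `V`. When `V` diverges, times of order `V^(-1/2)` therefore give a central limit theorem.

The matrix form is `norm_tiltDet_sub_gaussian_le`. For a projection `P` and a real diagonal `D`
bounded by `B`, put `φ(t) = det(1 + (e^{itD} - 1)P)`. Its logarithmic derivative is `i tr(D Q_t)`,
where `Q_t = e^{itD} P (1 + (e^{itD} - 1)P)⁻¹` is again idempotent, and the derivative of `tr(D
Q_t)` is `i` times the variance of `D` under `Q_t`. Any such variance equals `-1/2 tr [D, Q_t]²`,
and `[D, Q_t]` is `[D, P]` up to a relative error `O(tB)`. Hence `(log φ)'' = -V(1 + O(tB))`, and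
the error is at most `40 B t³ V`, whatever the size of the matrix. Dilating to a projection extends
this to contractions `0 ≤ M ≤ 1`.

With `r = μ/(2π)`, the kernel of the spectral projector is the Fourier integral over the ball of
radius `r`, evaluated at `x - y` (`eq_ballKernel_of_isIntegralKernel`). Sampled on `hℤⁿ` with `hr <
1/2` it becomes such a contraction, because the rescaled ball fits into one period cell. Letting `h
→ 0` in the Fredholm series yields `norm_ballFredholm_sub_gaussian_le`. The hypothesis only gives
Laplace transforms of nonnegative functions; analytic continuation turns them into characteristic
functions (`HasBallLaplace.integral_cexp`).

By Plancherel the variance is the integral of `|ĝ(ζ)|²` times the volume of the ball minus its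
translate by `ζ`. That volume is at most `ω_{n-1} r^{n-1} |ζ|`, and asymptotic to it. Thus the
weight `|ζ|`, and with it `H^{1/2}`, governs the limit.

The function `g` may be neither smooth nor bounded. The bound on the intensity measure makes `X(g)`
meaningful. For mollifications `h_k`, the variance of `X(g - h_k)` is at most `r^{n-1}` times a
quantity independent of `r` that vanishes as `k → ∞`. So `g` is replaced by `h_k` at a cost uniform
in `r`; first `r → ∞`, then `k → ∞`. -/

/-! ### Hilbert–Schmidt and operator norms of matrices -/

section HilbertSchmidt
open Matrix
open scoped Matrix.Norms.L2Operator

variable {ι : Type*} [Fintype ι]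

/-- The Hilbert–Schmidt norm of a square matrix. -/
noncomputable def hsNorm (X : Matrix ι ι ℂ) : ℝ :=
  ‖(WithLp.toLp 2 (fun p : ι × ι => X p.1 p.2) : EuclideanSpace ℂ (ι × ι))‖

lemma hsNorm_nonneg (X : Matrix ι ι ℂ) : 0 ≤ hsNorm X := norm_nonneg _

lemma hsNorm_add_le (X Y : Matrix ι ι ℂ) : hsNorm (X + Y) ≤ hsNorm X + hsNorm Y := by
  have h := norm_add_le (WithLp.toLp 2 (fun p : ι × ι => X p.1 p.2) : EuclideanSpace ℂ (ι × ι))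
    (WithLp.toLp 2 (fun p : ι × ι => Y p.1 p.2))
  rwa [← WithLp.toLp_add] at h

lemma hsNorm_sub_le (X Y : Matrix ι ι ℂ) : hsNorm (X - Y) ≤ hsNorm X + hsNorm Y := by
  have h := norm_sub_le (WithLp.toLp 2 (fun p : ι × ι => X p.1 p.2) : EuclideanSpace ℂ (ι × ι))
    (WithLp.toLp 2 (fun p : ι × ι => Y p.1 p.2))
  rwa [← WithLp.toLp_sub] at h

lemma hsNorm_sq (X : Matrix ι ι ℂ) : hsNorm X ^ 2 = ∑ i, ∑ j, ‖X i j‖ ^ 2 := by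
  rw [hsNorm, EuclideanSpace.norm_sq_eq, Fintype.sum_prod_type]

lemma hsNorm_conjTranspose (X : Matrix ι ι ℂ) : hsNorm Xᴴ = hsNorm X := by
  rw [← sq_eq_sq₀ (hsNorm_nonneg _) (hsNorm_nonneg _), hsNorm_sq, hsNorm_sq, Finset.sum_comm]
  simp [Matrix.conjTranspose_apply]

lemma norm_trace_mul_le_hsNorm (X Y : Matrix ι ι ℂ) :
    ‖(X * Y).trace‖ ≤ hsNorm X * hsNorm Y := by
  rw [← hsNorm_conjTranspose Y, Matrix.trace]
  simp only [Matrix.diag_apply, Matrix.mul_apply]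
  rw [← Fintype.sum_prod_type (f := fun p : ι × ι => X p.1 p.2 * Y p.2 p.1)]
  have := norm_inner_le_norm (𝕜 := ℂ)
    (WithLp.toLp 2 (fun p : ι × ι => star (Y p.2 p.1)) : EuclideanSpace ℂ (ι × ι))
    (WithLp.toLp 2 (fun p : ι × ι => X p.1 p.2) : EuclideanSpace ℂ (ι × ι))
  rw [mul_comm, PiLp.inner_apply] at this
  simpa [hsNorm, Matrix.conjTranspose_apply] using this

variable [DecidableEq ι]

lemma hsNorm_mul_le_left (X Y : Matrix ι ι ℂ) : hsNorm (X * Y) ≤ ‖X‖ * hsNorm Y := by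
  have h := hsNorm_nonneg Y
  rw [← sq_le_sq₀ (hsNorm_nonneg _) (by positivity), mul_pow, hsNorm_sq, hsNorm_sq,
    Finset.sum_comm, Finset.sum_comm (f := fun i j => ‖Y i j‖ ^ 2), Finset.mul_sum]
  refine Finset.sum_le_sum fun j _ => ?_
  have := Matrix.l2_opNorm_mulVec X (WithLp.toLp 2 fun i => Y i j)
  rw [← sq_le_sq₀ (norm_nonneg _) (by positivity), mul_pow, EuclideanSpace.norm_sq_eq,
    EuclideanSpace.norm_sq_eq] at this
  exact this

lemma hsNorm_mul_le_right (X Y : Matrix ι ι ℂ) : hsNorm (X * Y) ≤ hsNorm X * ‖Y‖ := by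
  rw [← hsNorm_conjTranspose, Matrix.conjTranspose_mul, ← hsNorm_conjTranspose X,
    ← Matrix.l2_opNorm_conjTranspose Y, mul_comm]
  exact hsNorm_mul_le_left _ _

lemma l2_opNorm_one_le : ‖(1 : Matrix ι ι ℂ)‖ ≤ 1 := by
  rw [← Matrix.diagonal_one, Matrix.l2_opNorm_diagonal]
  exact (pi_norm_le_iff_of_nonneg zero_le_one).2 fun i => by simp

/-- The C*-identity reads `‖P‖ = ‖P‖²`. -/
lemma l2_opNorm_le_one_of_projection {P : Matrix ι ι ℂ} (hP : Pᴴ = P) (hPP : P * P = P) :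
    ‖P‖ ≤ 1 := by
  have h := Matrix.l2_opNorm_conjTranspose_mul_self P
  rw [hP, hPP] at h
  by_contra hlt
  nlinarith

end HilbertSchmidt

/-! ### Derivative of a determinant -/

section Jacobi
open Matrix
open scoped Matrix.Norms.L2Operator
variable {ι : Type*} [Fintype ι] [DecidableEq ι]

/-- Jacobi's formula. -/
lemma hasDerivAt_matrix_det {A : ℝ → Matrix ι ι ℂ} {A' : Matrix ι ι ℂ} {t : ℝ}
    (h : ∀ i j, HasDerivAt (fun s => A s i j) (A' i j) t) :
    HasDerivAt (fun s => (A s).det) ((A t).adjugate * A').trace t := by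
  have key : HasDerivAt (fun s => (A s).det)
      (∑ σ : Equiv.Perm ι, (((Equiv.Perm.sign σ : ℤ)) : ℂ) *
        ∑ i, (∏ j ∈ Finset.univ.erase i, A t (σ j) j) * A' (σ i) i) t := by
    simp only [Matrix.det_apply']
    refine HasDerivAt.fun_sum fun σ _ => HasDerivAt.const_mul _ ?_
    simpa using HasDerivAt.fun_finsetProd (u := Finset.univ) fun i _ => h (σ i) i
  convert key using 1
  simp only [Finset.mul_sum]
  rw [Finset.sum_comm, Matrix.trace]
  refine Finset.sum_congr rfl fun i _ => ?_
  have h1 : ((A t).adjugate * A').diag i = ((A t).updateCol i fun k => A' k i).det := by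
    rw [← Matrix.cramer_apply, Matrix.cramer_eq_adjugate_mulVec]
    simp [Matrix.mul_apply, Matrix.mulVec, dotProduct]
  rw [h1, Matrix.det_apply']
  refine Finset.sum_congr rfl fun σ _ => ?_
  rw [← Finset.prod_erase_mul _ _ (Finset.mem_univ i)]
  congr 2
  · refine Finset.prod_congr rfl fun j hj => ?_
    rw [Matrix.updateCol_ne (Finset.ne_of_mem_erase hj)]
  · simp
end Jacobi

/-! ### Stability of the variance under an exponential tilt -/

section TiltedProjection
open Matrix
open scoped Matrix.Norms.L2Operator
variable {ι : Type*} [Fintype ι] [DecidableEq ι]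

/-- Only idempotence and cyclicity of the trace enter. This matters because the tilted projection is
not Hermitian. The commutator form makes the variance quadratic in an object controlled in
Hilbert–Schmidt norm. -/
lemma trace_mul_one_sub_mul_of_idempotent {Q : Matrix ι ι ℂ} (hQ : Q * Q = Q)
    (D : Matrix ι ι ℂ) :
    (D * (1 - Q) * D * Q).trace
      = -(1 / 2) * ((D * Q - Q * D) * (D * Q - Q * D)).trace := by
  have h1 : D * (1 - Q) * D * Q = D * D * Q - D * Q * D * Q := by noncomm_ring
  have h2 : (D * Q - Q * D) * (D * Q - Q * D)
      = D * Q * D * Q - D * (Q * Q) * D - Q * D * D * Q + Q * D * Q * D := by noncomm_ring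
  have h3 : (D * Q * D).trace = (D * D * Q).trace := by
    rw [Matrix.trace_mul_comm, ← mul_assoc]
  have h4 : (Q * D * D * Q).trace = (D * D * Q).trace := by
    rw [Matrix.trace_mul_comm, ← mul_assoc, ← mul_assoc, hQ, mul_assoc, Matrix.trace_mul_comm]
  have h5 : (Q * D * Q * D).trace = (D * Q * D * Q).trace := by
    rw [mul_assoc, mul_assoc, Matrix.trace_mul_comm]
    simp only [mul_assoc]
  rw [h1, h2, hQ, Matrix.trace_add, Matrix.trace_sub, Matrix.trace_sub, Matrix.trace_sub, h3, h4,
    h5]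
  ring

/-- The equation reads `Ai - 1 = -(E - 1) P Ai`, so `‖Ai - 1‖ ≤ δ‖Ai‖`. With `δ ≤ 1/2` this bounds
`‖Ai‖` in terms of itself. -/
lemma norm_inverse_tilt_le {P E Ai : Matrix ι ι ℂ} {δ : ℝ} (hP : ‖P‖ ≤ 1) (hE : ‖E - 1‖ ≤ δ)
    (hδ : δ ≤ 1 / 2) (h : (1 + (E - 1) * P) * Ai = 1) :
    ‖Ai‖ ≤ 2 ∧ ‖Ai - 1‖ ≤ 2 * δ := by
  have h1 : Ai - 1 = -((E - 1) * (P * Ai)) := by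
    rw [add_mul, one_mul] at h
    rw [← mul_assoc, eq_neg_iff_add_eq_zero, sub_add_eq_add_sub, h, sub_self]
  have h2 : ‖Ai - 1‖ ≤ δ * ‖Ai‖ := by
    rw [h1, norm_neg]
    calc _ ≤ ‖E - 1‖ * (‖P‖ * ‖Ai‖) :=
          (norm_mul_le _ _).trans (by gcongr; exact norm_mul_le _ _)
      _ ≤ δ * (1 * ‖Ai‖) := by gcongr; exact (norm_nonneg _).trans hE
      _ = _ := by rw [one_mul]
  have h3 : ‖Ai‖ ≤ ‖Ai - 1‖ + ‖(1 : Matrix ι ι ℂ)‖ := by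
    simpa using norm_add_le (Ai - 1) 1
  have h4 := l2_opNorm_one_le (ι := ι)
  have h5 : 0 ≤ δ := (norm_nonneg _).trans hE
  have h6 : ‖Ai‖ ≤ 2 := by nlinarith [norm_nonneg Ai]
  exact ⟨h6, h2.trans (by nlinarith)⟩

/-- If `P` is an idempotent contraction, `E` is close to `1`, and `Q = E P (1 + (E - 1) P)⁻¹`, then
the variances of `D` with respect to `Q` and `P` are close. -/
lemma norm_trace_tilt_sub_le {P D E Ai : Matrix ι ι ℂ} {δ : ℝ} (hP : ‖P‖ ≤ 1) (hPP : P * P = P)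
    (hDE : D * E = E * D) (hE1 : ‖E‖ ≤ 1) (hE : ‖E - 1‖ ≤ δ) (hδ : δ ≤ 1 / 2)
    (h : (1 + (E - 1) * P) * Ai = 1) :
    ‖(D * (1 - E * P * Ai) * D * (E * P * Ai)).trace - (D * (1 - P) * D * P).trace‖
      ≤ 20 * δ * hsNorm (D * P - P * D) ^ 2 := by
  obtain ⟨hA1, hA2⟩ := norm_inverse_tilt_le hP hE hδ h
  have hδ0 : 0 ≤ δ := (norm_nonneg _).trans hE
  have h' : Ai * (1 + (E - 1) * P) = 1 := mul_eq_one_comm.1 h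
  -- Idempotence of `P` makes `Ai` carry `E P` back to `P`. Hence `Q` is idempotent, though oblique.
  have hAP : (1 + (E - 1) * P) * P = E * P := by
    have : (1 + (E - 1) * P) * P = P + (E - 1) * (P * P) := by noncomm_ring
    rw [this, hPP]; noncomm_ring
  have hAEP : Ai * (E * P) = P := by rw [← hAP, ← mul_assoc, h', one_mul]
  set Q := E * P * Ai with hQdef
  have hQQ : Q * Q = Q := by
    have : Q * Q = E * P * (Ai * (E * P)) * Ai := by rw [hQdef]; noncomm_ring
    rw [this, hAEP, mul_assoc E P P, hPP]
  have hQn : ‖Q‖ ≤ 2 := by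
    calc _ ≤ ‖E‖ * ‖P‖ * ‖Ai‖ :=
          (norm_mul_le _ _).trans (by gcongr; exact norm_mul_le _ _)
      _ ≤ 1 * 1 * 2 := by gcongr
      _ = 2 := by norm_num
  set C0 := D * P - P * D with hC0
  set C := D * Q - Q * D with hCdef
  -- The commutator with an inverse is `Ai [A, D] Ai`, where `A = 1 + (E - 1) P`. Since `D` commutes
  -- with `E`, only `[D, P]` survives.
  have hcomm : D * Ai - Ai * D = -(Ai * ((E - 1) * C0) * Ai) := by
    have e1 : D * Ai - Ai * D
        = Ai * ((1 + (E - 1) * P) * D - D * (1 + (E - 1) * P)) * Ai := by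
      have : Ai * ((1 + (E - 1) * P) * D - D * (1 + (E - 1) * P)) * Ai
          = (Ai * (1 + (E - 1) * P)) * D * Ai - Ai * D * ((1 + (E - 1) * P) * Ai) := by
        noncomm_ring
      rw [this, h, h']; noncomm_ring
    have e2 : (1 + (E - 1) * P) * D - D * (1 + (E - 1) * P) = -((E - 1) * C0) := by
      have : (1 + (E - 1) * P) * D - D * (1 + (E - 1) * P) + (E - 1) * C0
        = (E * D - D * E) * P := by rw [hC0]; noncomm_ring
      rw [eq_neg_iff_add_eq_zero, this, hDE, sub_self, zero_mul]
    rw [e1, e2]; noncomm_ring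
  -- By the Leibniz rule, `[D, Q]` is `[D, P]` multiplied by `E - Q(E - 1)` on the left and `Ai` on
  -- the right. Both factors are within `O(δ)` of `1`.
  have hC : C = E * C0 * Ai - Q * (E - 1) * C0 * Ai := by
    have e1 : C = (D * E - E * D) * (P * Ai) + E * C0 * Ai + E * P * (D * Ai - Ai * D) := by
      rw [hCdef, hQdef, hC0]; noncomm_ring
    rw [e1, hDE, sub_self, zero_mul, zero_add, hcomm, hQdef]; noncomm_ring
  set a := hsNorm C0 with ha
  have ha0 : 0 ≤ a := hsNorm_nonneg _
  have b1 : hsNorm (Q * (E - 1) * C0 * Ai) ≤ 4 * δ * a := by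
    calc _ ≤ ‖Q * (E - 1)‖ * a * ‖Ai‖ :=
          (hsNorm_mul_le_right _ _).trans (by gcongr; exact hsNorm_mul_le_left _ _)
      _ ≤ (2 * δ) * a * 2 := by
          gcongr
          exact (norm_mul_le _ _).trans (by gcongr)
      _ = _ := by ring
  have b2 : hsNorm (E * C0 * Ai) ≤ 2 * a := by
    calc _ ≤ ‖E‖ * a * ‖Ai‖ :=
          (hsNorm_mul_le_right _ _).trans (by gcongr; exact hsNorm_mul_le_left _ _)
      _ ≤ 1 * a * 2 := by gcongr
      _ = _ := by ring
  have b3 : hsNorm C ≤ 4 * a := by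
    rw [hC]
    refine (hsNorm_sub_le _ _).trans ?_
    nlinarith [mul_nonneg hδ0 ha0]
  have b4 : hsNorm (C - C0) ≤ 8 * δ * a := by
    have : C - C0 = ((E - 1) * C0 * Ai + C0 * (Ai - 1)) - Q * (E - 1) * C0 * Ai := by
      rw [hC]; noncomm_ring
    rw [this]
    refine (hsNorm_sub_le _ _).trans ?_
    have c1 : hsNorm ((E - 1) * C0 * Ai) ≤ 2 * δ * a := by
      calc _ ≤ ‖E - 1‖ * a * ‖Ai‖ :=
            (hsNorm_mul_le_right _ _).trans (by gcongr; exact hsNorm_mul_le_left _ _)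
        _ ≤ δ * a * 2 := by gcongr
        _ = _ := by ring
    have c2 : hsNorm (C0 * (Ai - 1)) ≤ 2 * δ * a := by
      calc _ ≤ a * ‖Ai - 1‖ := hsNorm_mul_le_right _ _
        _ ≤ a * (2 * δ) := by gcongr
        _ = _ := by ring
    linarith [hsNorm_add_le ((E - 1) * C0 * Ai) (C0 * (Ai - 1))]
  rw [trace_mul_one_sub_mul_of_idempotent hQQ, trace_mul_one_sub_mul_of_idempotent hPP, ← mul_sub,
    ← Matrix.trace_sub, norm_mul]
  -- The two terms contribute `8δa · 4a` and `a · 8δa`. Their sum `40 δ a²` is halved by the factor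
  -- `-1/2` in the trace identity.
  have e : C * C - C0 * C0 = (C - C0) * C + C0 * (C - C0) := by noncomm_ring
  have b5 : ‖(C * C - C0 * C0).trace‖ ≤ 40 * δ * a ^ 2 := by
    rw [e, Matrix.trace_add]
    refine (norm_add_le _ _).trans ?_
    have d1 := norm_trace_mul_le_hsNorm (C - C0) C
    have d2 := norm_trace_mul_le_hsNorm C0 (C - C0)
    have d3 : hsNorm (C - C0) * hsNorm C ≤ 8 * δ * a * (4 * a) := by
      gcongr; exact hsNorm_nonneg _
    have d4 : hsNorm C0 * hsNorm (C - C0) ≤ a * (8 * δ * a) := by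
      gcongr
    nlinarith
  have : ‖(-(1 / 2) : ℂ)‖ = 1 / 2 := by norm_num
  rw [this]
  linarith

/-- For Hermitian `P` and `D` the commutator is skew-Hermitian, so minus the trace of its square is
its squared Hilbert–Schmidt norm. The variance thus controls the size of `[D, P]`, which closes the
estimate on the tilted variance. -/
lemma hsNorm_commutator_sq {P : Matrix ι ι ℂ} (hP : Pᴴ = P) (hPP : P * P = P)
    {D : Matrix ι ι ℂ} (hD : Dᴴ = D) :
    (D * (1 - P) * D * P).trace = ((hsNorm (D * P - P * D) ^ 2 / 2 : ℝ) : ℂ) := by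
  rw [trace_mul_one_sub_mul_of_idempotent hPP, hsNorm_sq]
  set C0 := D * P - P * D
  have h1 : C0ᴴ = -C0 := by simp [C0, Matrix.conjTranspose_mul, hP, hD]
  have h2 : (C0 * C0).trace = -∑ i, ∑ j, ((‖C0 i j‖ ^ 2 : ℝ) : ℂ) := by
    have : C0 * C0 = -(C0 * C0ᴴ) := by rw [h1]; noncomm_ring
    rw [this, Matrix.trace_neg, Matrix.trace]
    congr 1
    refine Finset.sum_congr rfl fun i _ => ?_
    rw [Matrix.diag_apply, Matrix.mul_apply]
    refine Finset.sum_congr rfl fun j _ => ?_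
    rw [Matrix.conjTranspose_apply, Complex.star_def, Complex.mul_conj, Complex.normSq_eq_norm_sq]
  rw [h2]
  push_cast
  ring

end TiltedProjection

/-! ### The generating function of a finite determinantal statistic and its derivatives -/

section ProjectionDeterminant
open Matrix
open scoped Matrix.Norms.L2Operator
variable {ι : Type*} [Fintype ι] [DecidableEq ι]

/-- The diagonal unitary matrix `e^{itD}`. -/
noncomputable def phaseMatrix (d : ι → ℝ) (t : ℝ) : Matrix ι ι ℂ :=
  Matrix.diagonal fun i => Complex.exp (Complex.I * t * d i)

/-- The real diagonal matrix with entries `d`. -/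
noncomputable def realDiagonal (d : ι → ℝ) : Matrix ι ι ℂ :=
  Matrix.diagonal fun i => (d i : ℂ)

lemma diagonal_eq_sum_single' (v : ι → ℂ) :
    Matrix.diagonal v = ∑ i, Matrix.single i i (v i) := by
  ext a b
  rw [Matrix.sum_apply, Matrix.diagonal_apply]
  split_ifs with h
  · subst h
    rw [Finset.sum_eq_single a] <;> simp +contextual
  · refine (Finset.sum_eq_zero fun i _ => ?_).symm
    rw [Matrix.single_apply, if_neg]
    rintro ⟨rfl, rfl⟩
    exact h rfl

lemma hasDerivAt_phaseMatrix (d : ι → ℝ) (t : ℝ) :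
    HasDerivAt (phaseMatrix d) (Complex.I • (realDiagonal d * phaseMatrix d t)) t := by
  have h1 : phaseMatrix d = fun s : ℝ =>
      ∑ i, Complex.exp (Complex.I * s * d i) • Matrix.single i i (1 : ℂ) := by
    funext s
    simp [phaseMatrix, Matrix.smul_single, diagonal_eq_sum_single']
  have h2 : Complex.I • (realDiagonal d * phaseMatrix d t)
      = ∑ i, (Complex.exp (Complex.I * t * d i) * (Complex.I * d i)) •
        Matrix.single i i (1 : ℂ) := by
    rw [realDiagonal, phaseMatrix, Matrix.diagonal_mul_diagonal, ← Matrix.diagonal_smul,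
      diagonal_eq_sum_single']
    refine Finset.sum_congr rfl fun i _ => ?_
    rw [Matrix.smul_single]
    congr 1
    simp [smul_eq_mul]; ring
  rw [h2, h1]
  refine HasDerivAt.fun_sum fun i _ => HasDerivAt.smul_const ?_ _
  have h3 : HasDerivAt (fun s : ℝ => Complex.I * (s : ℂ) * (d i : ℂ)) (Complex.I * d i) t := by
    simpa using ((Complex.ofRealCLM.hasDerivAt (x := t)).const_mul Complex.I).mul_const (d i : ℂ)
  exact h3.cexp

lemma norm_phaseMatrix_le (d : ι → ℝ) (t : ℝ) : ‖phaseMatrix d t‖ ≤ 1 := by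
  rw [phaseMatrix, Matrix.l2_opNorm_diagonal]
  refine (pi_norm_le_iff_of_nonneg zero_le_one).2 fun i => le_of_eq ?_
  rw [mul_assoc, mul_comm, ← Complex.ofReal_mul, Complex.norm_exp_ofReal_mul_I]

lemma norm_phaseMatrix_sub_one_le {d : ι → ℝ} {B : ℝ} (hB : 0 ≤ B) (hd : ∀ i, |d i| ≤ B) (t : ℝ) :
    ‖phaseMatrix d t - 1‖ ≤ |t| * B := by
  rw [phaseMatrix, ← Matrix.diagonal_one, Matrix.diagonal_sub, Matrix.l2_opNorm_diagonal]
  refine (pi_norm_le_iff_of_nonneg (by positivity)).2 fun i => ?_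
  rw [mul_assoc, ← Complex.ofReal_mul]
  refine Real.norm_exp_I_mul_ofReal_sub_one_le.trans ?_
  rw [Real.norm_eq_abs, abs_mul]
  gcongr
  exact hd i

/-- The generating function `det(1 + (e^{itD} - 1) P)`. -/
noncomputable def tiltDet (P : Matrix ι ι ℂ) (d : ι → ℝ) (t : ℝ) : ℂ :=
  (1 + (phaseMatrix d t - 1) * P).det

lemma isUnit_tilt {P : Matrix ι ι ℂ} (hPn : ‖P‖ ≤ 1) {d : ι → ℝ} {B : ℝ} (hB : 0 ≤ B)
    (hd : ∀ i, |d i| ≤ B) {t : ℝ} (ht : |t| * B ≤ 1 / 2) :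
    IsUnit (1 + (phaseMatrix d t - 1) * P) := by
  have : 1 + (phaseMatrix d t - 1) * P = 1 - -((phaseMatrix d t - 1) * P) := by rw [sub_neg_eq_add]
  rw [this]
  apply isUnit_one_sub_of_norm_lt_one
  rw [norm_neg]
  calc _ ≤ ‖phaseMatrix d t - 1‖ * ‖P‖ := norm_mul_le _ _
    _ ≤ (1 / 2) * 1 := by
        gcongr; exact (norm_phaseMatrix_sub_one_le hB hd t).trans ht
    _ < 1 := by norm_num

lemma hasDerivAt_tilt (P : Matrix ι ι ℂ) (d : ι → ℝ) (t : ℝ) :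
    HasDerivAt (fun s => 1 + (phaseMatrix d s - 1) * P)
      (Complex.I • (realDiagonal d * phaseMatrix d t) * P) t :=
  (((hasDerivAt_phaseMatrix d t).sub_const 1).mul_const P).const_add 1

/-- Jacobi's formula with the adjugate written as determinant times inverse: the logarithmic
derivative is `i` times the mean of `D` under the tilted projection. -/
lemma hasDerivAt_tiltDet {P : Matrix ι ι ℂ} {d : ι → ℝ} {t : ℝ}
    (h : IsUnit (1 + (phaseMatrix d t - 1) * P)) :
    HasDerivAt (tiltDet P d)
      (tiltDet P d t * (Complex.I * (realDiagonal d *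
        (phaseMatrix d t * P * (1 + (phaseMatrix d t - 1) * P)⁻¹)).trace)) t := by
  have hA := hasDerivAt_tilt P d t
  have h1 := hasDerivAt_matrix_det (A := fun s => 1 + (phaseMatrix d s - 1) * P)
    (A' := Complex.I • (realDiagonal d * phaseMatrix d t) * P) (t := t) (fun i j => by
      have := (Matrix.entryLinearMap ℝ ℂ i j).toContinuousLinearMap.hasFDerivAt.comp_hasDerivAt t hA
      exact this)
  refine HasDerivAt.congr_deriv h1 ?_
  set A := 1 + (phaseMatrix d t - 1) * P with hAdef
  have hdet : IsUnit A.det := (Matrix.isUnit_iff_isUnit_det _).1 h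
  have hadj : A.adjugate = A.det • A⁻¹ := by
    rw [Matrix.inv_def, smul_smul, Ring.mul_inverse_cancel _ hdet, one_smul]
  change (A.adjugate * _).trace = _
  rw [hadj, Matrix.smul_mul, Matrix.trace_smul, smul_mul_assoc, Matrix.mul_smul, Matrix.trace_smul,
    Matrix.trace_mul_comm A⁻¹]
  simp only [tiltDet, smul_eq_mul, mul_assoc, hAdef]

/-- The tilted projection solves `Q' = i(1 - Q) D Q`. The mean therefore moves at a rate given by
the variance. -/
lemma hasDerivAt_trace_tilt {P : Matrix ι ι ℂ} {d : ι → ℝ} {t : ℝ}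
    (h : IsUnit (1 + (phaseMatrix d t - 1) * P)) :
    HasDerivAt (fun s => (realDiagonal d *
        (phaseMatrix d s * P * (1 + (phaseMatrix d s - 1) * P)⁻¹)).trace)
      (Complex.I * (realDiagonal d * (1 - phaseMatrix d t * P * (1 + (phaseMatrix d t - 1) * P)⁻¹) *
        realDiagonal d * (phaseMatrix d t * P * (1 + (phaseMatrix d t - 1) * P)⁻¹)).trace) t := by
  have hA := hasDerivAt_tilt P d t
  obtain ⟨u, hu⟩ := h
  have hinv : HasDerivAt (fun s => (1 + (phaseMatrix d s - 1) * P)⁻¹)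
      (-((1 + (phaseMatrix d t - 1) * P)⁻¹ * (Complex.I • (realDiagonal d * phaseMatrix d t) * P) *
        (1 + (phaseMatrix d t - 1) * P)⁻¹)) t := by
    have h1 := hasFDerivAt_ringInverse (𝕜 := ℝ) u
    rw [hu] at h1
    have h2 := h1.comp_hasDerivAt t hA
    simp only [Matrix.nonsing_inv_eq_ringInverse]
    refine HasDerivAt.congr_deriv h2 ?_
    rw [← hu, Ring.inverse_unit]
    simp
  have h3 := (((hasDerivAt_phaseMatrix d t).mul_const P).mul hinv).const_mul (realDiagonal d)
  have h4 := (Matrix.traceLinearMap ι ℝ ℂ).toContinuousLinearMap.hasFDerivAt.comp_hasDerivAt t h3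
  refine HasDerivAt.congr_deriv h4 ?_
  change Matrix.trace _ = _
  rw [← smul_eq_mul (a := Complex.I), ← Matrix.trace_smul]
  congr 1
  simp only [smul_mul_assoc, mul_smul_comm, ← smul_neg, ← smul_add]
  congr 1
  noncomm_ring

end ProjectionDeterminant

/-! ### Gaussian approximation for projections and contractions -/

section Gaussian
open Matrix
open scoped Matrix.Norms.L2Operator ComplexOrder
variable {ι : Type*} [Fintype ι] [DecidableEq ι]

/-- Quantitative Gaussian approximation of the generating function attached to a projection. -/
lemma norm_tiltDet_sub_gaussian_le {P : Matrix ι ι ℂ} (hP : Pᴴ = P) (hPP : P * P = P) {d : ι → ℝ}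
    {B T m V : ℝ} (hB : 0 ≤ B) (hd : ∀ i, |d i| ≤ B) (hT : 0 ≤ T) (hBT : 192 * (B * T) ≤ 1)
    (hm : (realDiagonal d * P).trace = m)
    (hV : (realDiagonal d * (1 - P) * realDiagonal d * P).trace = V) :
    ‖tiltDet P d T * Complex.exp (-(Complex.I * T * m)) - Real.exp (-(T ^ 2 * V / 2))‖
      ≤ 40 * B * T ^ 3 * V := by
  have hPn := l2_opNorm_le_one_of_projection hP hPP
  have hDD : (realDiagonal d)ᴴ = realDiagonal d := by
    rw [realDiagonal, Matrix.diagonal_conjTranspose]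
    congr 1; funext i; simp
  have hVC : V = hsNorm (realDiagonal d * P - P * realDiagonal d) ^ 2 / 2 := by
    have := hsNorm_commutator_sq hP hPP hDD
    rw [hV] at this
    exact_mod_cast this
  have hV0 : 0 ≤ V := by rw [hVC]; positivity
  have hsm : ∀ t ∈ Set.Icc (0 : ℝ) T, |t| * B ≤ 1 / 2 := fun t ht => by
    rw [abs_of_nonneg ht.1]; nlinarith [ht.2]
  have hunit : ∀ t ∈ Set.Icc (0 : ℝ) T, IsUnit (1 + (phaseMatrix d t - 1) * P) :=
    fun t ht => isUnit_tilt hPn hB hd (hsm t ht)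
  have hz : phaseMatrix d 0 = 1 := by simp [phaseMatrix]
  set Q : ℝ → Matrix ι ι ℂ :=
    fun s => phaseMatrix d s * P * (1 + (phaseMatrix d s - 1) * P)⁻¹ with hQ
  set q : ℝ → ℂ := fun s => (realDiagonal d * Q s).trace with hq
  have hQ0 : Q 0 = P := by simp [hQ, hz]
  have hq0 : q 0 = m := by rw [hq]; simp only [hQ0]; exact hm
  -- The stability bound is `20 δ ‖[D, P]‖²`, used here with `δ = tB` and `‖[D, P]‖² = 2V`.
  have hv : ∀ t ∈ Set.Icc (0 : ℝ) T,
      ‖(realDiagonal d * (1 - Q t) * realDiagonal d * Q t).trace - V‖ ≤ 40 * B * T * V := by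
    intro t ht
    have hA : (1 + (phaseMatrix d t - 1) * P) * (1 + (phaseMatrix d t - 1) * P)⁻¹ = 1 :=
      Matrix.mul_nonsing_inv _ ((Matrix.isUnit_iff_isUnit_det _).1 (hunit t ht))
    have hcomm : realDiagonal d * phaseMatrix d t = phaseMatrix d t * realDiagonal d := by
      simp [realDiagonal, phaseMatrix, mul_comm]
    have := norm_trace_tilt_sub_le hPn hPP hcomm (norm_phaseMatrix_le d t)
      (norm_phaseMatrix_sub_one_le hB hd t) (hsm t ht) hA
    rw [hV] at this
    refine this.trans ?_
    rw [abs_of_nonneg ht.1, show hsNorm (realDiagonal d * P - P * realDiagonal d) ^ 2 = 2 * V by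
      rw [hVC]; ring]
    nlinarith [mul_le_mul_of_nonneg_right ht.2 (mul_nonneg hB hV0)]
  -- This is the logarithmic derivative of the ratio `G` between `φ(t)e^{-itm}` and the Gaussian. It
  -- vanishes at `0`, and its derivative is the variance error just bounded.
  set r : ℝ → ℂ := fun s => Complex.I * (q s - m) + s * V with hr
  have hr' : ∀ t ∈ Set.Icc (0 : ℝ) T, HasDerivAt r
      (-((realDiagonal d * (1 - Q t) * realDiagonal d * Q t).trace - V)) t := by
    intro t ht
    have h1 := ((hasDerivAt_trace_tilt (hunit t ht)).sub_const (m : ℂ)).const_mul Complex.I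
    have h2 : HasDerivAt (fun s : ℝ => (s : ℂ) * (V : ℂ)) V t := by
      simpa using (Complex.ofRealCLM.hasDerivAt (x := t)).mul_const (V : ℂ)
    refine (h1.add h2).congr_deriv ?_
    rw [← mul_assoc, Complex.I_mul_I]
    ring
  have hrb : ∀ t ∈ Set.Icc (0 : ℝ) T, ‖r t‖ ≤ 40 * B * T ^ 2 * V := by
    intro t ht
    have h1 := Convex.norm_image_sub_le_of_norm_hasDerivWithin_le (f := r) (s := Set.Icc 0 T)
      (C := 40 * B * T * V) (x := 0) (y := t) (fun x hx => (hr' x hx).hasDerivWithinAt)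
      (fun x hx => by rw [norm_neg]; exact hv x hx) (convex_Icc 0 T) ⟨le_rfl, hT⟩ ht
    have h2 : r 0 = 0 := by simp [hr, hq0]
    rw [h2, sub_zero, sub_zero, Real.norm_eq_abs, abs_of_nonneg ht.1] at h1
    refine h1.trans ?_
    have : 0 ≤ 40 * B * T * V := by positivity
    nlinarith [ht.2]
  set G : ℝ → ℂ :=
    fun s => tiltDet P d s * Complex.exp (-(Complex.I * s * m) + (s : ℂ) ^ 2 * V / 2) with hG
  have hG' : ∀ t ∈ Set.Icc (0 : ℝ) T, HasDerivAt G (r t * G t) t := by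
    intro t ht
    have h1 := hasDerivAt_tiltDet (hunit t ht)
    have h2 : HasDerivAt (fun s : ℝ => -(Complex.I * s * m) + (s : ℂ) ^ 2 * V / 2)
        (-(Complex.I * m) + t * V) t := by
      have hid := Complex.ofRealCLM.hasDerivAt (x := t)
      have e1 := ((hid.const_mul Complex.I).mul_const (m : ℂ)).neg
      have e2 := ((hid.pow 2).mul_const (V : ℂ)).div_const 2
      refine (e1.add e2).congr_deriv ?_
      simp
      ring
    refine (h1.mul h2.cexp).congr_deriv ?_
    simp only [hG, hr, hq, hQ]
    ring
  set K := 40 * B * T ^ 2 * V with hK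
  have hK0 : 0 ≤ K := by positivity
  have hG0 : G 0 = 1 := by simp [hG, tiltDet, hz]
  -- Grönwall's inequality gives a crude bound on `G`. Inserted in `G' = rG`, it yields the sharp
  -- bound on `G - 1`.
  have hGb : ∀ t ∈ Set.Icc (0 : ℝ) T, ‖G t‖ ≤ Real.exp (K * T) := by
    intro t ht
    have h1 := norm_le_gronwallBound_of_norm_deriv_right_le (f := G) (f' := fun t => r t * G t)
      (δ := 1) (K := K) (ε := 0) (a := 0) (b := T)
      (fun x hx => (hG' x hx).continuousAt.continuousWithinAt)
      (fun x hx => (hG' x (Set.Ico_subset_Icc_self hx)).hasDerivWithinAt)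
      (by rw [hG0]; simp) (fun x hx => by
        rw [norm_mul, add_zero]; gcongr; exact hrb x (Set.Ico_subset_Icc_self hx)) t ht
    rw [gronwallBound_ε0, one_mul, sub_zero] at h1
    refine h1.trans (Real.exp_le_exp.2 ?_)
    gcongr
    exact ht.2
  have hGT : ‖G T - 1‖ ≤ K * T * Real.exp (K * T) := by
    have h1 := Convex.norm_image_sub_le_of_norm_hasDerivWithin_le (f := G) (s := Set.Icc 0 T)
      (C := K * Real.exp (K * T)) (x := 0) (y := T) (fun x hx => (hG' x hx).hasDerivWithinAt)
      (fun x hx => by rw [norm_mul]; gcongr; exacts [hrb x hx, hGb x hx]) (convex_Icc 0 T)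
      ⟨le_rfl, hT⟩ ⟨hT, le_rfl⟩
    rw [hG0, sub_zero, Real.norm_eq_abs, abs_of_nonneg hT] at h1
    linarith
  -- Since `192 BT ≤ 1`, one has `40 BT ≤ 1/2`. The exponential from Grönwall's inequality is then
  -- absorbed by the Gaussian factor, with no restriction on the size of `T²V`.
  have hKT : K * T ≤ T ^ 2 * V / 2 := by
    have : 0 ≤ T ^ 2 * V := by positivity
    rw [hK]; nlinarith
  have hfin : tiltDet P d T * Complex.exp (-(Complex.I * T * m)) - Real.exp (-(T ^ 2 * V / 2))
      = Real.exp (-(T ^ 2 * V / 2)) * (G T - 1) := by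
    have : Complex.exp (-(Complex.I * T * m))
        = (Real.exp (-(T ^ 2 * V / 2)) : ℂ)
          * Complex.exp (-(Complex.I * T * m) + (T : ℂ) ^ 2 * V / 2) := by
      rw [Complex.ofReal_exp, ← Complex.exp_add]
      congr 1; push_cast; ring
    rw [this, hG]; ring
  rw [hfin, norm_mul, Complex.norm_real, Real.norm_eq_abs, Real.abs_exp]
  calc _ ≤ Real.exp (-(T ^ 2 * V / 2)) * (K * T * Real.exp (T ^ 2 * V / 2)) := by
        gcongr
        exact hGT.trans (by gcongr)
    _ = K * T * (Real.exp (-(T ^ 2 * V / 2)) * Real.exp (T ^ 2 * V / 2)) := by ring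
    _ = K * T := by rw [← Real.exp_add]; simp
    _ = _ := by rw [hK]; ring

/-- The matrix is `S = (M(1 - M))^{1/2}`, built in an eigenbasis of `M`. The three identities are
exactly what makes the block matrix with rows `(M, S)` and `(S, 1 - M)` a Hermitian projection. -/
lemma exists_dilation {M : Matrix ι ι ℂ} (hM : M.PosSemidef) (hM1 : (1 - M).PosSemidef) :
    ∃ S : Matrix ι ι ℂ, Sᴴ = S ∧ S * S = M - M * M ∧ M * S = S * M := by
  have hH := hM.isHermitian
  set U : Matrix ι ι ℂ := (hH.eigenvectorUnitary : Matrix ι ι ℂ) with hU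
  have hUU : Uᴴ * U = 1 := by
    have := Unitary.coe_star_mul_self hH.eigenvectorUnitary
    simpa [Matrix.star_eq_conjTranspose] using this
  set Λ : Matrix ι ι ℂ := diagonal fun i => (hH.eigenvalues i : ℂ) with hΛ
  have hspec : M = U * Λ * Uᴴ := by
    have := hH.spectral_theorem
    rw [Unitary.conjStarAlgAut_apply] at this
    exact this
  have h0 : ∀ i, 0 ≤ hH.eigenvalues i := hM.eigenvalues_nonneg
  have h1 : ∀ i, hH.eigenvalues i ≤ 1 := by
    intro i
    have h2 := hM1.conjTranspose_mul_mul_same U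
    have h3 : Uᴴ * (1 - M) * U = 1 - Λ := by
      have : Uᴴ * (1 - M) * U = Uᴴ * U - (Uᴴ * U) * Λ * (Uᴴ * U) := by
        rw [hspec]; noncomm_ring
      rw [this, hUU]; noncomm_ring
    rw [h3] at h2
    have h4 := h2.diag_nonneg (i := i)
    simp only [hΛ, Matrix.sub_apply, Matrix.one_apply_eq, Matrix.diagonal_apply_eq] at h4
    rw [sub_nonneg] at h4
    exact_mod_cast h4
  set s : Matrix ι ι ℂ :=
    diagonal fun i => (Real.sqrt (hH.eigenvalues i * (1 - hH.eigenvalues i)) : ℂ) with hs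
  refine ⟨U * s * Uᴴ, ?_, ?_, ?_⟩
  · simp only [Matrix.conjTranspose_mul, Matrix.conjTranspose_conjTranspose, hs,
      Matrix.diagonal_conjTranspose, mul_assoc]
    congr 3
    funext i; simp
  · have e1 : U * s * Uᴴ * (U * s * Uᴴ) = U * (s * (Uᴴ * U) * s) * Uᴴ := by noncomm_ring
    have e2 : M - M * M = U * (Λ - Λ * (Uᴴ * U) * Λ) * Uᴴ := by rw [hspec]; noncomm_ring
    rw [e1, e2, hUU, mul_one, mul_one]
    congr 2
    simp only [hs, hΛ, Matrix.diagonal_mul_diagonal, Matrix.diagonal_sub]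
    congr 1; funext i
    rw [← Complex.ofReal_mul, Real.mul_self_sqrt (mul_nonneg (h0 i) (sub_nonneg.2 (h1 i)))]
    push_cast; ring
  · have e1 : U * Λ * Uᴴ * (U * s * Uᴴ) = U * (Λ * (Uᴴ * U) * s) * Uᴴ := by noncomm_ring
    have e2 : U * s * Uᴴ * (U * Λ * Uᴴ) = U * (s * (Uᴴ * U) * Λ) * Uᴴ := by noncomm_ring
    rw [hspec, e1, e2, hUU, mul_one, mul_one]
    congr 2
    simp [hs, hΛ, mul_comm]

/-- Quantitative Gaussian approximation for the finite determinantal generating function attached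
to a Hermitian matrix `0 ≤ M ≤ 1`. -/
theorem norm_tiltDet_sub_gaussian_le_of_contraction {M : Matrix ι ι ℂ} (hM : M.PosSemidef)
    (hM1 : (1 - M).PosSemidef) {d : ι → ℝ}
    {B T m V : ℝ} (hB : 0 ≤ B) (hd : ∀ i, |d i| ≤ B) (hT : 0 ≤ T) (hBT : 192 * (B * T) ≤ 1)
    (hm : (realDiagonal d * M).trace = m)
    (hV : (realDiagonal d * (1 - M) * realDiagonal d * M).trace
      = V) :
    ‖tiltDet M d T * Complex.exp (-(Complex.I * T * m)) - Real.exp (-(T ^ 2 * V / 2))‖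
      ≤ 40 * B * T ^ 3 * V := by
  obtain ⟨S, hS, hSS, hMS⟩ := exists_dilation hM hM1
  set P : Matrix (ι ⊕ ι) (ι ⊕ ι) ℂ := Matrix.fromBlocks M S S (1 - M) with hPdef
  have hP : Pᴴ = P := by
    rw [hPdef, Matrix.fromBlocks_conjTranspose, hS, hM.isHermitian.eq, hM1.isHermitian.eq]
  have hPP : P * P = P := by
    rw [hPdef, Matrix.fromBlocks_multiply]
    congr 1
    · rw [hSS]; noncomm_ring
    · rw [hMS]; noncomm_ring
    · rw [← hMS]; noncomm_ring
    · rw [hSS]; noncomm_ring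
  -- Extending `d` by zero leaves only the upper left block visible. The determinant, the mean and
  -- the variance of the dilation are then those of `M`: the cross terms with `S` drop out.
  set e : ι ⊕ ι → ℝ := Sum.elim d 0 with he
  have hphase : phaseMatrix e T = Matrix.fromBlocks (phaseMatrix d T) 0 0 1 := by
    rw [phaseMatrix, phaseMatrix, ← Matrix.diagonal_one, Matrix.fromBlocks_diagonal]
    congr 1; funext i
    rcases i with i | i <;> simp [he]
  have hdiag : realDiagonal e = Matrix.fromBlocks (realDiagonal d) 0 0 0 := by
    ext (i | i) (j | j) <;> simp [realDiagonal, he, Matrix.diagonal_apply]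
  have hdet : tiltDet P e T = tiltDet M d T := by
    rw [tiltDet, hphase, hPdef, ← Matrix.fromBlocks_one, sub_eq_add_neg, Matrix.fromBlocks_neg,
      Matrix.fromBlocks_add,
      Matrix.fromBlocks_multiply, Matrix.fromBlocks_add]
    simp [tiltDet, sub_eq_add_neg]
  rw [← hdet]
  refine norm_tiltDet_sub_gaussian_le hP hPP hB (fun i => ?_) hT hBT ?_ ?_
  · rcases i with i | i
    · exact hd i
    · simpa [he] using hB
  · rw [hdiag, hPdef, Matrix.fromBlocks_multiply, Matrix.trace]
    simpa [Fintype.sum_sum_type, Matrix.trace] using hm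
  · rw [hdiag, hPdef, ← Matrix.fromBlocks_one, sub_eq_add_neg, Matrix.fromBlocks_neg,
      Matrix.fromBlocks_add, Matrix.fromBlocks_multiply,
      Matrix.fromBlocks_multiply, Matrix.fromBlocks_multiply, Matrix.trace]
    simpa [Fintype.sum_sum_type, Matrix.trace, sub_eq_add_neg] using hV

end Gaussian

/-! ### Finite determinants as Fredholm series, and a Hadamard-type bound -/

section FredholmExpansion
open Matrix
variable {ι : Type*} [Fintype ι] [DecidableEq ι]

/-- A tuple with a repeated index gives two equal rows. The injective tuples with a given image are
its `k!` enumerations, and a simultaneous permutation of rows and columns does not change the minor.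
-/
lemma sum_det_submatrix_eq (A : Matrix ι ι ℂ) (k : ℕ) :
    ∑ z : Fin k → ι, (A.submatrix z z).det
      = k.factorial * ∑ s ∈ Finset.univ.powersetCard k,
        (A.submatrix (Subtype.val : s → ι) (Subtype.val : s → ι)).det := by
  classical
  have h1 : ∑ z : Fin k → ι, (A.submatrix z z).det
      = ∑ z : Fin k → ι with Function.Injective z, (A.submatrix z z).det := by
    rw [Finset.sum_filter]
    refine Finset.sum_congr rfl fun z _ => ?_
    split_ifs with hz
    · rfl
    · simp only [Function.Injective, not_forall] at hz
      obtain ⟨a, b, hab, hne⟩ := hz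
      exact Matrix.det_zero_of_row_eq hne (by funext j; simp [hab])
  rw [h1, Finset.mul_sum, ← Finset.sum_fiberwise_of_maps_to
    (t := Finset.univ.powersetCard k) (g := fun z => Finset.univ.image z)]
  · refine Finset.sum_congr rfl fun s hs => ?_
    rw [Finset.mem_powersetCard] at hs
    have hcard : Fintype.card s = k := by simpa using hs.2
    have h2 : ∀ z ∈ (Finset.univ.filter (fun z : Fin k → ι => Function.Injective z)).filter
        (fun z => Finset.univ.image z = s), (A.submatrix z z).det
          = (A.submatrix (Subtype.val : s → ι) (Subtype.val : s → ι)).det := by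
      intro z hz
      simp only [Finset.mem_filter, Finset.mem_univ, true_and] at hz
      obtain ⟨hinj, him⟩ := hz
      have hmem : ∀ i, z i ∈ s := fun i => him ▸ Finset.mem_image_of_mem _ (Finset.mem_univ i)
      let e : Fin k ≃ s := Equiv.ofBijective (fun i => ⟨z i, hmem i⟩) (by
        rw [Fintype.bijective_iff_injective_and_card]
        exact ⟨fun a b hab => hinj (by simpa using hab), by simp [hs.2]⟩)
      have : A.submatrix z z
          = (A.submatrix (Subtype.val : s → ι) (Subtype.val : s → ι)).submatrix e e := by
        ext i j; rfl
      rw [this, Matrix.det_submatrix_equiv_self]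
    rw [Finset.sum_congr rfl h2, Finset.sum_const, nsmul_eq_mul]
    congr 2
    have hc : Fintype.card (Fin k ≃ s) = k.factorial := by
      rw [Fintype.card_equiv (Fintype.equivOfCardEq (by simp [hs.2]))]; simp
    rw [← hc]
    symm
    refine Finset.card_bij (s := (Finset.univ : Finset (Fin k ≃ s)))
      (fun e _ => fun i => (e i : ι)) ?_ ?_ ?_
    · intro e _
      simp only [Finset.mem_filter, Finset.mem_univ, true_and]
      refine ⟨fun a b hab => e.injective (Subtype.ext hab), ?_⟩
      ext x
      simp only [Finset.mem_image, Finset.mem_univ, true_and]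
      exact ⟨fun ⟨i, hi⟩ => hi ▸ (e i).2, fun hx => ⟨e.symm ⟨x, hx⟩, by simp⟩⟩
    · intro e₁ _ e₂ _ h
      ext i
      exact congrFun h i
    · intro z hz
      simp only [Finset.mem_filter, Finset.mem_univ, true_and] at hz
      obtain ⟨hinj, him⟩ := hz
      have hmem : ∀ i, z i ∈ s := fun i => him ▸ Finset.mem_image_of_mem _ (Finset.mem_univ i)
      refine ⟨Equiv.ofBijective (fun i => ⟨z i, hmem i⟩) (by
        rw [Fintype.bijective_iff_injective_and_card]
        exact ⟨fun a b hab => hinj (by simpa using hab), by simp [hs.2]⟩), Finset.mem_univ _, ?_⟩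
      rfl
  · intro z hz
    simp only [Finset.mem_filter, Finset.mem_univ, true_and] at hz
    rw [Finset.mem_powersetCard]
    exact ⟨Finset.subset_univ _, by rw [Finset.card_image_of_injective _ hz]; simp⟩

/-- The Fredholm expansion of a finite determinant. -/
theorem hasSum_det_submatrix (A : Matrix ι ι ℂ) :
    HasSum (fun k : ℕ => (1 / (k.factorial : ℂ)) * ∑ z : Fin k → ι, (A.submatrix z z).det)
      (1 + A).det := by
  -- The coefficients of `det(1 + X A)` are the sums of principal minors, and the series is the
  -- value of this polynomial at `1`.
  set p : Polynomial ℂ := det (1 + (Polynomial.X : Polynomial ℂ) • A.map Polynomial.C) with hp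
  have h1 : ∀ k, (1 / (k.factorial : ℂ)) * ∑ z : Fin k → ι, (A.submatrix z z).det
      = p.coeff k := by
    intro k
    rw [sum_det_submatrix_eq, hp, coeff_det_one_add_X_smul_eq_sum_minors, ← mul_assoc,
      one_div_mul_cancel (by exact_mod_cast k.factorial_ne_zero), one_mul]
  have h2 : (1 + A).det = p.eval 1 := by
    rw [hp, ← Polynomial.coe_evalRingHom, RingHom.map_det]
    congr 1
    ext i j
    simp [Matrix.one_apply, apply_ite]
  rw [h2, Polynomial.eval_eq_sum_range]
  simp only [h1, one_pow, mul_one]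
  refine hasSum_sum_of_ne_finset_zero fun k hk => ?_
  rw [Finset.mem_range, not_lt] at hk
  exact Polynomial.coeff_eq_zero_of_natDegree_lt (by omega)

open scoped ComplexOrder in
/-- A positive semidefinite matrix with constant diagonal `c` has determinant at most `c ^ k`. -/
lemma norm_det_le_pow_of_posSemidef {A : Matrix ι ι ℂ} (hA : A.PosSemidef) {c : ℝ} (hc : 0 < c)
    (hdiag : ∀ i, A i i = c) : ‖A.det‖ ≤ c ^ Fintype.card ι := by
  have hH := hA.isHermitian
  rw [hH.det_eq_prod_eigenvalues, norm_prod]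
  have h0 : ∀ i, 0 ≤ hH.eigenvalues i := hA.eigenvalues_nonneg
  have htr : ∑ i, hH.eigenvalues i = c * Fintype.card ι := by
    have h := hH.trace_eq_sum_eigenvalues
    rw [Matrix.trace, Finset.sum_congr rfl fun i _ => show A.diag i = (c : ℂ) from hdiag i] at h
    rw [Finset.sum_const, Finset.card_univ, nsmul_eq_mul] at h
    have : (Fintype.card ι : ℂ) * c = ((∑ i, hH.eigenvalues i : ℝ) : ℂ) := by
      rw [h]; push_cast; rfl
    have h' : (Fintype.card ι : ℝ) * c = ∑ i, hH.eigenvalues i := by exact_mod_cast this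
    rw [← h', mul_comm]
  -- The inequality of arithmetic and geometric means, through `x ≤ e^{x-1}`: the exponents add up
  -- to zero because the trace is `c` times the size.
  have h1 : ∏ i, (hH.eigenvalues i / c) ≤ 1 := by
    calc ∏ i, (hH.eigenvalues i / c) ≤ ∏ i, Real.exp (hH.eigenvalues i / c - 1) := by
          refine Finset.prod_le_prod (fun i _ => div_nonneg (h0 i) hc.le) fun i _ => ?_
          simpa using Real.add_one_le_exp (hH.eigenvalues i / c - 1)
      _ = Real.exp (∑ i, (hH.eigenvalues i / c - 1)) := (Real.exp_sum _ _).symm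
      _ = 1 := by
          rw [Finset.sum_sub_distrib, ← Finset.sum_div, htr]
          simp [hc.ne']
  rw [Finset.prod_div_distrib, Finset.prod_const, Finset.card_univ,
    div_le_one (by positivity)] at h1
  refine le_trans (le_of_eq ?_) h1
  refine Finset.prod_congr rfl fun i _ => ?_
  simp [abs_of_nonneg (h0 i)]

end FredholmExpansion

/-! ### Gram matrices of functions -/

section GramMatrix
open Matrix
open scoped ComplexOrder ComplexConjugate

/-- The Gram matrix of a bounded family of functions on a finite measure space is positive
semidefinite. -/
lemma posSemidef_integral_mul_conj {X ι : Type*} [MeasurableSpace X] [Fintype ι]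
    {ν : Measure X} {e : ι → X → ℂ}
    (hint : ∀ i j, Integrable (fun x => e i x * conj (e j x)) ν) :
    (Matrix.of fun i j => ∫ x, e i x * conj (e j x) ∂ν).PosSemidef := by
  refine Matrix.PosSemidef.of_dotProduct_mulVec_nonneg ?_ fun a => ?_
  · ext i j
    rw [Matrix.conjTranspose_apply, Matrix.of_apply, Matrix.of_apply, Complex.star_def,
      ← integral_conj]
    refine integral_congr_ae (.of_forall fun x => ?_)
    simp [mul_comm]
  · have h : star a ⬝ᵥ (Matrix.of fun i j => ∫ x, e i x * conj (e j x) ∂ν) *ᵥ a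
        = ∫ x, ((‖∑ i, conj (a i) * e i x‖ ^ 2 : ℝ) : ℂ) ∂ν := by
      have h1 : ∀ x, ((‖∑ i, conj (a i) * e i x‖ ^ 2 : ℝ) : ℂ)
          = ∑ i, ∑ j, conj (a i) * (e i x * conj (e j x) * a j) := by
        intro x
        rw [← Complex.normSq_eq_norm_sq, ← Complex.mul_conj, map_sum, Finset.sum_mul_sum]
        refine Finset.sum_congr rfl fun i _ => Finset.sum_congr rfl fun j _ => ?_
        rw [map_mul, Complex.conj_conj]; ring
      simp only [h1]
      rw [integral_finsetSum _ fun i _ => integrable_finsetSum _ fun j _ =>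
        ((hint i j).mul_const _).const_mul _]
      simp only [dotProduct, mulVec, Finset.mul_sum, Matrix.of_apply, Pi.star_apply]
      refine Finset.sum_congr rfl fun i _ => ?_
      rw [integral_finsetSum _ fun j _ => ((hint i j).mul_const _).const_mul _]
      refine Finset.sum_congr rfl fun j _ => ?_
      rw [integral_const_mul, integral_mul_const]
      rfl
    rw [h, integral_complex_ofReal]
    exact_mod_cast integral_nonneg fun x => by positivity

end GramMatrix

/-! ### The kernel of the ball multiplier and its lattice samples -/

section BallKernel
open Matrix
open scoped ComplexOrder ComplexConjugate Pointwise

/-- The function `z ↦ ∫_{|ξ| ≤ r} e^{-2πi ξ·z} dξ`. -/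
noncomputable def ballKernel (n : ℕ) (r : ℝ) (z : EuclideanSpace ℝ (Fin n)) : ℂ :=
  ∫ ξ in Metric.closedBall (0 : EuclideanSpace ℝ (Fin n)) r,
    Complex.exp (((-2 * Real.pi * inner ℝ ξ z : ℝ) : ℂ) * Complex.I)

variable {n : ℕ} {r : ℝ}

lemma isFiniteMeasure_restrict_closedBall (x : EuclideanSpace ℝ (Fin n)) (r : ℝ) :
    IsFiniteMeasure (volume.restrict (Metric.closedBall x r)) :=
  ⟨by rw [Measure.restrict_apply_univ]; exact measure_closedBall_lt_top⟩

lemma norm_ballKernel_le (z : EuclideanSpace ℝ (Fin n)) :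
    ‖ballKernel n r z‖ ≤ volume.real (Metric.closedBall (0 : EuclideanSpace ℝ (Fin n)) r) := by
  have := norm_setIntegral_le_of_norm_le_const (μ := volume)
    (s := Metric.closedBall (0 : EuclideanSpace ℝ (Fin n)) r)
    (f := fun ξ => Complex.exp (((-2 * Real.pi * inner ℝ ξ z : ℝ) : ℂ) * Complex.I)) (C := 1)
    measure_closedBall_lt_top (fun ξ _ => by rw [Complex.norm_exp_ofReal_mul_I])
  rwa [one_mul] at this

lemma ballKernel_zero :
    ballKernel n r 0 = volume.real (Metric.closedBall (0 : EuclideanSpace ℝ (Fin n)) r) := by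
  simp [ballKernel]

lemma continuous_ballKernel : Continuous (ballKernel n r) := by
  unfold ballKernel
  have := isFiniteMeasure_restrict_closedBall (0 : EuclideanSpace ℝ (Fin n)) r
  refine continuous_of_dominated (bound := fun _ => 1) (fun z => by fun_prop)
    (fun z => .of_forall fun ξ => by rw [Complex.norm_exp_ofReal_mul_I])
    (integrable_const _) (.of_forall fun ξ => by fun_prop)

lemma conj_ballKernel (z : EuclideanSpace ℝ (Fin n)) :
    conj (ballKernel n r z) = ballKernel n r (-z) := by
  rw [ballKernel, ballKernel, ← integral_conj]
  refine integral_congr_ae (.of_forall fun ξ => ?_)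
  simp only [← Complex.exp_conj, map_mul, Complex.conj_ofReal, Complex.conj_I, inner_neg_right]
  congr 1
  push_cast; ring

/-- The matrices of the ball kernel are Gram matrices. -/
lemma ballKernel_sub_eq (x y : EuclideanSpace ℝ (Fin n)) :
    ballKernel n r (x - y) = ∫ ξ in Metric.closedBall (0 : EuclideanSpace ℝ (Fin n)) r,
      Complex.exp (((-2 * Real.pi * inner ℝ ξ x : ℝ) : ℂ) * Complex.I) *
        conj (Complex.exp (((-2 * Real.pi * inner ℝ ξ y : ℝ) : ℂ) * Complex.I)) := by
  rw [ballKernel]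
  refine integral_congr_ae (.of_forall fun ξ => ?_)
  simp only [← Complex.exp_conj, ← Complex.exp_add, map_mul, Complex.conj_ofReal, Complex.conj_I,
    inner_sub_right]
  congr 1
  push_cast; ring

lemma integrable_planeWave_mul_conj {X : Type*} [MeasurableSpace X] {ν : Measure X}
    [IsFiniteMeasure ν] {f g : X → ℝ} (hf : Measurable f) (hg : Measurable g) :
    Integrable (fun x => Complex.exp ((f x : ℂ) * Complex.I)
      * conj (Complex.exp ((g x : ℂ) * Complex.I))) ν := by
  refine Integrable.of_bound (C := 1) (by fun_prop) (.of_forall fun x => ?_)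
  rw [norm_mul, RCLike.norm_conj, Complex.norm_exp_ofReal_mul_I, Complex.norm_exp_ofReal_mul_I,
    one_mul]

lemma posSemidef_ballKernel {ι : Type*} [Fintype ι] (z : ι → EuclideanSpace ℝ (Fin n)) :
    (Matrix.of fun i j => ballKernel n r (z i - z j)).PosSemidef := by
  have := isFiniteMeasure_restrict_closedBall (0 : EuclideanSpace ℝ (Fin n)) r
  simp only [ballKernel_sub_eq]
  exact posSemidef_integral_mul_conj fun i j =>
    integrable_planeWave_mul_conj (by fun_prop) (by fun_prop)

/-- Growth of order `c^k`, against the `1/k!` in the Fredholm series, is what supplies a summable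
majorant throughout. -/
lemma norm_det_ballKernel_le (hr : 0 < r) {k : ℕ} (z : Fin k → EuclideanSpace ℝ (Fin n)) :
    ‖(Matrix.of fun i j => ballKernel n r (z i - z j)).det‖
      ≤ volume.real (Metric.closedBall (0 : EuclideanSpace ℝ (Fin n)) r) ^ k := by
  have h := norm_det_le_pow_of_posSemidef (posSemidef_ballKernel (r := r) z)
    (c := volume.real (Metric.closedBall (0 : EuclideanSpace ℝ (Fin n)) r))
    (ENNReal.toReal_pos (Metric.measure_closedBall_pos volume _ hr).ne'
      measure_closedBall_lt_top.ne) (fun i => by rw [Matrix.of_apply, sub_self, ballKernel_zero])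
  simpa using h

/-- The half-open unit cube centred at the origin. -/
def unitCube (n : ℕ) : Set (EuclideanSpace ℝ (Fin n)) :=
  {η | ∀ i, η i ∈ Set.Ioc (-(1 / 2) : ℝ) (1 / 2)}

lemma unitCube_eq : unitCube n
    = WithLp.ofLp ⁻¹' (Set.univ.pi fun _ : Fin n => Set.Ioc (-(1 / 2) : ℝ) (1 / 2)) := by
  ext η; simp [unitCube]

lemma volume_unitCube : volume (unitCube n) = 1 := by
  rw [unitCube_eq, (PiLp.volume_preserving_ofLp (Fin n)).measure_preimage
    (MeasurableSet.univ_pi fun _ => measurableSet_Ioc).nullMeasurableSet, Real.volume_pi_Ioc]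
  norm_num

/-- The point of `ℝⁿ` with integral coordinates `m`. -/
def latticePoint (m : Fin n → ℤ) : EuclideanSpace ℝ (Fin n) := WithLp.toLp 2 fun i => (m i : ℝ)

lemma integral_exp_int (m : ℤ) :
    ∫ x in Set.Ioc (-(1 / 2) : ℝ) (1 / 2), Complex.exp (((-2 * Real.pi * (x * m) : ℝ) : ℂ)
      * Complex.I) = if m = 0 then 1 else 0 := by
  split_ifs with h
  · subst h
    simp
    norm_num
  · rw [← intervalIntegral.integral_of_le (by norm_num)]
    have hc : (-2 * Real.pi * m * Complex.I : ℂ) ≠ 0 := by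
      simp [Real.pi_ne_zero, h]
    have h1 := integral_exp_mul_complex (a := -(1 / 2)) (b := 1 / 2) hc
    have h2 : ∀ x : ℝ, Complex.exp (((-2 * Real.pi * (x * m) : ℝ) : ℂ) * Complex.I)
        = Complex.exp (-2 * Real.pi * m * Complex.I * x) := fun x => by
      congr 1; push_cast; ring
    simp only [h2]
    rw [h1, div_eq_zero_iff, sub_eq_zero]
    left
    rw [Complex.exp_eq_exp_iff_exists_int]
    exact ⟨-m, by push_cast; ring⟩

/-- Orthonormality of the characters of `ℤⁿ` on one period cell. It identifies the identity matrix
with a Gram matrix over the whole cube. -/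
lemma integral_unitCube (m : Fin n → ℤ) :
    ∫ η in unitCube n, Complex.exp (((-2 * Real.pi * inner ℝ η (latticePoint m) : ℝ) : ℂ)
      * Complex.I) = if m = 0 then 1 else 0 := by
  have hF : ∀ η : EuclideanSpace ℝ (Fin n),
      Complex.exp (((-2 * Real.pi * inner ℝ η (latticePoint m) : ℝ) : ℂ) * Complex.I)
      = (fun x : Fin n → ℝ => ∏ i, Complex.exp (((-2 * Real.pi * (x i * m i) : ℝ) : ℂ)
        * Complex.I)) (WithLp.ofLp η) := by
    intro η
    simp only
    rw [← Complex.exp_sum, ← Finset.sum_mul, ← Complex.ofReal_sum, ← Finset.mul_sum]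
    congr 3
    simp [latticePoint, PiLp.inner_apply, mul_comm]
  simp only [hF]
  have hpre := (PiLp.volume_preserving_ofLp (Fin n)).setIntegral_preimage_emb
    (MeasurableEquiv.toLp 2 (Fin n → ℝ)).symm.measurableEmbedding
    (fun x : Fin n → ℝ => ∏ i, Complex.exp (((-2 * Real.pi * (x i * m i) : ℝ) : ℂ) * Complex.I))
    (Set.univ.pi fun _ : Fin n => Set.Ioc (-(1 / 2) : ℝ) (1 / 2))
  rw [unitCube_eq, hpre, volume_pi,
    Measure.restrict_pi_pi, integral_fintype_prod_eq_prod
      (f := fun i (y : ℝ) => Complex.exp (((-2 * Real.pi * (y * m i) : ℝ) : ℂ) * Complex.I))]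
  simp only [integral_exp_int]
  split_ifs with h
  · simp [h]
  · obtain ⟨i, hi⟩ := Function.ne_iff.1 h
    exact Finset.prod_eq_zero (Finset.mem_univ i) (if_neg hi)

/-- The lattice matrix `h ^ n k(h (i - j))`. -/
noncomputable def latticeMatrix (r h : ℝ) (S : Finset (Fin n → ℤ)) : Matrix S S ℂ :=
  Matrix.of fun i j => (h : ℂ) ^ n * ballKernel n r (h • latticePoint i.1 - h • latticePoint j.1)

/-- The substitution `η = hξ` absorbs the factor `h ^ n` and leaves the characters of `ℤⁿ` over the
rescaled ball. -/
lemma latticeMatrix_apply {h : ℝ} (hh : 0 < h) (S : Finset (Fin n → ℤ)) (i j : S) :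
    latticeMatrix r h S i j
      = ∫ η in h • Metric.closedBall (0 : EuclideanSpace ℝ (Fin n)) r,
        Complex.exp (((-2 * Real.pi * inner ℝ η (latticePoint i.1) : ℝ) : ℂ) * Complex.I) *
        conj (Complex.exp (((-2 * Real.pi * inner ℝ η (latticePoint j.1) : ℝ) : ℂ)
          * Complex.I)) := by
  rw [latticeMatrix, Matrix.of_apply, ballKernel_sub_eq]
  have h1 := Measure.setIntegral_comp_smul_of_pos (volume : Measure (EuclideanSpace ℝ (Fin n)))
    (fun η => Complex.exp (((-2 * Real.pi * inner ℝ η (latticePoint i.1) : ℝ) : ℂ) * Complex.I) *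
        conj (Complex.exp (((-2 * Real.pi * inner ℝ η (latticePoint j.1) : ℝ) : ℂ)
          * Complex.I))) (Metric.closedBall (0 : EuclideanSpace ℝ (Fin n)) r) hh
  simp only [inner_smul_right, real_inner_smul_left] at h1 ⊢
  rw [h1, finrank_euclideanSpace, Fintype.card_fin, Complex.real_smul, ← mul_assoc]
  push_cast
  rw [mul_inv_cancel₀ (pow_ne_zero _ (by exact_mod_cast hh.ne')), one_mul]

lemma smul_closedBall_subset_unitCube {h : ℝ} (hh : 0 < h) (hhr : h * r < 1 / 2) :
    h • Metric.closedBall (0 : EuclideanSpace ℝ (Fin n)) r ⊆ unitCube n := by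
  rintro _ ⟨ξ, hξ, rfl⟩ i
  have h1 : |ξ i| ≤ r := by
    have := PiLp.norm_apply_le ξ i
    exact (by simpa using this : |ξ i| ≤ ‖ξ‖).trans (by simpa using hξ)
  have h2 : |h * ξ i| < 1 / 2 := by
    rw [abs_mul, abs_of_pos hh]; nlinarith
  rw [abs_lt] at h2
  exact ⟨by simpa using h2.1, by simpa using h2.2.le⟩

/-- When `hr < 1/2` the rescaled ball lies in the unit cube. The lattice matrix is then the Gram
matrix of orthonormal characters restricted to the ball, and `1` minus it is their Gram matrix over
the rest of the cube. -/
lemma posSemidef_latticeMatrix {h : ℝ} (hh : 0 < h) (hhr : h * r < 1 / 2)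
    (S : Finset (Fin n → ℤ)) : (latticeMatrix r h S).PosSemidef ∧
      (1 - latticeMatrix r h S).PosSemidef := by
  classical
  have hsub := smul_closedBall_subset_unitCube (n := n) hh hhr
  have hfin : ∀ A ⊆ unitCube n, IsFiniteMeasure (volume.restrict A) := fun A hA =>
    ⟨by rw [Measure.restrict_apply_univ]
        exact (measure_mono hA).trans_lt (by rw [volume_unitCube]; exact ENNReal.one_lt_top)⟩
  have hmeas : MeasurableSet (h • Metric.closedBall (0 : EuclideanSpace ℝ (Fin n)) r) :=
    Metric.isClosed_closedBall.measurableSet.const_smul_of_ne_zero hh.ne'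
  constructor
  · have := hfin _ hsub
    have h1 : latticeMatrix r h S = Matrix.of fun i j => latticeMatrix r h S i j := rfl
    rw [h1]
    simp only [latticeMatrix_apply hh]
    exact posSemidef_integral_mul_conj fun i j =>
      integrable_planeWave_mul_conj (by fun_prop) (by fun_prop)
  · have := hfin _ (Set.sdiff_subset (s := unitCube n)
      (t := h • Metric.closedBall (0 : EuclideanSpace ℝ (Fin n)) r))
    have := hfin _ subset_rfl
    have h1 : 1 - latticeMatrix r h S = Matrix.of fun i j : S =>
        ∫ η in unitCube n \ (h • Metric.closedBall (0 : EuclideanSpace ℝ (Fin n)) r),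
        Complex.exp (((-2 * Real.pi * inner ℝ η (latticePoint i.1) : ℝ) : ℂ) * Complex.I) *
        conj (Complex.exp (((-2 * Real.pi * inner ℝ η (latticePoint j.1) : ℝ) : ℂ)
          * Complex.I)) := by
      ext i j
      rw [Matrix.sub_apply, latticeMatrix_apply hh, Matrix.of_apply,
        setIntegral_sdiff hmeas (integrable_planeWave_mul_conj (by fun_prop) (by fun_prop)) hsub]
      congr 1
      have h2 := integral_unitCube (i.1 - j.1)
      rw [Matrix.one_apply]
      simp only [sub_eq_zero, ← Subtype.ext_iff] at h2
      rw [← h2]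
      refine integral_congr_ae (.of_forall fun ξ => ?_)
      simp only [← Complex.exp_conj, ← Complex.exp_add, map_mul, Complex.conj_ofReal,
        Complex.conj_I]
      congr 1
      have : latticePoint (i.1 - j.1) = latticePoint i.1 - latticePoint j.1 := by
        ext a; simp [latticePoint]
      rw [this, inner_sub_right]
      push_cast; ring
    rw [h1]
    exact posSemidef_integral_mul_conj fun i j =>
      integrable_planeWave_mul_conj (by fun_prop) (by fun_prop)

end BallKernel

/-! ### Fredholm determinants of the ball kernel and their discretisation -/

section Fredholm
open scoped Topology
variable {n : ℕ} {r : ℝ}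

/-- The volume of the ball of radius `r`. -/
noncomputable def ballVol (n : ℕ) (r : ℝ) : ℝ :=
  volume.real (Metric.closedBall (0 : EuclideanSpace ℝ (Fin n)) r)

lemma ballVol_nonneg : 0 ≤ ballVol n r := measureReal_nonneg

/-- The determinant of the kernel matrix at the points `z`. -/
noncomputable def ballDet (r : ℝ) {k : ℕ} (z : Fin k → EuclideanSpace ℝ (Fin n)) : ℂ :=
  (Matrix.of fun i j => ballKernel n r (z i - z j)).det

/-- The Fredholm determinant `det(I - u K)`, `K` being the kernel `ballKernel n r (x - y)`. -/
noncomputable def ballFredholm (n : ℕ) (r : ℝ) (u : EuclideanSpace ℝ (Fin n) → ℂ) : ℂ :=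
  ∑' k : ℕ, ((-1) ^ k / (k.factorial : ℂ)) * ∫ z : Fin k → EuclideanSpace ℝ (Fin n),
    (∏ i, u (z i)) * ballDet r z

lemma continuous_det_ballKernel (k : ℕ) :
    Continuous (ballDet (n := n) r (k := k)) := by
  refine Continuous.matrix_det (continuous_matrix fun i j => ?_)
  have := continuous_ballKernel (n := n) (r := r)
  simp only [Matrix.of_apply]
  fun_prop

lemma norm_fredholm_integrand_le (hr : 0 < r) {k : ℕ} {u : EuclideanSpace ℝ (Fin n) → ℂ}
    {b : EuclideanSpace ℝ (Fin n) → ℝ} (hub : ∀ x, ‖u x‖ ≤ b x)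
    (z w : Fin k → EuclideanSpace ℝ (Fin n)) :
    ‖(∏ i, u (z i)) * ballDet r w‖
      ≤ (∏ i, b (z i)) * ballVol n r ^ k := by
  rw [norm_mul, norm_prod]
  gcongr
  · exact Finset.prod_nonneg fun i _ => (norm_nonneg _).trans (hub _)
  · exact hub _
  · exact norm_det_ballKernel_le hr w

lemma integrable_fredholm_bound {b : EuclideanSpace ℝ (Fin n) → ℝ} (hb : Integrable b) (k : ℕ) :
    Integrable fun z : Fin k → EuclideanSpace ℝ (Fin n) => (∏ i, b (z i)) * ballVol n r ^ k :=
  (Integrable.fintype_prod fun _ : Fin k => hb).mul_const _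

lemma norm_fredholm_term_le (hr : 0 < r) (k : ℕ) {u : EuclideanSpace ℝ (Fin n) → ℂ}
    {b : EuclideanSpace ℝ (Fin n) → ℝ} (hub : ∀ x, ‖u x‖ ≤ b x) (hb : Integrable b)
    (φ : (Fin k → EuclideanSpace ℝ (Fin n)) → Fin k → EuclideanSpace ℝ (Fin n)) :
    ‖((-1) ^ k / (k.factorial : ℂ)) * ∫ z : Fin k → EuclideanSpace ℝ (Fin n),
      (∏ i, u (z i)) * ballDet r (φ z)‖
      ≤ ((∫ x, b x) * ballVol n r) ^ k / k.factorial := by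
  have h1 : ‖∫ z : Fin k → EuclideanSpace ℝ (Fin n),
      (∏ i, u (z i)) * ballDet r (φ z)‖
      ≤ ((∫ x, b x) * ballVol n r) ^ k := by
    refine (norm_integral_le_of_norm_le (integrable_fredholm_bound hb k)
      (.of_forall fun z => norm_fredholm_integrand_le hr hub z (φ z))).trans (le_of_eq ?_)
    rw [integral_mul_const, integral_fintype_prod_volume_eq_pow, mul_pow, Fintype.card_fin]
  rw [norm_mul, norm_div, norm_pow, norm_neg, norm_one, one_pow, Complex.norm_natCast,
    div_mul_eq_mul_div, one_mul]
  gcongr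

/-- Continuity of the Fredholm determinant under dominated convergence and under a distortion of
the arguments of the kernel. -/
lemma tendsto_fredholm_distorted (hr : 0 < r) {J : Type*} {l : Filter J} [l.IsCountablyGenerated]
    {π : J → EuclideanSpace ℝ (Fin n) → EuclideanSpace ℝ (Fin n)} (hπm : ∀ j, Measurable (π j))
    (hπ : ∀ x, Tendsto (fun j => π j x) l (𝓝 x))
    {u : J → EuclideanSpace ℝ (Fin n) → ℂ} {u₀ : EuclideanSpace ℝ (Fin n) → ℂ}
    (hum : ∀ j, Measurable (u j)) {b : EuclideanSpace ℝ (Fin n) → ℝ} (hb : Integrable b)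
    (hub : ∀ᶠ j in l, ∀ x, ‖u j x‖ ≤ b x) (hu : ∀ x, Tendsto (fun j => u j x) l (𝓝 (u₀ x))) :
    Tendsto (fun j => ∑' k : ℕ, ((-1) ^ k / (k.factorial : ℂ)) *
      ∫ z : Fin k → EuclideanSpace ℝ (Fin n),
        (∏ i, u j (z i)) * ballDet r fun i => π j (z i))
      l (𝓝 (ballFredholm n r u₀)) := by
  -- Dominated convergence is used twice: over `k` with the exponential series of `‖b‖₁ · vol`, and
  -- in each multiple integral with the product of the `b (z i)`.
  refine tendsto_tsum_of_dominated_convergence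
    (bound := fun k : ℕ => ((∫ x, b x) * ballVol n r) ^ k / k.factorial)
    (Real.summable_pow_div_factorial _) (fun k => ?_) ?_
  · refine Tendsto.const_mul _ (tendsto_integral_filter_of_dominated_convergence _ ?_ ?_
      (integrable_fredholm_bound (r := r) hb k) ?_)
    · refine .of_forall fun j => ?_
      have h1 : Measurable fun z : Fin k → EuclideanSpace ℝ (Fin n) =>
          ballDet r fun i => π j (z i) :=
        (continuous_det_ballKernel k).measurable.comp (by have := hπm j; fun_prop)
      have h2 := hum j
      exact (Measurable.mul (by fun_prop) h1).aestronglyMeasurable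
    · filter_upwards [hub] with j hj
      exact .of_forall fun z => norm_fredholm_integrand_le hr hj z (fun i => π j (z i))
    · refine .of_forall fun z => Tendsto.mul (tendsto_finsetProd _ fun i _ => hu (z i)) ?_
      exact ((continuous_det_ballKernel k).tendsto z).comp (f := fun j i => π j (z i))
        (tendsto_pi_nhds.2 fun i => hπ (z i))
  · filter_upwards [hub] with j hj k
    exact norm_fredholm_term_le hr k hj hb fun z i => π j (z i)

lemma tendsto_ballFredholm (hr : 0 < r) {J : Type*} {l : Filter J} [l.IsCountablyGenerated]
    {u : J → EuclideanSpace ℝ (Fin n) → ℂ} {u₀ : EuclideanSpace ℝ (Fin n) → ℂ}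
    (hum : ∀ j, Measurable (u j)) {b : EuclideanSpace ℝ (Fin n) → ℝ} (hb : Integrable b)
    (hub : ∀ᶠ j in l, ∀ x, ‖u j x‖ ≤ b x) (hu : ∀ x, Tendsto (fun j => u j x) l (𝓝 (u₀ x))) :
    Tendsto (fun j => ballFredholm n r (u j)) l (𝓝 (ballFredholm n r u₀)) :=
  tendsto_fredholm_distorted hr (π := fun _ x => x) (fun _ => measurable_id)
    (fun _ => tendsto_const_nhds) hum hb hub hu

/-- The index of the cell of the lattice `h ℤⁿ` containing `x`. -/
noncomputable def cellIndex (h : ℝ) (x : EuclideanSpace ℝ (Fin n)) : Fin n → ℤ := fun i => ⌊x i / h⌋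

/-- The corner of the cell of the lattice `h ℤⁿ` containing `x`. -/
noncomputable def cellCorner (h : ℝ) (x : EuclideanSpace ℝ (Fin n)) : EuclideanSpace ℝ (Fin n) :=
  h • latticePoint (cellIndex h x)

lemma measurable_cellIndex (h : ℝ) : Measurable (cellIndex (n := n) h) := by
  refine measurable_pi_lambda _ fun i => Int.measurable_floor.comp ?_
  fun_prop

lemma measurable_cellCorner (h : ℝ) : Measurable (cellCorner (n := n) h) :=
  (measurable_from_top (f := fun m : Fin n → ℤ => h • latticePoint m)).comp
    (by
      have := measurable_cellIndex (n := n) h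
      exact this.mono le_rfl (by
        intro s _; exact MeasurableSet.of_discrete))

lemma dist_cellCorner_le {h : ℝ} (hh : 0 < h) (x : EuclideanSpace ℝ (Fin n)) :
    dist (cellCorner h x) x ≤ h * Real.sqrt n := by
  rw [EuclideanSpace.dist_eq]
  have h1 : ∀ i, dist ((cellCorner h x) i) (x i) ^ 2 ≤ h ^ 2 := by
    intro i
    have h2 : (cellCorner h x) i = h * ⌊x i / h⌋ := by simp [cellCorner, latticePoint, cellIndex]
    have h3 := Int.floor_le (x i / h)
    have h4 := Int.lt_floor_add_one (x i / h)
    rw [le_div_iff₀ hh] at h3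
    rw [div_lt_iff₀ hh] at h4
    rw [h2, Real.dist_eq, sq_le_sq, abs_abs, abs_of_pos hh, abs_le]
    constructor <;> nlinarith
  calc _ ≤ Real.sqrt (∑ _i : Fin n, h ^ 2) := Real.sqrt_le_sqrt (Finset.sum_le_sum fun i _ => h1 i)
    _ = _ := by
      rw [Finset.sum_const, Finset.card_univ, Fintype.card_fin, nsmul_eq_mul,
        Real.sqrt_mul (by positivity), Real.sqrt_sq hh.le, mul_comm]

lemma tendsto_cellCorner (x : EuclideanSpace ℝ (Fin n)) :
    Tendsto (fun h => cellCorner h x) (𝓝[>] 0) (𝓝 x) := by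
  rw [tendsto_iff_dist_tendsto_zero]
  refine squeeze_zero' (.of_forall fun h => dist_nonneg)
    (eventually_nhdsWithin_of_forall fun h (hh : 0 < h) => dist_cellCorner_le hh x) ?_
  have : Tendsto (fun h : ℝ => h * Real.sqrt n) (𝓝 0) (𝓝 (0 * Real.sqrt n)) :=
    tendsto_id.mul_const _
  rw [zero_mul] at this
  exact this.mono_left nhdsWithin_le_nhds

/-- Cells are cubes of volume `h ^ n`. Integrals of functions constant on cells therefore become
weighted lattice sums. -/
lemma map_cellIndex {h : ℝ} (hh : 0 < h) :
    (volume : Measure (EuclideanSpace ℝ (Fin n))).map (cellIndex h)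
      = (h ^ n).toNNReal • Measure.count := by
  refine Measure.ext_of_singleton fun m => ?_
  rw [Measure.map_apply (measurable_cellIndex h) (measurableSet_singleton m)]
  have h1 : cellIndex h ⁻¹' {m} = WithLp.ofLp ⁻¹' (Set.univ.pi fun i : Fin n =>
      Set.Ico (h * m i) (h * m i + h)) := by
    ext x
    simp only [Set.mem_preimage, Set.mem_singleton_iff, Set.mem_pi, Set.mem_univ, true_implies,
      funext_iff, cellIndex, Int.floor_eq_iff, Set.mem_Ico]
    refine forall_congr' fun i => ?_
    rw [le_div_iff₀ hh, div_lt_iff₀ hh]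
    constructor <;> rintro ⟨h1, h2⟩ <;> constructor <;> linarith
  rw [h1, (PiLp.volume_preserving_ofLp (Fin n)).measure_preimage
    (MeasurableSet.univ_pi fun _ => measurableSet_Ico).nullMeasurableSet, Real.volume_pi_Ico]
  simp only [add_sub_cancel_left, Finset.prod_const, Finset.card_univ, Fintype.card_fin]
  rw [Measure.smul_apply, Measure.count_singleton, ENNReal.smul_def, smul_eq_mul, mul_one,
    ← ENNReal.ofReal_pow hh.le]
  rfl

lemma integrableOn_finset_of_singleton_lt_top {X F : Type*} [MeasurableSpace X]
    [MeasurableSingletonClass X] [NormedAddCommGroup F] {μ : Measure X} (hμ : ∀ x, μ {x} < ⊤)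
    (s : Finset X) (f : X → F) : IntegrableOn f s μ := by
  rw [← (s : Set X).biUnion_of_singleton]
  simp [integrableOn_finset_iUnion, hμ]

lemma integral_comp_cellIndex {F : Type*} [NormedAddCommGroup F] [NormedSpace ℝ F]
    [CompleteSpace F] {h : ℝ} (hh : 0 < h) (S : Finset (Fin n → ℤ))
    {G : (Fin n → ℤ) → F} (hG : ∀ m, m ∉ S → G m = 0) :
    ∫ x : EuclideanSpace ℝ (Fin n), G (cellIndex h x) = h ^ n • ∑ m : S, G m := by
  rw [← integral_map (measurable_cellIndex h).aemeasurable
    (StronglyMeasurable.of_discrete (f := G)).aestronglyMeasurable, map_cellIndex hh,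
    ← setIntegral_eq_integral_of_forall_compl_eq_zero (s := (S : Set (Fin n → ℤ)))
      (fun m hm => hG m (by simpa using hm)),
    setIntegral_finset]
  · rw [Finset.smul_sum, ← Finset.sum_coe_sort S]
    refine Finset.sum_congr rfl fun m _ => ?_
    congr 1
    rw [measureReal_def, Measure.smul_apply, Measure.count_singleton, ENNReal.smul_def,
      smul_eq_mul, mul_one, ENNReal.coe_toReal, Real.coe_toNNReal _ (by positivity)]
  · refine integrableOn_finset_of_singleton_lt_top (fun m => ?_) _ _
    rw [Measure.smul_apply, Measure.count_singleton, ENNReal.smul_def, smul_eq_mul, mul_one]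
    exact ENNReal.coe_lt_top

lemma integral_comp_cellIndex_pi {k : ℕ} {h : ℝ} (hh : 0 < h) (S : Finset (Fin n → ℤ))
    {G : (Fin k → Fin n → ℤ) → ℂ} (hG : ∀ m, (∃ i, m i ∉ S) → G m = 0) :
    ∫ z : Fin k → EuclideanSpace ℝ (Fin n), G (fun i => cellIndex h (z i))
      = (h : ℂ) ^ (n * k) * ∑ m : Fin k → S, G (fun i => m i) := by
  have hmp : MeasurePreserving (fun (z : Fin k → EuclideanSpace ℝ (Fin n)) i => cellIndex h (z i))
      volume (Measure.pi fun _ => (h ^ n).toNNReal • Measure.count) :=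
    measurePreserving_pi _ _ fun _ => ⟨measurable_cellIndex h, map_cellIndex hh⟩
  rw [← integral_map hmp.measurable.aemeasurable
    (StronglyMeasurable.of_discrete (f := G)).aestronglyMeasurable, hmp.map_eq,
    ← setIntegral_eq_integral_of_forall_compl_eq_zero
      (s := ((Fintype.piFinset fun _ : Fin k => S : Finset _) : Set (Fin k → Fin n → ℤ)))
      (fun m hm => hG m (by
        simp only [Finset.mem_coe, Fintype.mem_piFinset, not_forall] at hm; exact hm)),
    setIntegral_finset]
  · have h1 : ∀ m : Fin k → Fin n → ℤ,
        (Measure.pi fun _ : Fin k => (h ^ n).toNNReal • (Measure.count :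
          Measure (Fin n → ℤ))).real {m} = h ^ (n * k) := by
      intro m
      rw [measureReal_def, Measure.pi_singleton]
      simp only [Measure.smul_apply, Measure.count_singleton, ENNReal.smul_def, smul_eq_mul,
        mul_one, Finset.prod_const, Finset.card_univ, Fintype.card_fin, ENNReal.toReal_pow,
        ENNReal.coe_toReal]
      rw [Real.coe_toNNReal _ (by positivity), pow_mul]
    simp only [h1]
    rw [← Finset.smul_sum, Complex.real_smul]
    push_cast
    congr 1
    symm
    refine Finset.sum_bij (fun (m : Fin k → S) _ => fun i => (m i : Fin n → ℤ)) ?_ ?_ ?_ ?_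
    · intro m _; simp
    · intro m _ m' _ hm
      funext i; exact Subtype.ext (congrFun hm i)
    · intro m hm
      rw [Fintype.mem_piFinset] at hm
      exact ⟨fun i => ⟨m i, hm i⟩, Finset.mem_univ _, rfl⟩
    · intro m _; rfl
  · refine integrableOn_finset_of_singleton_lt_top (fun m => ?_) _ _
    rw [Measure.pi_singleton]
    refine ENNReal.prod_lt_top fun i _ => ?_
    rw [Measure.smul_apply, Measure.count_singleton, ENNReal.smul_def, smul_eq_mul, mul_one]
    exact ENNReal.coe_lt_top

/-- The discretised Fredholm determinant is a finite determinant. -/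
lemma fredholm_cellCorner_eq_det {h : ℝ} (hh : 0 < h) (S : Finset (Fin n → ℤ))
    {u : EuclideanSpace ℝ (Fin n) → ℂ} (hu : ∀ m, m ∉ S → u (h • latticePoint m) = 0) :
    ∑' k : ℕ, ((-1) ^ k / (k.factorial : ℂ)) *
      ∫ z : Fin k → EuclideanSpace ℝ (Fin n), (∏ i, u (cellCorner h (z i))) *
        (ballDet r fun i => cellCorner h (z i))
      = (1 + (Matrix.diagonal fun m : S => -u (h • latticePoint m.1)) *
        latticeMatrix r h S).det := by
  rw [← (hasSum_det_submatrix _).tsum_eq]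
  congr 1
  funext k
  have h1 := integral_comp_cellIndex_pi (k := k) hh S
    (G := fun m => (∏ i, u (h • latticePoint (m i))) *
      ballDet r fun i => h • latticePoint (m i))
    (fun m ⟨i, hi⟩ => by
      rw [Finset.prod_eq_zero (Finset.mem_univ i) (hu _ hi), zero_mul])
  change _ * ∫ z : Fin k → EuclideanSpace ℝ (Fin n), (∏ i, u (h • latticePoint (cellIndex h (z i))))
    * (ballDet r fun i => h • latticePoint (cellIndex h (z i))) = _
  rw [h1, div_mul_eq_mul_div, div_mul_eq_mul_div, one_mul, Finset.mul_sum, Finset.mul_sum]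
  congr 1
  refine Finset.sum_congr rfl fun m _ => ?_
  -- In each term the signs `(-1)^k` go into `-u`, and the product of the cell volumes goes into the
  -- factors `h ^ n` of the lattice matrix.
  have h2 : ((Matrix.diagonal fun m : S => -u (h • latticePoint m.1)) *
      latticeMatrix r h S).submatrix m m
      = Matrix.of fun i i' => (-u (h • latticePoint (m i).1) * (h : ℂ) ^ n) *
        (Matrix.of fun i i' => ballKernel n r (h • latticePoint (m i).1
          - h • latticePoint (m i').1)) i i' := by
    ext i i'
    simp [latticeMatrix, Matrix.diagonal_mul, mul_assoc]
  rw [h2, Matrix.det_mul_column, ballDet, Finset.prod_mul_distrib, Finset.prod_neg]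
  simp only [Finset.prod_const, Finset.card_univ, Fintype.card_fin]
  rw [pow_mul]
  ring

end Fredholm

/-! ### Gaussian approximation of the continuous Fredholm determinant -/

section GaussianApproximation
open scoped Topology ComplexConjugate
variable {n : ℕ} {r : ℝ}

/-- The variance functional of the determinantal process with kernel `ballKernel n r (x - y)`. -/
noncomputable def ballVariance (r : ℝ) (f : EuclideanSpace ℝ (Fin n) → ℝ) : ℝ :=
  ballVol n r * (∫ x, f x ^ 2) - ∫ x, ∫ y, f x * f y * ‖ballKernel n r (x - y)‖ ^ 2

/-- For `h ≤ 1` a corner lies within `√n` of its point. One multiple of the indicator of the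
enlarged support then dominates `f` and all its discretisations. -/
lemma exists_cellCorner_bound {F : Type*} [NormedAddCommGroup F]
    {f : EuclideanSpace ℝ (Fin n) → F} (hfc : Continuous f)
    (hfs : HasCompactSupport f) : ∃ b : EuclideanSpace ℝ (Fin n) → ℝ, Integrable b ∧
      (∀ x, ‖f x‖ ≤ b x) ∧
      ∀ᶠ h in 𝓝[>] (0 : ℝ), ∀ x, ‖f (cellCorner h x)‖ ≤ b x := by
  obtain ⟨C, hC⟩ := hfs.exists_bound_of_continuous hfc
  obtain ⟨R, hR⟩ := hfs.isCompact.isBounded.subset_closedBall (0 : EuclideanSpace ℝ (Fin n))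
  have hC0 : 0 ≤ C := (norm_nonneg _).trans (hC 0)
  have hs0 : 0 ≤ Real.sqrt n := Real.sqrt_nonneg _
  have key : ∀ x y, dist y x ≤ Real.sqrt n →
      ‖f y‖ ≤ (Metric.closedBall (0 : EuclideanSpace ℝ (Fin n)) (R + Real.sqrt n)).indicator
        (fun _ => C) x := by
    intro x y hxy
    by_cases h : x ∈ Metric.closedBall (0 : EuclideanSpace ℝ (Fin n)) (R + Real.sqrt n)
    · rw [Set.indicator_of_mem h]
      exact hC y
    · rw [Set.indicator_of_notMem h]
      by_contra hne
      have : f y ≠ 0 := fun h0 => hne (by rw [h0, norm_zero])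
      have hy := hR (subset_tsupport f this)
      rw [Metric.mem_closedBall] at hy h
      exact h (by
        have := dist_triangle x y 0
        rw [dist_comm x y] at this
        linarith)
  refine ⟨(Metric.closedBall (0 : EuclideanSpace ℝ (Fin n)) (R + Real.sqrt n)).indicator
    fun _ => C, ?_, fun x => key x x (by simp), ?_⟩
  · exact (integrable_indicator_iff Metric.isClosed_closedBall.measurableSet).2
      (integrableOn_const measure_closedBall_lt_top.ne)
  · have : ∀ᶠ h in 𝓝[>] (0 : ℝ), h ≤ 1 :=
      nhdsWithin_le_nhds (Iic_mem_nhds zero_lt_one)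
    filter_upwards [this, self_mem_nhdsWithin] with h h1 (h0 : 0 < h) x
    refine key x _ ((dist_cellCorner_le h0 x).trans ?_)
    nlinarith

lemma tendsto_integral_cellCorner {F : Type*} [NormedAddCommGroup F] [NormedSpace ℝ F]
    {f : EuclideanSpace ℝ (Fin n) → F} (hfc : Continuous f) (hfs : HasCompactSupport f) :
    Tendsto (fun h => ∫ x, f (cellCorner h x)) (𝓝[>] 0) (𝓝 (∫ x, f x)) := by
  obtain ⟨b, hb, -, hfb⟩ := exists_cellCorner_bound hfc hfs
  refine tendsto_integral_filter_of_dominated_convergence b ?_ ?_ hb ?_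
  · exact .of_forall fun h =>
      (hfc.stronglyMeasurable.comp_measurable (measurable_cellCorner h)).aestronglyMeasurable
  · filter_upwards [hfb] with h hh using .of_forall hh
  · exact .of_forall fun x => (hfc.tendsto x).comp (tendsto_cellCorner x)

lemma tendsto_integral_integral_cellCorner {f : EuclideanSpace ℝ (Fin n) → ℝ} (hfc : Continuous f)
    (hfs : HasCompactSupport f) :
    Tendsto (fun h => ∫ x, ∫ y, f (cellCorner h x) * f (cellCorner h y) *
      ‖ballKernel n r (cellCorner h x - cellCorner h y)‖ ^ 2) (𝓝[>] 0)
      (𝓝 (∫ x, ∫ y, f x * f y * ‖ballKernel n r (x - y)‖ ^ 2)) := by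
  obtain ⟨b, hb, hfb0, hfb⟩ := exists_cellCorner_bound hfc hfs
  have hk := continuous_ballKernel (n := n) (r := r)
  have hG : Continuous fun p : EuclideanSpace ℝ (Fin n) × EuclideanSpace ℝ (Fin n) =>
      f p.1 * f p.2 * ‖ballKernel n r (p.1 - p.2)‖ ^ 2 := by fun_prop
  have hbound : ∀ {a c : ℝ} {w z z'}, |f z| ≤ a → |f z'| ≤ c →
      ‖f z * f z' * ‖ballKernel n r w‖ ^ 2‖ ≤ a * c * ballVol n r ^ 2 := by
    intro a c w z z' ha hc
    have ha0 : 0 ≤ a := (abs_nonneg _).trans ha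
    rw [Real.norm_eq_abs, abs_mul, abs_mul, abs_of_nonneg (by positivity : 0 ≤ ‖_‖ ^ 2)]
    have h1 : |f z| * |f z'| ≤ a * c := by gcongr
    have h2 : ‖ballKernel n r w‖ ^ 2 ≤ ballVol n r ^ 2 := by
      gcongr; exact norm_ballKernel_le w
    exact mul_le_mul h1 h2 (by positivity) ((by positivity : (0 : ℝ) ≤ |f z| * |f z'|).trans h1)
  have hm : ∀ h, Measurable fun p : EuclideanSpace ℝ (Fin n) × EuclideanSpace ℝ (Fin n) =>
      f (cellCorner h p.1) * f (cellCorner h p.2) *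
        ‖ballKernel n r (cellCorner h p.1 - cellCorner h p.2)‖ ^ 2 := fun h =>
    hG.measurable.comp (((measurable_cellCorner h).comp measurable_fst).prodMk
      ((measurable_cellCorner h).comp measurable_snd))
  refine tendsto_integral_filter_of_dominated_convergence
    (fun x => ∫ y, b x * b y * ballVol n r ^ 2) ?_ ?_ ?_ ?_
  · exact .of_forall fun h => (hm h).stronglyMeasurable.integral_prod_right.aestronglyMeasurable
  · filter_upwards [hfb] with h hh
    refine .of_forall fun x => norm_integral_le_of_norm_le ((hb.const_mul _).mul_const _)
      (.of_forall fun y => hbound (hh x) (hh y))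
  · simp only [integral_mul_const, integral_const_mul]
    exact (hb.mul_const _).mul_const _
  · refine .of_forall fun x => tendsto_integral_filter_of_dominated_convergence
      (fun y => b x * b y * ballVol n r ^ 2) ?_ ?_ ((hb.const_mul _).mul_const _) ?_
    · exact .of_forall fun h => ((hm h).comp measurable_prodMk_left).aestronglyMeasurable
    · filter_upwards [hfb] with h hh
      exact .of_forall fun y => hbound (hh x) (hh y)
    · exact .of_forall fun y => (hG.tendsto (x, y)).comp
        ((tendsto_cellCorner x).prodMk_nhds (tendsto_cellCorner y))

lemma exists_finset_latticePoint {f : EuclideanSpace ℝ (Fin n) → ℝ} (hfs : HasCompactSupport f)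
    {h : ℝ} (hh : 0 < h) : ∃ S : Finset (Fin n → ℤ), ∀ m, m ∉ S → f (h • latticePoint m) = 0 := by
  obtain ⟨R, hR⟩ := hfs.isCompact.isBounded.subset_closedBall (0 : EuclideanSpace ℝ (Fin n))
  refine ⟨Fintype.piFinset fun _ => Finset.Icc (-⌈R / h⌉) ⌈R / h⌉, fun m hm => ?_⟩
  by_contra hne
  refine hm ?_
  rw [Fintype.mem_piFinset]
  intro i
  have h1 := hR (subset_tsupport f hne)
  rw [mem_closedBall_zero_iff, norm_smul, Real.norm_eq_abs, abs_of_pos hh, mul_comm,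
    ← le_div_iff₀ hh] at h1
  have h2 : |(m i : ℝ)| ≤ R / h := by
    have := PiLp.norm_apply_le (latticePoint m) i
    exact (by simpa [latticePoint] using this : |(m i : ℝ)| ≤ ‖latticePoint m‖).trans h1
  have h3 := Int.le_ceil (R / h)
  rw [abs_le] at h2
  rw [Finset.mem_Icc]
  constructor
  · have : (-(⌈R / h⌉ : ℤ) : ℝ) ≤ m i := by linarith
    exact_mod_cast this
  · have : (m i : ℝ) ≤ ⌈R / h⌉ := by linarith
    exact_mod_cast this

/-- Quantitative Gaussian approximation of the Fredholm determinant `det(I - (1 - e^{iTf}) K)`. -/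
theorem norm_ballFredholm_sub_gaussian_le (hr : 0 < r) {f : EuclideanSpace ℝ (Fin n) → ℝ}
    (hfc : Continuous f) (hfs : HasCompactSupport f) {B T : ℝ} (hB : 0 ≤ B) (hfB : ∀ x, |f x| ≤ B)
    (hT : 0 ≤ T) (hBT : 192 * (B * T) ≤ 1) :
    ‖ballFredholm n r (fun x => 1 - Complex.exp (Complex.I * T * f x)) *
        Complex.exp (-(Complex.I * T * (ballVol n r * ∫ x, f x : ℝ)))
        - Real.exp (-(T ^ 2 * ballVariance r f / 2))‖
      ≤ 40 * B * T ^ 3 * ballVariance r f := by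
  set u : EuclideanSpace ℝ (Fin n) → ℂ := fun x => 1 - Complex.exp (Complex.I * T * f x) with hu
  have huc : Continuous u := by fun_prop
  have hus : HasCompactSupport u := by
    refine hfs.mono' fun x hx => ?_
    by_contra hx'
    exact hx (by simp [hu, image_eq_zero_of_notMem_tsupport hx'])
  -- Moving every point to its cell corner turns the determinant, the mean and the variance into
  -- those of the lattice matrix. All three converge as `h → 0`, and the matrix bound does not
  -- depend on the number of lattice points, so it passes to the limit.
  set D : ℝ → ℂ := fun h => ∑' k : ℕ, ((-1) ^ k / (k.factorial : ℂ)) *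
      ∫ z : Fin k → EuclideanSpace ℝ (Fin n), (∏ i, u (cellCorner h (z i))) *
        (ballDet r fun i => cellCorner h (z i)) with hD
  set m : ℝ → ℝ := fun h => ballVol n r * ∫ x, f (cellCorner h x) with hm
  set V : ℝ → ℝ := fun h => ballVol n r * (∫ x, f (cellCorner h x) ^ 2)
    - ∫ x, ∫ y, f (cellCorner h x) * f (cellCorner h y) *
      ‖ballKernel n r (cellCorner h x - cellCorner h y)‖ ^ 2 with hV
  have hDlim : Tendsto D (𝓝[>] 0) (𝓝 (ballFredholm n r u)) := by
    obtain ⟨b, hb, -, hub⟩ := exists_cellCorner_bound huc hus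
    exact tendsto_fredholm_distorted hr (u := fun h x => u (cellCorner h x))
      (fun h => measurable_cellCorner h) tendsto_cellCorner
      (fun h => huc.measurable.comp (measurable_cellCorner h)) hb hub
      (fun x => (huc.tendsto x).comp (tendsto_cellCorner x))
  have hmlim : Tendsto m (𝓝[>] 0) (𝓝 (ballVol n r * ∫ x, f x)) :=
    (tendsto_integral_cellCorner hfc hfs).const_mul _
  have hVlim : Tendsto V (𝓝[>] 0) (𝓝 (ballVariance r f)) := by
    refine Tendsto.sub ((tendsto_integral_cellCorner (f := fun x => f x ^ 2) (by fun_prop)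
      ?_).const_mul _) (tendsto_integral_integral_cellCorner hfc hfs)
    exact hfs.comp_left (g := fun t : ℝ => t ^ 2) (by simp)
  have hev : ∀ᶠ h in 𝓝[>] (0 : ℝ),
      ‖D h * Complex.exp (-(Complex.I * T * (m h : ℝ))) - Real.exp (-(T ^ 2 * V h / 2))‖
        ≤ 40 * B * T ^ 3 * V h := by
    have h1 : ∀ᶠ h in 𝓝[>] (0 : ℝ), h * r < 1 / 2 := by
      have : Tendsto (fun h : ℝ => h * r) (𝓝[>] 0) (𝓝 (0 * r)) :=
        (tendsto_id.mul_const r).mono_left nhdsWithin_le_nhds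
      rw [zero_mul] at this
      exact this.eventually_lt_const (by norm_num)
    filter_upwards [h1, self_mem_nhdsWithin] with h hhr (hh : 0 < h)
    obtain ⟨S, hS⟩ := exists_finset_latticePoint hfs hh
    obtain ⟨hpsd, hpsd1⟩ := posSemidef_latticeMatrix (r := r) hh hhr S
    set d : S → ℝ := fun i => f (h • latticePoint i.1) with hd
    have hDet : D h = tiltDet (latticeMatrix r h S) d T := by
      rw [hD]
      simp only
      rw [fredholm_cellCorner_eq_det hh S (fun m' hm' => by simp [hu, hS m' hm']), tiltDet]
      congr 3
      rw [phaseMatrix, ← Matrix.diagonal_one, Matrix.diagonal_sub]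
      congr 1; funext i
      simp [hu, hd]
    have hdiag : ∀ i, latticeMatrix r h S i i = ((h ^ n * ballVol n r : ℝ) : ℂ) := by
      intro i
      rw [latticeMatrix, Matrix.of_apply, sub_self, ballKernel_zero]
      push_cast; rfl
    have hoff : ∀ i j, latticeMatrix r h S i j * latticeMatrix r h S j i
        = ((h ^ n * h ^ n * ‖ballKernel n r (h • latticePoint i.1 - h • latticePoint j.1)‖ ^ 2 : ℝ)
          : ℂ) := by
      intro i j
      rw [latticeMatrix, Matrix.of_apply, Matrix.of_apply,
        ← neg_sub (h • latticePoint i.1) (h • latticePoint j.1), ← conj_ballKernel]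
      rw [← Complex.normSq_eq_norm_sq]
      push_cast
      rw [← Complex.mul_conj]
      ring
    have hm' : m h = ∑ i : S, h ^ n * ballVol n r * d i := by
      have := integral_comp_cellIndex hh S (G := fun m => f (h • latticePoint m)) hS
      change ballVol n r * ∫ x, f (h • latticePoint (cellIndex h x)) = _
      rw [this, smul_eq_mul, ← Finset.mul_sum]
      ring
    have hV' : V h = ∑ i : S, h ^ n * ballVol n r * d i ^ 2
        - ∑ i : S, ∑ j : S, d i * d j *
          (h ^ n * h ^ n * ‖ballKernel n r (h • latticePoint i.1 - h • latticePoint j.1)‖ ^ 2) := by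
      have e1 := integral_comp_cellIndex hh S (G := fun m => f (h • latticePoint m) ^ 2)
        (fun m hm => by simp [hS m hm])
      have e2 : ∀ x : EuclideanSpace ℝ (Fin n),
          ∫ y : EuclideanSpace ℝ (Fin n), f (h • latticePoint (cellIndex h x)) *
            f (h • latticePoint (cellIndex h y)) *
            ‖ballKernel n r (h • latticePoint (cellIndex h x)
              - h • latticePoint (cellIndex h y))‖ ^ 2
          = h ^ n • ∑ j : S, f (h • latticePoint (cellIndex h x)) * f (h • latticePoint j.1) *
            ‖ballKernel n r (h • latticePoint (cellIndex h x) - h • latticePoint j.1)‖ ^ 2 :=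
        fun x => integral_comp_cellIndex hh S
          (G := fun m => f (h • latticePoint (cellIndex h x)) * f (h • latticePoint m) *
            ‖ballKernel n r (h • latticePoint (cellIndex h x) - h • latticePoint m)‖ ^ 2)
          (fun m hm => by simp [hS m hm])
      have e3 := integral_comp_cellIndex hh S (G := fun m' => h ^ n • ∑ j : S,
        f (h • latticePoint m') * f (h • latticePoint j.1) *
            ‖ballKernel n r (h • latticePoint m' - h • latticePoint j.1)‖ ^ 2)
        (fun m hm => by simp [hS m hm])
      change ballVol n r * (∫ x, f (h • latticePoint (cellIndex h x)) ^ 2)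
        - ∫ x : EuclideanSpace ℝ (Fin n), ∫ y : EuclideanSpace ℝ (Fin n),
          f (h • latticePoint (cellIndex h x)) * f (h • latticePoint (cellIndex h y)) *
            ‖ballKernel n r (h • latticePoint (cellIndex h x)
              - h • latticePoint (cellIndex h y))‖ ^ 2 = _
      rw [e1]
      simp only [e2]
      rw [e3]
      simp only [smul_eq_mul, Finset.mul_sum]
      congr 1
      · exact Finset.sum_congr rfl fun i _ => by ring
      · exact Finset.sum_congr rfl fun i _ => Finset.sum_congr rfl fun j _ => by ring
    rw [hDet]
    refine norm_tiltDet_sub_gaussian_le_of_contraction hpsd hpsd1 hB (fun i => hfB _) hT hBT ?_ ?_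
    · rw [hm', Matrix.trace]
      push_cast
      refine Finset.sum_congr rfl fun i _ => ?_
      rw [Matrix.diag_apply, realDiagonal, Matrix.diagonal_mul, hdiag]
      push_cast; ring
    · rw [hV', Matrix.mul_sub, Matrix.mul_one, Matrix.sub_mul, Matrix.sub_mul, Matrix.trace_sub]
      push_cast
      congr 1
      · rw [Matrix.trace]
        refine Finset.sum_congr rfl fun i _ => ?_
        rw [Matrix.diag_apply, realDiagonal, Matrix.diagonal_mul_diagonal, Matrix.diagonal_mul,
          hdiag]
        push_cast; ring
      · rw [Matrix.trace]
        refine Finset.sum_congr rfl fun i _ => ?_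
        rw [Matrix.diag_apply, Matrix.mul_apply]
        refine Finset.sum_congr rfl fun j _ => ?_
        rw [realDiagonal, Matrix.mul_diagonal, Matrix.diagonal_mul]
        have := hoff i j
        push_cast at this
        linear_combination (d i : ℂ) * d j * this
  have hlim1 : Tendsto (fun h =>
      ‖D h * Complex.exp (-(Complex.I * T * (m h : ℝ))) - Real.exp (-(T ^ 2 * V h / 2))‖)
      (𝓝[>] 0) (𝓝 ‖ballFredholm n r u *
        Complex.exp (-(Complex.I * T * (ballVol n r * ∫ x, f x : ℝ)))
        - Real.exp (-(T ^ 2 * ballVariance r f / 2))‖) := by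
    refine Tendsto.norm (Tendsto.sub (hDlim.mul ?_) ?_)
    · have : Continuous fun t : ℝ => Complex.exp (-(Complex.I * T * (t : ℝ))) := by fun_prop
      exact (this.tendsto _).comp hmlim
    · have : Continuous fun t : ℝ => ((Real.exp (-(T ^ 2 * t / 2)) : ℝ) : ℂ) := by fun_prop
      exact (this.tendsto _).comp hVlim
  exact le_of_tendsto_of_tendsto hlim1 (hVlim.const_mul _) hev

end GaussianApproximation

/-! ### Holomorphic dependence of integrals and Fredholm determinants -/

section HolomorphicIntegral
open scoped Topology

/-- A parametric integral of a locally bounded family of holomorphic functions is holomorphic. -/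
lemma differentiableOn_integral_of_norm_le {X : Type*} [MeasurableSpace X] {ν : Measure X}
    {U : Set ℂ} (hU : IsOpen U) {F : ℂ → X → ℂ}
    (hm : ∀ w ∈ U, AEStronglyMeasurable (F w) ν)
    (hd : ∀ x, DifferentiableOn ℂ (fun w => F w x) U) {b : X → ℝ} (hb : Integrable b ν)
    (hF : ∀ᵐ x ∂ν, ∀ w ∈ U, ‖F w x‖ ≤ b x) :
    DifferentiableOn ℂ (fun w => ∫ x, F w x ∂ν) U := by
  intro w₀ hw₀
  obtain ⟨ε, hε, hεU⟩ := Metric.isOpen_iff.1 hU w₀ hw₀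
  have hball : Metric.ball w₀ (ε / 2) ∈ 𝓝 w₀ := Metric.ball_mem_nhds _ (half_pos hε)
  have hsub : ∀ w ∈ Metric.ball w₀ (ε / 2), Metric.closedBall w (ε / 4) ⊆ U := fun w hw z hz =>
    hεU (by
      rw [Metric.mem_ball] at hw ⊢
      rw [Metric.mem_closedBall] at hz
      linarith [dist_triangle z w w₀])
  have hmemU : ∀ w ∈ Metric.ball w₀ (ε / 2), w ∈ U := fun w hw =>
    hsub w hw (Metric.mem_closedBall_self (by positivity))
  have hderiv : ∀ x, ∀ w ∈ U, HasDerivAt (fun w => F w x) (deriv (fun w => F w x) w) w :=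
    fun x w hw => ((hd x).differentiableAt (hU.mem_nhds hw)).hasDerivAt
  have hmeas' : AEStronglyMeasurable (fun x => deriv (fun w => F w x) w₀) ν := by
    -- The derivative is measurable in `x` as a pointwise limit of difference quotients along a
    -- sequence of increments that keeps the argument inside `U`.
    have hseq : Tendsto (fun k : ℕ => ((ε / 2 / (k + 1) : ℝ) : ℂ)) atTop (𝓝[≠] 0) := by
      rw [tendsto_nhdsWithin_iff]
      constructor
      · have : Tendsto (fun k : ℕ => (ε / 2) / ((k : ℝ) + 1)) atTop (𝓝 0) := by
          have := (tendsto_one_div_add_atTop_nhds_zero_nat (𝕜 := ℝ)).const_mul (ε / 2)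
          simpa [div_eq_mul_inv] using this
        exact_mod_cast (Complex.continuous_ofReal.tendsto 0).comp this
      · refine .of_forall fun k => ?_
        have : (ε / 2 / ((k : ℝ) + 1)) ≠ 0 := by positivity
        exact Complex.ofReal_ne_zero.2 this
    have hev : ∀ k : ℕ, w₀ + ((ε / 2 / (k + 1) : ℝ) : ℂ) ∈ U := fun k => hεU (by
      rw [Metric.mem_ball, dist_eq_norm, add_sub_cancel_left, Complex.norm_real,
        Real.norm_eq_abs, abs_of_pos (by positivity)]
      have : ε / 2 / ((k : ℝ) + 1) ≤ ε / 2 := div_le_self (by positivity) (by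
        linarith [(Nat.cast_nonneg k : (0 : ℝ) ≤ k)])
      linarith)
    refine aestronglyMeasurable_of_tendsto_ae atTop
      (f := fun (k : ℕ) x => ((ε / 2 / (k + 1) : ℝ) : ℂ)⁻¹ •
        (F (w₀ + ((ε / 2 / (k + 1) : ℝ) : ℂ)) x - F w₀ x)) (fun k => ?_) ?_
    · exact ((hm _ (hev k)).sub (hm _ hw₀)).const_mul _
    · exact .of_forall fun x => (hasDerivAt_iff_tendsto_slope_zero.1 (hderiv x w₀ hw₀)).comp hseq
  refine (hasDerivAt_integral_of_dominated_loc_of_deriv_le hball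
    (F := F) (F' := fun w x => deriv (fun w => F w x) w) (bound := fun x => b x / (ε / 4)) ?_ ?_
    hmeas' ?_ (hb.div_const _) ?_).2.differentiableAt.differentiableWithinAt
  · filter_upwards [hball] with w hw using hm w (hmemU w hw)
  · exact hb.mono' (hm _ hw₀) (by filter_upwards [hF] with x hx using hx w₀ hw₀)
  · filter_upwards [hF] with x hx w hw
    -- Cauchy's estimate on a circle of radius `ε/4` bounds the derivative by the same majorant `b`.
    refine Complex.norm_deriv_le_of_forall_mem_sphere_norm_le (by positivity) ?_ fun z hz =>
      hx z (hsub w hw (Metric.sphere_subset_closedBall hz))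
    exact ((hd x).mono ((closure_minimal Metric.ball_subset_closedBall
      Metric.isClosed_closedBall).trans (hsub w hw))).diffContOnCl
  · exact .of_forall fun x w hw => hderiv x w (hmemU w hw)

variable {n : ℕ} {r : ℝ}

/-- On each ball of parameters `w` the symbol is bounded by a constant on a fixed compact set and
vanishes off it. The Fredholm series then converges uniformly there, with holomorphic terms. -/
lemma differentiable_ballFredholm (hr : 0 < r) {χ f : EuclideanSpace ℝ (Fin n) → ℝ}
    (hχ : Continuous χ) (hχs : HasCompactSupport χ) (hf : Continuous f)
    (hfs : HasCompactSupport f) :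
    Differentiable ℂ fun w : ℂ =>
      ballFredholm n r fun x => 1 - Complex.exp (-(χ x : ℂ) - w * f x) := by
  obtain ⟨A, hA⟩ := hχs.exists_bound_of_continuous hχ
  obtain ⟨B, hB⟩ := hfs.exists_bound_of_continuous hf
  have hB0 : 0 ≤ B := (norm_nonneg _).trans (hB 0)
  intro w₀
  set R := ‖w₀‖ + 1 with hR
  have hR0 : 0 ≤ R := by positivity
  set K := tsupport χ ∪ tsupport f with hK
  have hKc : IsCompact K := hχs.isCompact.union hfs.isCompact
  set b : EuclideanSpace ℝ (Fin n) → ℝ := K.indicator fun _ => 1 + Real.exp (A + R * B) with hb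
  have hbi : Integrable b := (integrable_indicator_iff hKc.isClosed.measurableSet).2
    (integrableOn_const hKc.measure_lt_top.ne)
  have hub : ∀ w ∈ Metric.ball (0 : ℂ) R, ∀ x,
      ‖1 - Complex.exp (-(χ x : ℂ) - w * f x)‖ ≤ b x := by
    intro w hw x
    by_cases hx : x ∈ K
    · rw [hb, Set.indicator_of_mem hx]
      refine (norm_sub_le _ _).trans ?_
      rw [norm_one, Complex.norm_exp]
      gcongr
      have h1 : (-(χ x : ℂ) - w * f x).re ≤ ‖(χ x : ℂ)‖ + ‖w‖ * ‖(f x : ℂ)‖ := by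
        refine (Complex.re_le_norm _).trans ((norm_sub_le _ _).trans ?_)
        rw [norm_neg, norm_mul]
      rw [Complex.norm_real, Complex.norm_real] at h1
      refine h1.trans ?_
      rw [mem_ball_zero_iff] at hw
      gcongr
      exacts [hA x, hB x]
    · have h1 : χ x = 0 := image_eq_zero_of_notMem_tsupport fun h => hx (Or.inl h)
      have h2 : f x = 0 := image_eq_zero_of_notMem_tsupport fun h => hx (Or.inr h)
      rw [hb, Set.indicator_of_notMem hx]
      simp [h1, h2]
  have hdiff : DifferentiableOn ℂ (fun w : ℂ =>
      ballFredholm n r fun x => 1 - Complex.exp (-(χ x : ℂ) - w * f x)) (Metric.ball 0 R) := by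
    refine Complex.differentiableOn_tsum_of_summable_norm
      (u := fun k : ℕ => ((∫ x, b x) * ballVol n r) ^ k / k.factorial)
      (Real.summable_pow_div_factorial _) (fun k => ?_) Metric.isOpen_ball
      (fun k w hw => norm_fredholm_term_le hr k (hub w hw) hbi fun z => z)
    refine DifferentiableOn.const_mul ?_ _
    refine differentiableOn_integral_of_norm_le Metric.isOpen_ball (fun w _ => ?_) (fun z => ?_)
      (integrable_fredholm_bound (r := r) hbi k)
      (.of_forall fun z w hw => norm_fredholm_integrand_le hr (hub w hw) z z)
    · have := continuous_det_ballKernel (n := n) (r := r) k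
      exact Continuous.aestronglyMeasurable (by fun_prop)
    · refine Differentiable.differentiableOn ?_
      fun_prop
  exact (hdiff w₀ (by rw [mem_ball_zero_iff]; linarith)).differentiableAt
    (Metric.isOpen_ball.mem_nhds (by rw [mem_ball_zero_iff]; linarith))

end HolomorphicIntegral

/-! ### From the Laplace functional to characteristic functions -/

section LinearStatistics
open scoped Topology
variable {n : ℕ} {r : ℝ} {Ω : Type*} [MeasurableSpace Ω] {P : Measure Ω}
  {Ξ : Ω → Measure (EuclideanSpace ℝ (Fin n))}

lemma IsPointProcess.ae_isCompact_lt_top (h : IsPointProcess P Ξ) :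
    ∀ᵐ ω ∂P, ∀ C, IsCompact C → Ξ ω C < ⊤ := by
  filter_upwards [h.simple] with ω ⟨Λ, hΛ, hω⟩ C hC
  rw [hω, Measure.sum_apply _ hC.isClosed.measurableSet]
  have hfin : Set.Finite {x : Λ | x.1 ∈ C} :=
    ((hΛ C hC).preimage Subtype.val_injective.injOn).subset fun x hx => ⟨x.2, hx⟩
  rw [tsum_eq_sum (s := hfin.toFinset)]
  · refine ENNReal.sum_lt_top.2 fun x _ => ?_
    exact measure_lt_top _ _
  · intro x hx
    rw [Measure.dirac_apply' _ hC.isClosed.measurableSet, Set.indicator_of_notMem]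
    simpa using hx

lemma integrable_of_isCompact_lt_top {ν : Measure (EuclideanSpace ℝ (Fin n))}
    (hν : ∀ C, IsCompact C → ν C < ⊤) {f : EuclideanSpace ℝ (Fin n) → ℝ} (hf : Continuous f)
    (hfs : HasCompactSupport f) : Integrable f ν := by
  have : IsFiniteMeasureOnCompacts ν := ⟨fun {C} hC => hν C hC⟩
  exact hf.integrable_of_hasCompactSupport hfs

/-- Lower integrals depend measurably on the measure. Where `f` is integrable, its integral is the
difference of those of the positive and negative parts. -/
lemma aemeasurable_integral_of_ae_integrable (hΞ : Measurable Ξ)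
    {f : EuclideanSpace ℝ (Fin n) → ℝ} (hf : Measurable f) (hi : ∀ᵐ ω ∂P, Integrable f (Ξ ω)) :
    AEMeasurable (fun ω => ∫ x, f x ∂(Ξ ω)) P := by
  refine ⟨fun ω => (∫⁻ x, ENNReal.ofReal (f x) ∂(Ξ ω)).toReal
    - (∫⁻ x, ENNReal.ofReal (-f x) ∂(Ξ ω)).toReal, ?_, ?_⟩
  · have h1 : Measurable fun ω => ∫⁻ x, ENNReal.ofReal (f x) ∂(Ξ ω) :=
      (Measure.measurable_lintegral (by fun_prop)).comp hΞ
    have h2 : Measurable fun ω => ∫⁻ x, ENNReal.ofReal (-f x) ∂(Ξ ω) :=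
      (Measure.measurable_lintegral (by fun_prop)).comp hΞ
    exact h1.ennreal_toReal.sub h2.ennreal_toReal
  · filter_upwards [hi] with ω hω
    exact integral_eq_lintegral_pos_part_sub_lintegral_neg_part hω

/-- The process `Ξ` has the Laplace functional of the determinantal process with kernel
`ballKernel n r (x - y)`. -/
structure HasBallLaplace (P : Measure Ω) (Ξ : Ω → Measure (EuclideanSpace ℝ (Fin n)))
    (r : ℝ) : Prop where
  points : IsPointProcess P Ξ
  laplace : ∀ f : EuclideanSpace ℝ (Fin n) → ℝ, ContDiff ℝ ((⊤ : ℕ∞) : WithTop ℕ∞) f →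
    HasCompactSupport f → (∀ x, 0 ≤ f x) →
      ((∫ ω, Real.exp (-∫ x, f x ∂(Ξ ω)) ∂P : ℝ) : ℂ)
        = ballFredholm n r fun x => 1 - Complex.exp (-(f x : ℂ))

lemma HasBallLaplace.integrable (h : HasBallLaplace P Ξ r)
    {f : EuclideanSpace ℝ (Fin n) → ℝ} (hf : Continuous f) (hfs : HasCompactSupport f) :
    ∀ᵐ ω ∂P, Integrable f (Ξ ω) := by
  filter_upwards [h.points.ae_isCompact_lt_top] with ω hω
  exact integrable_of_isCompact_lt_top hω hf hfs

lemma HasBallLaplace.aemeasurable (h : HasBallLaplace P Ξ r)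
    {f : EuclideanSpace ℝ (Fin n) → ℝ} (hf : Continuous f) (hfs : HasCompactSupport f) :
    AEMeasurable (fun ω => ∫ x, f x ∂(Ξ ω)) P :=
  aemeasurable_integral_of_ae_integrable h.points.measurable hf.measurable
    (h.integrable hf hfs)

variable [IsProbabilityMeasure P]

/-- The regularised characteristic function of a linear statistic. -/
lemma HasBallLaplace.integral_cexp_regularised (h : HasBallLaplace P Ξ r) (hr : 0 < r)
    {f χ : EuclideanSpace ℝ (Fin n) → ℝ} (hf : ContDiff ℝ ((⊤ : ℕ∞) : WithTop ℕ∞) f)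
    (hfs : HasCompactSupport f)
    (hχ : ContDiff ℝ ((⊤ : ℕ∞) : WithTop ℕ∞) χ) (hχs : HasCompactSupport χ) (hχ0 : ∀ x, 0 ≤ χ x)
    {c : ℝ}
    (hfχ : ∀ x, |f x| ≤ c * χ x) {M : ℝ} (hM : 0 < M) (t : ℝ) :
    ∫ ω, Complex.exp (-(M * ∫ x, χ x ∂(Ξ ω) : ℝ) + Complex.I * t * (∫ x, f x ∂(Ξ ω) : ℝ)) ∂P
      = ballFredholm n r fun x => 1 - Complex.exp (-(M * χ x : ℝ) + Complex.I * t * f x) := by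
  -- In this strip `M X(χ)` dominates `|Re w| |X(f)|`, so the exponential has modulus at most `1`.
  -- For real `w` in it, `Mχ + wf ≥ 0` is an admissible test function.
  set U : Set ℂ := {w | |w.re| * c < M} with hU
  have hUo : IsOpen U := isOpen_lt (by fun_prop) continuous_const
  have hUc : Convex ℝ U := by
    intro w hw z hz a b ha hb hab
    simp only [hU, Set.mem_ofPred_eq] at hw hz ⊢
    rcases le_or_gt c 0 with hc | hc
    · exact lt_of_le_of_lt (mul_nonpos_of_nonneg_of_nonpos (abs_nonneg _) hc) hM
    · rw [← lt_div_iff₀ hc] at hw hz ⊢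
      have h1 : |(a • w + b • z).re| ≤ a * |w.re| + b * |z.re| := by
        simp only [Complex.add_re, Complex.real_smul, Complex.mul_re, Complex.ofReal_re,
          Complex.ofReal_im, zero_mul, sub_zero]
        refine (abs_add_le _ _).trans ?_
        rw [abs_mul, abs_mul, abs_of_nonneg ha, abs_of_nonneg hb]
      refine lt_of_le_of_lt h1 ?_
      rcases ha.eq_or_lt with rfl | ha'
      · have : b = 1 := by linarith
        subst this; simpa using hz
      · have h2 : a * |w.re| < a * (M / c) := by gcongr
        have h3 : b * |z.re| ≤ b * (M / c) := by gcongr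
        have h4 : a * (M / c) + b * (M / c) = M / c := by rw [← add_mul, hab, one_mul]
        linarith
  have hXχ := h.aemeasurable hχ.continuous hχs
  have hXf := h.aemeasurable hf.continuous hfs
  have hdom : ∀ᵐ ω ∂P, |∫ x, f x ∂(Ξ ω)| ≤ c * ∫ x, χ x ∂(Ξ ω) := by
    filter_upwards [h.integrable hf.continuous hfs, h.integrable hχ.continuous hχs] with ω h1 h2
    rw [← integral_const_mul]
    exact norm_integral_le_of_norm_le (f := f) (h2.const_mul c) (.of_forall hfχ)
  have hχnn : ∀ ω, 0 ≤ ∫ x, χ x ∂(Ξ ω) := fun ω => integral_nonneg hχ0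
  have hL : DifferentiableOn ℂ (fun w : ℂ => ∫ ω, Complex.exp (-(M * ∫ x, χ x ∂(Ξ ω) : ℝ)
      - w * (∫ x, f x ∂(Ξ ω) : ℝ)) ∂P) U := by
    refine differentiableOn_integral_of_norm_le hUo (fun w _ => ?_) (fun ω => ?_)
      (b := fun _ => 1) (integrable_const _) ?_
    · exact AEMeasurable.aestronglyMeasurable (by fun_prop)
    · exact Differentiable.differentiableOn (by fun_prop)
    · filter_upwards [hdom] with ω hω w hw
      rw [Complex.norm_exp, Real.exp_le_one_iff]
      simp only [Complex.sub_re, Complex.neg_re, Complex.ofReal_re, Complex.mul_re,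
        Complex.ofReal_im, mul_zero, sub_zero]
      have h1 : -(w.re * ∫ x, f x ∂(Ξ ω)) ≤ |w.re| * (c * ∫ x, χ x ∂(Ξ ω)) := by
        refine (neg_le_abs _).trans ?_
        rw [abs_mul]
        gcongr
      have h2 : |w.re| * (c * ∫ x, χ x ∂(Ξ ω)) ≤ M * ∫ x, χ x ∂(Ξ ω) := by
        rw [← mul_assoc]
        exact mul_le_mul_of_nonneg_right (le_of_lt hw) (hχnn ω)
      linarith
  have hR : DifferentiableOn ℂ (fun w : ℂ => ballFredholm n r fun x =>
      1 - Complex.exp (-((M * χ x : ℝ) : ℂ) - w * f x)) U :=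
    (differentiable_ballFredholm hr (χ := fun x => M * χ x) (by have := hχ.continuous; fun_prop)
      hχs.mul_left hf.continuous hfs).differentiableOn
  have h0 : (0 : ℂ) ∈ U := by simpa [hU] using hM
  have hreal : ∀ w : ℝ, (w : ℂ) ∈ U →
      ∫ ω, Complex.exp (-(M * ∫ x, χ x ∂(Ξ ω) : ℝ) - (w : ℂ) * (∫ x, f x ∂(Ξ ω) : ℝ)) ∂P
      = ballFredholm n r fun x => 1 - Complex.exp (-((M * χ x : ℝ) : ℂ) - (w : ℂ) * f x) := by
    intro w hw
    have hw' : |w| * c < M := by simpa [hU] using hw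
    have hsm : ContDiff ℝ ((⊤ : ℕ∞) : WithTop ℕ∞) fun x => M * χ x + w * f x := by fun_prop
    have hcs : HasCompactSupport fun x => M * χ x + w * f x := hχs.mul_left.add hfs.mul_left
    have hnn : ∀ x, 0 ≤ M * χ x + w * f x := fun x => by
      have h1 : -(w * f x) ≤ |w| * (c * χ x) := by
        refine (neg_le_abs _).trans ?_
        rw [abs_mul]
        gcongr
        exact hfχ x
      have h2 : |w| * (c * χ x) ≤ M * χ x := by
        rw [← mul_assoc]
        exact mul_le_mul_of_nonneg_right hw'.le (hχ0 x)
      linarith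
    have h3 := h.laplace _ hsm hcs hnn
    rw [← integral_complex_ofReal] at h3
    convert h3 using 1
    · refine integral_congr_ae ?_
      filter_upwards [h.integrable hf.continuous hfs, h.integrable hχ.continuous hχs] with ω h1 h2
      rw [integral_add (h2.const_mul M) (h1.const_mul w), integral_const_mul, integral_const_mul]
      push_cast
      congr 1; ring
    · congr 1; funext x
      push_cast
      congr 2; ring
  -- Both sides are holomorphic in the strip and agree at its real points. These accumulate at `0`,
  -- so the identity theorem gives equality up to the imaginary axis.
  have hfreq : ∃ᶠ w in 𝓝[≠] (0 : ℂ),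
      ∫ ω, Complex.exp (-(M * ∫ x, χ x ∂(Ξ ω) : ℝ) - w * (∫ x, f x ∂(Ξ ω) : ℝ)) ∂P
      = ballFredholm n r fun x => 1 - Complex.exp (-((M * χ x : ℝ) : ℂ) - w * f x) := by
    have ht : Tendsto (fun w : ℝ => (w : ℂ)) (𝓝[≠] 0) (𝓝[≠] 0) := by
      refine tendsto_nhdsWithin_iff.2 ⟨?_, ?_⟩
      · exact (Complex.continuous_ofReal.tendsto 0).mono_left nhdsWithin_le_nhds
      · filter_upwards [self_mem_nhdsWithin] with w hw
        simpa using hw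
    refine ht.frequently (Eventually.frequently ?_)
    have : ∀ᶠ w : ℝ in 𝓝[≠] (0 : ℝ), (w : ℂ) ∈ U :=
      (ht.mono_right nhdsWithin_le_nhds).eventually (hUo.mem_nhds h0)
    filter_upwards [this] with w hw using hreal w hw
  have heq := (hL.analyticOnNhd hUo).eqOn_of_preconnected_of_frequently_eq
    (hR.analyticOnNhd hUo) hUc.isPreconnected h0 hfreq
  have hmem : -(Complex.I * t) ∈ U := by simpa [hU] using hM
  have := heq hmem
  simpa [sub_neg_eq_add] using this

/-- The characteristic function of a linear statistic is a Fredholm determinant. -/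
theorem HasBallLaplace.integral_cexp (h : HasBallLaplace P Ξ r) (hr : 0 < r)
    {f : EuclideanSpace ℝ (Fin n) → ℝ} (hf : ContDiff ℝ ((⊤ : ℕ∞) : WithTop ℕ∞) f)
    (hfs : HasCompactSupport f) (t : ℝ) :
    ∫ ω, Complex.exp (Complex.I * t * (∫ x, f x ∂(Ξ ω) : ℝ)) ∂P
      = ballFredholm n r fun x => 1 - Complex.exp (Complex.I * t * f x) := by
  obtain ⟨B, hB⟩ := hfs.exists_bound_of_continuous hf.continuous
  obtain ⟨R, hR⟩ := hfs.isCompact.isBounded.subset_closedBall (0 : EuclideanSpace ℝ (Fin n))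
  -- The bump equals `1` on the support of `f`, so `|f| ≤ Bχ`. The regularising factor `e^{-M X(χ)}`
  -- is removed by letting `M → 0`.
  let χ : ContDiffBump (0 : EuclideanSpace ℝ (Fin n)) := ⟨max R 1, max R 1 + 1, by positivity,
    by linarith⟩
  have hχ : ContDiff ℝ ((⊤ : ℕ∞) : WithTop ℕ∞) χ := χ.contDiff
  have hχs : HasCompactSupport χ := χ.hasCompactSupport
  have hB0 : 0 ≤ B := (norm_nonneg _).trans (hB 0)
  have hfχ : ∀ x, |f x| ≤ B * χ x := fun x => by
    by_cases hx : f x = 0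
    · rw [hx, abs_zero]; exact mul_nonneg hB0 χ.nonneg
    · rw [χ.one_of_mem_closedBall (Metric.closedBall_subset_closedBall (le_max_left _ _)
        (hR (subset_tsupport f hx))), mul_one]
      exact hB x
  have hXχ := h.aemeasurable hχ.continuous hχs
  have hXf := h.aemeasurable hf.continuous hfs
  have hχnn : ∀ ω, 0 ≤ ∫ x, χ x ∂(Ξ ω) := fun ω => integral_nonneg fun x => χ.nonneg
  have h1 : Tendsto (fun M : ℝ => ∫ ω, Complex.exp (-(M * ∫ x, χ x ∂(Ξ ω) : ℝ)
      + Complex.I * t * (∫ x, f x ∂(Ξ ω) : ℝ)) ∂P) (𝓝[>] 0)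
      (𝓝 (∫ ω, Complex.exp (Complex.I * t * (∫ x, f x ∂(Ξ ω) : ℝ)) ∂P)) := by
    refine tendsto_integral_filter_of_dominated_convergence (fun _ => 1) ?_ ?_
      (integrable_const _) ?_
    · exact .of_forall fun M => AEMeasurable.aestronglyMeasurable (by fun_prop)
    · filter_upwards [self_mem_nhdsWithin] with M (hM : 0 < M)
      refine .of_forall fun ω => ?_
      rw [Complex.norm_exp, Real.exp_le_one_iff]
      have : 0 ≤ M * ∫ x, χ x ∂(Ξ ω) := mul_nonneg hM.le (hχnn ω)
      simpa using this
    · refine .of_forall fun ω => ?_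
      have : Continuous fun M : ℝ => Complex.exp (-(M * ∫ x, χ x ∂(Ξ ω) : ℝ)
        + Complex.I * t * (∫ x, f x ∂(Ξ ω) : ℝ)) := by fun_prop
      have := (this.tendsto 0).mono_left (nhdsWithin_le_nhds (s := Set.Ioi 0))
      simpa using this
  have h2 : Tendsto (fun M : ℝ => ballFredholm n r fun x =>
      1 - Complex.exp (-(M * χ x : ℝ) + Complex.I * t * f x)) (𝓝[>] 0)
      (𝓝 (ballFredholm n r fun x => 1 - Complex.exp (Complex.I * t * f x))) := by
    have hKc := hχs.isCompact
    refine tendsto_ballFredholm hr (fun M => ?_)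
      (b := (tsupport χ).indicator fun _ => 2)
      ((integrable_indicator_iff hKc.isClosed.measurableSet).2
        (integrableOn_const hKc.measure_lt_top.ne)) ?_ fun x => ?_
    · have := hf.continuous
      have := hχ.continuous
      exact Continuous.measurable (by fun_prop)
    · filter_upwards [self_mem_nhdsWithin] with M (hM : 0 < M) x
      by_cases hx : x ∈ tsupport χ
      · rw [Set.indicator_of_mem hx]
        refine (norm_sub_le _ _).trans ?_
        rw [norm_one, Complex.norm_exp]
        have h3 : 0 ≤ M * χ x := mul_nonneg hM.le χ.nonneg
        have : Real.exp (-((M * χ x : ℝ) : ℂ) + Complex.I * t * f x).re ≤ 1 := by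
          rw [Real.exp_le_one_iff]; simpa using h3
        linarith
      · have h3 : χ x = 0 := image_eq_zero_of_notMem_tsupport hx
        have h4 : f x = 0 := by
          have := hfχ x
          rw [h3, mul_zero] at this
          exact abs_nonpos_iff.1 this
        rw [Set.indicator_of_notMem hx]
        simp [h3, h4]
    · have : Continuous fun M : ℝ => 1 - Complex.exp (-(M * χ x : ℝ) + Complex.I * t * f x) := by
        fun_prop
      have := (this.tendsto 0).mono_left (nhdsWithin_le_nhds (s := Set.Ioi 0))
      simpa using this
  refine tendsto_nhds_unique h1 (h2.congr' ?_)
  filter_upwards [self_mem_nhdsWithin] with M (hM : 0 < M)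
  exact (h.integral_cexp_regularised hr hf hfs hχ hχs (fun x => χ.nonneg) hfχ hM t).symm

end LinearStatistics

/-! ### The kernel of the spectral projector -/

section KernelIdentification
open scoped FourierTransform SchwartzMap ComplexConjugate InnerProductSpace
variable {n : ℕ}

lemma frequencyBall_eq_closedBall {μ : ℝ} (hμ : 0 < μ) :
    frequencyBall n μ = Metric.closedBall 0 (μ / (2 * Real.pi)) := by
  ext ξ
  rw [frequencyBall, Set.mem_ofPred_eq, mem_closedBall_zero_iff, le_div_iff₀ (by positivity),
    sq_le_sq₀ (by positivity) hμ.le, mul_comm]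

lemma frequencyCutoff_coeFn (μ : ℝ) (φ : L2Space n) :
    frequencyCutoff n μ φ =ᵐ[volume] (frequencyBall n μ).indicator φ := by
  have h1 : (ContinuousLinearMap.lsmul ℂ ℂ).holder 2
      (((memLp_top_const (1 : ℂ)).indicator (measurableSet_frequencyBall n μ)).toLp
        ((frequencyBall n μ).indicator fun _ => (1 : ℂ))) φ =ᵐ[volume] _ :=
    ContinuousLinearMap.coeFn_holder _ _ _
  have h2 := ((memLp_top_const (μ := (volume : Measure (EuclideanSpace ℝ (Fin n))))
    (1 : ℂ)).indicator (measurableSet_frequencyBall n μ)).coeFn_toLp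
  refine EventuallyEq.trans (h1 : frequencyCutoff n μ φ =ᵐ[volume] _) ?_
  filter_upwards [h2] with x hx
  rw [hx]
  by_cases hxs : x ∈ frequencyBall n μ
  · simp [Set.indicator_of_mem hxs]
  · simp [Set.indicator_of_notMem hxs]

/-- The inverse transform in the projector is moved to the other argument by unitarity. What remains
is the cutoff between two Fourier transforms. -/
lemma inner_freeLaplacianProjector (μ : ℝ) (φ ψ : 𝓢(EuclideanSpace ℝ (Fin n), ℂ)) :
    inner ℂ (ψ.toLp 2 volume) (freeLaplacianProjector n μ (φ.toLp 2 volume))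
      = ∫ ξ in frequencyBall n μ, conj (𝓕 ψ ξ) * 𝓕 φ ξ := by
  have h1 : inner ℂ (ψ.toLp 2 volume) (freeLaplacianProjector n μ (φ.toLp 2 volume))
      = inner ℂ ((𝓕 ψ).toLp 2 volume) (frequencyCutoff n μ ((𝓕 φ).toLp 2 volume)) := by
    rw [← SchwartzMap.toLp_fourier_eq, ← SchwartzMap.toLp_fourier_eq]
    rw [← Lp.inner_fourier_eq]
    congr 1
    exact (Lp.fourierTransformₗᵢ (EuclideanSpace ℝ (Fin n)) ℂ).apply_symm_apply _
  rw [h1, L2.inner_def, ← integral_indicator (measurableSet_frequencyBall n μ)]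
  refine integral_congr_ae ?_
  filter_upwards [frequencyCutoff_coeFn μ ((𝓕 φ).toLp 2 volume), (𝓕 ψ).coeFn_toLp 2 volume,
    (𝓕 φ).coeFn_toLp 2] with ξ h1 h2 h3
  rw [h1, h2]
  by_cases hxs : ξ ∈ frequencyBall n μ
  · rw [Set.indicator_of_mem hxs, Set.indicator_of_mem hxs, h3, RCLike.inner_apply, mul_comm]
  · rw [Set.indicator_of_notMem hxs, Set.indicator_of_notMem hxs, inner_zero_right]

lemma ballKernel_neg (r : ℝ) (z : EuclideanSpace ℝ (Fin n)) :
    ballKernel n r (-z) = ballKernel n r z := by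
  unfold ballKernel
  rw [← (Measure.measurePreserving_neg volume).setIntegral_preimage_emb
    (MeasurableEquiv.neg _).measurableEmbedding]
  simp

lemma setIntegral_conj_fourier_mul_fourier (r : ℝ) (φ ψ : 𝓢(EuclideanSpace ℝ (Fin n), ℂ)) :
    ∫ ξ in Metric.closedBall 0 r, conj (𝓕 ψ ξ) * 𝓕 φ ξ
      = ∫ x, ∫ y, conj (ψ x) * φ y * ballKernel n r (x - y) := by
  have := isFiniteMeasure_restrict_closedBall (0 : EuclideanSpace ℝ (Fin n)) r
  have hψφ : Integrable (fun z : EuclideanSpace ℝ (Fin n) × EuclideanSpace ℝ (Fin n) =>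
      conj (ψ z.1) * φ z.2) (volume.prod volume) :=
    Integrable.mul_prod (f := fun x => conj (ψ x)) (g := φ)
      ((Complex.conjLIE.toContinuousLinearEquiv : ℂ →L[ℝ] ℂ).integrable_comp ψ.integrable)
      φ.integrable
  have h1 : ∀ ξ, conj (𝓕 ψ ξ) * 𝓕 φ ξ = ∫ z : EuclideanSpace ℝ (Fin n) × EuclideanSpace ℝ (Fin n),
      conj (ψ z.1) * φ z.2 * Complex.exp (((-2 * Real.pi * inner ℝ ξ (z.2 - z.1) : ℝ) : ℂ)
        * Complex.I) ∂(volume.prod volume) := by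
    intro ξ
    rw [SchwartzMap.fourier_coe, SchwartzMap.fourier_coe, Real.fourier_eq', Real.fourier_eq',
      ← integral_conj, ← integral_prod_mul]
    refine integral_congr_ae (.of_forall fun z => ?_)
    simp only [smul_eq_mul, map_mul, ← Complex.exp_conj, Complex.conj_I, Complex.conj_ofReal,
      inner_sub_right]
    rw [mul_mul_mul_comm, ← Complex.exp_add, mul_comm]
    congr 2
    rw [real_inner_comm, real_inner_comm ξ z.2]
    push_cast; ring
  simp only [h1]
  rw [integral_integral_swap]
  · rw [← integral_prod (f := fun z : EuclideanSpace ℝ (Fin n) × EuclideanSpace ℝ (Fin n) =>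
      conj (ψ z.1) * φ z.2 * ballKernel n r (z.1 - z.2))]
    · refine integral_congr_ae (.of_forall fun z => ?_)
      simp only
      rw [integral_const_mul, ← neg_sub z.2 z.1, ballKernel_neg]
      rfl
    · have hk := continuous_ballKernel (n := n) (r := r)
      refine hψφ.mul_bdd (c := ballVol n r) (Continuous.aestronglyMeasurable (by fun_prop))
        (.of_forall fun z => norm_ballKernel_le _)
  · have h2 : Integrable (fun p : EuclideanSpace ℝ (Fin n) ×
        EuclideanSpace ℝ (Fin n) × EuclideanSpace ℝ (Fin n) => conj (ψ p.2.1) * φ p.2.2)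
        ((volume.restrict (Metric.closedBall 0 r)).prod (volume.prod volume)) :=
      hψφ.comp_snd _
    refine h2.mul_bdd (c := 1) (Continuous.aestronglyMeasurable (by fun_prop))
      (.of_forall fun z => ?_)
    rw [Complex.norm_exp_ofReal_mul_I]

/-- The definition determines `K` only almost everywhere. Testing first in `x` against `g`, with
`f(y)` fixed, and then in `y` gives almost everywhere equalities between continuous functions, which
hold everywhere. -/
lemma eq_ballKernel_of_isIntegralKernel {μ : ℝ} (hμ : 0 < μ)
    {K : EuclideanSpace ℝ (Fin n) → EuclideanSpace ℝ (Fin n) → ℂ}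
    (hK : Continuous (Function.uncurry K)) (hT : IsIntegralKernel K (freeLaplacianProjector n μ))
    (x y : EuclideanSpace ℝ (Fin n)) :
    K x y = ballKernel n (μ / (2 * Real.pi)) (x - y) := by
  set r := μ / (2 * Real.pi) with hr
  have hk := continuous_ballKernel (n := n) (r := r)
  have hk2 : Continuous (Function.uncurry fun x y : EuclideanSpace ℝ (Fin n) =>
    ballKernel n r (x - y)) := by
    simp only [Function.uncurry_def]; fun_prop
  -- the partial integrals against a test function are continuous
  have hcont : ∀ (L : EuclideanSpace ℝ (Fin n) → EuclideanSpace ℝ (Fin n) → ℂ),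
      Continuous (Function.uncurry L) → ∀ f : EuclideanSpace ℝ (Fin n) → ℝ, Continuous f →
      HasCompactSupport f → Continuous fun x => ∫ y, L x y * (f y : ℂ) := by
    intro L hL f hf hfs
    have h1 : Continuous (Function.uncurry fun x y => L x y * (f y : ℂ)) :=
      hL.mul (Complex.continuous_ofReal.comp (hf.comp continuous_snd))
    have h2 := continuous_parametric_integral_of_continuous (μ := volume) h1 hfs.isCompact
    refine h2.congr fun x => ?_
    refine setIntegral_eq_integral_of_forall_compl_eq_zero fun y hy => ?_
    rw [image_eq_zero_of_notMem_tsupport hy]; simp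
  have key : ∀ f : EuclideanSpace ℝ (Fin n) → ℝ, ContDiff ℝ ((⊤ : ℕ∞) : WithTop ℕ∞) f →
      HasCompactSupport f →
      (fun x => ∫ y, K x y * (f y : ℂ)) = fun x => ∫ y, ballKernel n r (x - y) * (f y : ℂ) := by
    intro f hf hfs
    refine (Continuous.ae_eq_iff_eq volume (hcont K hK f hf.continuous hfs)
      (hcont _ hk2 f hf.continuous hfs)).1 ?_
    refine ae_eq_of_integral_contDiff_smul_eq (hcont K hK f hf.continuous hfs).locallyIntegrable
      (hcont _ hk2 f hf.continuous hfs).locallyIntegrable fun g hg hgs => ?_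
    have hof : ContDiff ℝ ((⊤ : ℕ∞) : WithTop ℕ∞) fun x : ℝ => (x : ℂ) :=
      Complex.ofRealCLM.contDiff
    set φ : 𝓢(EuclideanSpace ℝ (Fin n), ℂ) :=
      HasCompactSupport.toSchwartzMap (f := fun x => (f x : ℂ))
        (hfs.comp_left (g := fun x : ℝ => (x : ℂ)) rfl) (hof.comp hf) with hφ
    set ψ : 𝓢(EuclideanSpace ℝ (Fin n), ℂ) :=
      HasCompactSupport.toSchwartzMap (f := fun x => (g x : ℂ))
        (hgs.comp_left (g := fun x : ℝ => (x : ℂ)) rfl) (hof.comp hg) with hψ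
    have h1 := inner_freeLaplacianProjector μ φ ψ
    rw [frequencyBall_eq_closedBall hμ, setIntegral_conj_fourier_mul_fourier, L2.inner_def] at h1
    have hφx : ∀ x, φ x = (f x : ℂ) := fun x => rfl
    have hψx : ∀ x, ψ x = (g x : ℂ) := fun x => rfl
    have h2 : ∫ x, g x • ∫ y, ballKernel n r (x - y) * (f y : ℂ)
        = ∫ x, ∫ y, conj (ψ x) * φ y * ballKernel n r (x - y) := by
      refine integral_congr_ae (.of_forall fun x => ?_)
      simp only
      rw [← integral_smul]
      refine integral_congr_ae (.of_forall fun y => ?_)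
      simp only [hφx, hψx, Complex.conj_ofReal, Complex.real_smul]
      ring
    rw [h2, ← h1]
    refine integral_congr_ae ?_
    filter_upwards [hT (φ.toLp 2 volume), ψ.coeFn_toLp 2] with x hx1 hx2
    rw [hx1, hx2, RCLike.inner_apply, hψx, Complex.conj_ofReal, Complex.real_smul, mul_comm]
    congr 1
    refine integral_congr_ae ?_
    filter_upwards [φ.coeFn_toLp 2] with y hy
    rw [hy, hφx]
  have hKx : Continuous (K x) := hK.comp (Continuous.prodMk_right x)
  have hkx : Continuous fun y => ballKernel n r (x - y) := by fun_prop
  have := (Continuous.ae_eq_iff_eq volume hKx hkx).1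
    (ae_eq_of_integral_contDiff_smul_eq hKx.locallyIntegrable hkx.locallyIntegrable
    fun f hf hfs => by
      have := congrFun (key f hf hfs) x
      simp only [Complex.real_smul]
      simpa only [mul_comm] using this)
  exact congrFun this y

/-- Any admissible continuous kernel is pointwise the ball kernel, so its Fredholm series is
`ballFredholm` term by term. -/
theorem IsDeterminantalProcess.hasBallLaplace {Ω : Type*} [MeasurableSpace Ω] {P : Measure Ω}
    {Ξ : Ω → Measure (EuclideanSpace ℝ (Fin n))} {μ : ℝ} (hμ : 0 < μ)
    (h : IsDeterminantalProcess P Ξ (freeLaplacianProjector n μ)) :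
    HasBallLaplace P Ξ (μ / (2 * Real.pi)) := by
  refine ⟨h.1, fun f hf hfs hf0 => ?_⟩
  obtain ⟨K, hK, hT, hL⟩ := h.laplace
  rw [← (hL f hf hfs hf0).tsum_eq, ballFredholm]
  refine tsum_congr fun k => ?_
  simp only [ballDet, eq_ballKernel_of_isIntegralKernel hμ hK hT]
  push_cast
  rfl

end KernelIdentification

/-! ### Moments from the characteristic function near zero -/

section Moments
open scoped Topology
variable {Ω : Type*} [MeasurableSpace Ω] {P : Measure Ω} [IsProbabilityMeasure P]

/-- A quadratic bound is chosen over the cubic one because only a second moment is available when it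
is integrated. -/
lemma Real.abs_sin_sub_self_le (x : ℝ) : |Real.sin x - x| ≤ 2 * x ^ 2 := by
  rcases le_or_gt |x| 1 with hx | hx
  · have h1 := Real.sin_bound hx
    have h2 : |Real.sin x - x| ≤ |Real.sin x - (x - x ^ 3 / 6)| + |x| ^ 3 / 6 := by
      have : Real.sin x - x = (Real.sin x - (x - x ^ 3 / 6)) + -(x ^ 3 / 6) := by ring
      rw [this]
      refine (abs_add_le _ _).trans (le_of_eq ?_)
      rw [abs_neg, abs_div, abs_pow, abs_of_pos (by norm_num : (0 : ℝ) < 6)]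
    have h0 := abs_nonneg x
    have h3 : |x| ^ 3 ≤ |x| ^ 2 := pow_le_pow_of_le_one h0 hx (by norm_num)
    have h4 : |x| ^ 5 ≤ |x| ^ 2 := pow_le_pow_of_le_one h0 hx (by norm_num)
    rw [← sq_abs x]
    nlinarith [sq_nonneg |x|]
  · have h1 : |Real.sin x - x| ≤ 1 + |x| :=
      (abs_sub _ _).trans (add_le_add (Real.abs_sin_le_one x) le_rfl)
    rw [← sq_abs x]
    nlinarith

/-- A third order bound on the characteristic function at `0` controls two moments. -/
lemma moments_of_norm_charFun_sub_le {Y : Ω → ℝ} (hY : AEMeasurable Y P) {V C δ : ℝ} (hδ : 0 < δ)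
    (h : ∀ t : ℝ, 0 < t → t ≤ δ →
      ‖∫ ω, Complex.exp (Complex.I * t * Y ω) ∂P - Real.exp (-(t ^ 2 * V / 2))‖ ≤ C * t ^ 3) :
    ∫⁻ ω, ENNReal.ofReal (Y ω ^ 2) ∂P ≤ ENNReal.ofReal V ∧ ∫ ω, Y ω ∂P = 0 := by
  have hexpi : ∀ t : ℝ, Integrable (fun ω => Complex.exp (Complex.I * t * Y ω)) P := fun t => by
    refine Integrable.of_bound (C := 1) (AEMeasurable.aestronglyMeasurable (by fun_prop))
      (.of_forall fun ω => ?_)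
    rw [show Complex.I * t * Y ω = ((t * Y ω : ℝ) : ℂ) * Complex.I by push_cast; ring,
      Complex.norm_exp_ofReal_mul_I]
  have hexp : ∀ (t : ℝ) ω, Complex.exp (Complex.I * t * Y ω)
      = (Real.cos (t * Y ω) : ℂ) + (Real.sin (t * Y ω) : ℂ) * Complex.I := fun t ω => by
    rw [show Complex.I * t * Y ω = ((t * Y ω : ℝ) : ℂ) * Complex.I by push_cast; ring,
      Complex.exp_mul_I]
    push_cast; rfl
  have hre : ∀ t : ℝ, (∫ ω, Complex.exp (Complex.I * t * Y ω) ∂P).re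
      = ∫ ω, Real.cos (t * Y ω) ∂P := fun t => by
    have := integral_re (hexpi t)
    rw [show (∫ ω, Complex.exp (Complex.I * t * Y ω) ∂P).re
      = RCLike.re (∫ ω, Complex.exp (Complex.I * t * Y ω) ∂P) from rfl, ← this]
    refine integral_congr_ae (.of_forall fun ω => ?_)
    simp only [hexp]
    simp [-Complex.ofReal_cos, -Complex.ofReal_sin]
  have him : ∀ t : ℝ, (∫ ω, Complex.exp (Complex.I * t * Y ω) ∂P).im
      = ∫ ω, Real.sin (t * Y ω) ∂P := fun t => by
    have := integral_im (hexpi t)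
    rw [show (∫ ω, Complex.exp (Complex.I * t * Y ω) ∂P).im
      = RCLike.im (∫ ω, Complex.exp (Complex.I * t * Y ω) ∂P) from rfl, ← this]
    refine integral_congr_ae (.of_forall fun ω => ?_)
    simp only [hexp]
    simp [-Complex.ofReal_cos, -Complex.ofReal_sin]
  have hci : ∀ t : ℝ, Integrable (fun ω => Real.cos (t * Y ω)) P := fun t =>
    Integrable.of_bound (C := 1) (AEMeasurable.aestronglyMeasurable (by fun_prop))
      (.of_forall fun ω => Real.abs_cos_le_one _)
  have hsi : ∀ t : ℝ, Integrable (fun ω => Real.sin (t * Y ω)) P := fun t =>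
    Integrable.of_bound (C := 1) (AEMeasurable.aestronglyMeasurable (by fun_prop))
      (.of_forall fun ω => Real.abs_sin_le_one _)
  have h1 : ∫⁻ ω, ENNReal.ofReal (Y ω ^ 2) ∂P ≤ ENNReal.ofReal V := by
    set s : ℕ → ℝ := fun k => δ / (k + 1) with hs
    have hs0 : ∀ k, 0 < s k := fun k => by simp only [hs]; positivity
    have hsδ : ∀ k, s k ≤ δ := fun k => div_le_self hδ.le (by
      linarith [(Nat.cast_nonneg k : (0 : ℝ) ≤ k)])
    have hslim : Tendsto s atTop (𝓝 0) := by
      have := (tendsto_one_div_add_atTop_nhds_zero_nat (𝕜 := ℝ)).const_mul δ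
      simpa [hs, div_eq_mul_inv] using this
    have hpt : ∀ ω, Tendsto (fun k => ENNReal.ofReal (2 * (1 - Real.cos (s k * Y ω)) / s k ^ 2))
        atTop (𝓝 (ENNReal.ofReal (Y ω ^ 2))) := fun ω => by
      refine ENNReal.tendsto_ofReal ?_
      -- By the half-angle formula `2(1 - cos sY)/s²` is the square of the difference quotient of `2
      -- sin(sY/2)` at `0`, hence tends to `Y²`. Fatou's lemma then needs no prior integrability.
      have hd : HasDerivAt (fun t : ℝ => 2 * Real.sin (t * (Y ω / 2))) (Y ω) 0 := by
        have := ((((hasDerivAt_id (0 : ℝ)).mul_const (Y ω / 2))).sin).const_mul 2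
        refine this.congr_deriv ?_
        simp only [id, zero_mul, Real.cos_zero]
        ring
      have h2 := (hasDerivAt_iff_tendsto_slope_zero.1 hd).comp
        (tendsto_nhdsWithin_iff.2 ⟨hslim, .of_forall fun k => (hs0 k).ne'⟩)
      refine (h2.pow 2).congr fun k => ?_
      simp only [Function.comp_apply, zero_add, zero_mul, Real.sin_zero, mul_zero, sub_zero,
        smul_eq_mul]
      have h3 : Real.cos (s k * Y ω) = 1 - 2 * Real.sin (s k * (Y ω / 2)) ^ 2 := by
        rw [← Real.cos_two_mul_eq_one_sub]
        congr 1; ring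
      rw [h3, mul_pow, inv_pow]
      ring
    have hint : ∀ k, ∫⁻ ω, ENNReal.ofReal (2 * (1 - Real.cos (s k * Y ω)) / s k ^ 2) ∂P
        ≤ ENNReal.ofReal (V + 2 * C * s k) := fun k => by
      rw [← ofReal_integral_eq_lintegral_ofReal]
      · refine ENNReal.ofReal_le_ofReal ?_
        rw [integral_div, integral_const_mul, integral_sub (integrable_const _) (hci _),
          integral_const, probReal_univ, smul_eq_mul, one_mul, div_le_iff₀ (pow_pos (hs0 k) 2),
          ← hre]
        have h2 := (Complex.abs_re_le_norm _).trans (h (s k) (hs0 k) (hsδ k))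
        rw [Complex.sub_re, Complex.ofReal_re] at h2
        have h3 := (abs_le.1 h2).1
        have h4 := Real.add_one_le_exp (-(s k ^ 2 * V / 2))
        nlinarith
      · exact (((integrable_const _).sub (hci _)).const_mul _).div_const _
      · refine .of_forall fun ω => ?_
        have := Real.cos_le_one (s k * Y ω)
        have : 0 ≤ 1 - Real.cos (s k * Y ω) := by linarith
        simp only [Pi.zero_apply]
        positivity
    calc ∫⁻ ω, ENNReal.ofReal (Y ω ^ 2) ∂P
        = ∫⁻ ω, liminf (fun k => ENNReal.ofReal (2 * (1 - Real.cos (s k * Y ω)) / s k ^ 2))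
            atTop ∂P := lintegral_congr fun ω => (hpt ω).liminf_eq.symm
      _ ≤ liminf (fun k => ∫⁻ ω, ENNReal.ofReal (2 * (1 - Real.cos (s k * Y ω)) / s k ^ 2) ∂P)
            atTop := lintegral_liminf_le' fun k => by fun_prop
      _ ≤ liminf (fun k => ENNReal.ofReal (V + 2 * C * s k)) atTop :=
          liminf_le_liminf (.of_forall hint)
      _ = ENNReal.ofReal V := by
          refine Tendsto.liminf_eq (ENNReal.tendsto_ofReal ?_)
          have := (hslim.const_mul (2 * C)).const_add V
          simpa using this
  refine ⟨h1, ?_⟩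
  have hsq : Integrable (fun ω => Y ω ^ 2) P := by
    refine (lintegral_ofReal_ne_top_iff_integrable (by fun_prop)
      (.of_forall fun ω => sq_nonneg _)).1 (h1.trans_lt ENNReal.ofReal_lt_top).ne
  have hYi : Integrable Y P := ((memLp_two_iff_integrable_sq hY.aestronglyMeasurable).2
    hsq).integrable one_le_two
  set M := ∫ ω, Y ω ^ 2 ∂P with hM
  -- The Gaussian is real, so the imaginary part `E sin(tY)` is `O(t³)`. It differs from `t E Y` by
  -- `O(t²)`; dividing by `t` forces `E Y = 0`.
  have hbd : ∀ t : ℝ, 0 < t → t ≤ δ → |∫ ω, Y ω ∂P| ≤ C * t ^ 2 + 2 * t * M := fun t ht htδ => by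
    have h2 := (Complex.abs_im_le_norm _).trans (h t ht htδ)
    rw [Complex.sub_im, Complex.ofReal_im, sub_zero, him] at h2
    have h3 : |∫ ω, Real.sin (t * Y ω) ∂P - t * ∫ ω, Y ω ∂P| ≤ 2 * t ^ 2 * M := by
      rw [← integral_const_mul, ← integral_sub (hsi t) (hYi.const_mul t), hM,
        ← integral_const_mul]
      refine norm_integral_le_of_norm_le (f := fun ω => Real.sin (t * Y ω) - t * Y ω)
        (hsq.const_mul _) (.of_forall fun ω => ?_)
      refine (Real.abs_sin_sub_self_le _).trans (le_of_eq ?_)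
      ring
    have h4 : t * |∫ ω, Y ω ∂P| ≤ t * (C * t ^ 2 + 2 * t * M) := by
      rw [← abs_of_pos ht, ← abs_mul, abs_of_pos ht]
      have := abs_sub_abs_le_abs_sub (t * ∫ ω, Y ω ∂P) (∫ ω, Real.sin (t * Y ω) ∂P)
      rw [abs_sub_comm] at this
      nlinarith
    exact le_of_mul_le_mul_left h4 ht
  have hlim : Tendsto (fun t : ℝ => C * t ^ 2 + 2 * t * M) (𝓝[>] 0) (𝓝 0) := by
    have : Continuous fun t : ℝ => C * t ^ 2 + 2 * t * M := by fun_prop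
    simpa using (this.tendsto 0).mono_left (nhdsWithin_le_nhds (s := Set.Ioi 0))
  refine abs_nonpos_iff.1 (ge_of_tendsto hlim ?_)
  filter_upwards [Ioc_mem_nhdsGT hδ] with t ht using hbd t ht.1 ht.2

end Moments

/-! ### Mean, variance bound and intensity measure -/

section Intensity
open scoped Topology
variable {n : ℕ} {r : ℝ} {Ω : Type*} [MeasurableSpace Ω] {P : Measure Ω}
  {Ξ : Ω → Measure (EuclideanSpace ℝ (Fin n))}

/-- The centred linear statistic of `f`. -/
noncomputable def centeredStat (r : ℝ) (Ξ : Ω → Measure (EuclideanSpace ℝ (Fin n)))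
    (f : EuclideanSpace ℝ (Fin n) → ℝ) (ω : Ω) : ℝ :=
  ∫ x, f x ∂(Ξ ω) - ballVol n r * ∫ x, f x

lemma HasBallLaplace.aemeasurable_centeredStat (h : HasBallLaplace P Ξ r)
    {f : EuclideanSpace ℝ (Fin n) → ℝ} (hf : Continuous f) (hfs : HasCompactSupport f) :
    AEMeasurable (centeredStat r Ξ f) P :=
  (h.aemeasurable hf hfs).sub_const _

variable [IsProbabilityMeasure P]

lemma HasBallLaplace.norm_charFun_sub_le_of_hasCompactSupport (h : HasBallLaplace P Ξ r)
    (hr : 0 < r) {f : EuclideanSpace ℝ (Fin n) → ℝ} (hf : ContDiff ℝ ((⊤ : ℕ∞) : WithTop ℕ∞) f)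
    (hfs : HasCompactSupport f) {B t : ℝ} (hB : 0 ≤ B) (hfB : ∀ x, |f x| ≤ B) (ht : 0 ≤ t)
    (hBt : 192 * (B * t) ≤ 1) :
    ‖∫ ω, Complex.exp (Complex.I * t * centeredStat r Ξ f ω) ∂P
        - Real.exp (-(t ^ 2 * ballVariance r f / 2))‖ ≤ 40 * B * t ^ 3 * ballVariance r f := by
  refine le_of_eq_of_le ?_
    (norm_ballFredholm_sub_gaussian_le hr hf.continuous hfs hB hfB ht hBt)
  rw [← h.integral_cexp hr hf hfs t, ← integral_mul_const]
  congr 2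
  refine integral_congr_ae (.of_forall fun ω => ?_)
  simp only
  rw [← Complex.exp_add, centeredStat]
  push_cast
  congr 1; ring

lemma HasBallLaplace.moments_of_hasCompactSupport (h : HasBallLaplace P Ξ r)
    (hr : 0 < r) {f : EuclideanSpace ℝ (Fin n) → ℝ} (hf : ContDiff ℝ ((⊤ : ℕ∞) : WithTop ℕ∞) f)
    (hfs : HasCompactSupport f) :
    0 ≤ ballVariance r f ∧
    ∫⁻ ω, ENNReal.ofReal (centeredStat r Ξ f ω ^ 2) ∂P ≤ ENNReal.ofReal (ballVariance r f) ∧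
      ∫ ω, centeredStat r Ξ f ω ∂P = 0 := by
  obtain ⟨B', hB'⟩ := hfs.exists_bound_of_continuous hf.continuous
  set B := max B' 1 with hB
  have hB0 : 0 < B := lt_of_lt_of_le one_pos (le_max_right _ _)
  have hfB : ∀ x, |f x| ≤ B := fun x => (hB' x).trans (le_max_left _ _)
  have hδ : 0 < 1 / (192 * B) := by positivity
  have hbt : ∀ t : ℝ, t ≤ 1 / (192 * B) → 192 * (B * t) ≤ 1 := fun t ht => by
    rw [le_div_iff₀ (by positivity)] at ht
    linarith
  -- Nonnegativity comes for free: a positive multiple of the variance bounds a norm from above.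
  have hV : 0 ≤ ballVariance r f := by
    have h1 := (norm_nonneg _).trans
      (h.norm_charFun_sub_le_of_hasCompactSupport hr hf hfs hB0.le hfB hδ.le (hbt _ le_rfl))
    refine nonneg_of_mul_nonneg_right h1 (by positivity)
  refine ⟨hV, moments_of_norm_charFun_sub_le (h.aemeasurable_centeredStat hf.continuous hfs) hδ
    (C := 40 * B * ballVariance r f) fun t ht htδ => ?_⟩
  refine (h.norm_charFun_sub_le_of_hasCompactSupport hr hf hfs hB0.le hfB ht.le
    (hbt t htδ)).trans (le_of_eq (by ring))

lemma HasBallLaplace.integrable_linearStat_and_integral_eq (h : HasBallLaplace P Ξ r)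
    (hr : 0 < r) {f : EuclideanSpace ℝ (Fin n) → ℝ} (hf : ContDiff ℝ ((⊤ : ℕ∞) : WithTop ℕ∞) f)
    (hfs : HasCompactSupport f) :
    Integrable (fun ω => ∫ x, f x ∂(Ξ ω)) P ∧
      ∫ ω, ∫ x, f x ∂(Ξ ω) ∂P = ballVol n r * ∫ x, f x := by
  obtain ⟨-, h1, h2⟩ := h.moments_of_hasCompactSupport hr hf hfs
  have hm := h.aemeasurable_centeredStat (r := r) hf.continuous hfs
  have hsq : Integrable (fun ω => centeredStat r Ξ f ω ^ 2) P := by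
    refine (lintegral_ofReal_ne_top_iff_integrable (by fun_prop)
      (.of_forall fun ω => sq_nonneg _)).1 (h1.trans_lt ENNReal.ofReal_lt_top).ne
  have hYi : Integrable (centeredStat r Ξ f) P :=
    ((memLp_two_iff_integrable_sq hm.aestronglyMeasurable).2 hsq).integrable one_le_two
  have hX : (fun ω => ∫ x, f x ∂(Ξ ω))
      = fun ω => centeredStat r Ξ f ω + ballVol n r * ∫ x, f x := by
    funext ω; rw [centeredStat]; ring
  refine ⟨by rw [hX]; exact hYi.add (integrable_const _), ?_⟩
  rw [hX, integral_add hYi (integrable_const _), h2]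
  simp

/-- The intensity measure is bounded by that of a homogeneous process. -/
lemma HasBallLaplace.bind_le (h : HasBallLaplace P Ξ r) (hr : 0 < r) :
    P.bind Ξ ≤ ENNReal.ofReal (ballVol n r) • volume := by
  have hΞ := h.points.measurable
  have hcomp : ∀ K : Set (EuclideanSpace ℝ (Fin n)), IsCompact K →
      P.bind Ξ K ≤ ENNReal.ofReal (ballVol n r) * volume K := by
    intro K hK
    have hle : ∀ ε : NNReal, ε ≠ 0 →
        P.bind Ξ K ≤ ENNReal.ofReal (ballVol n r) * (volume K + ε) := by
      intro ε hε
      obtain ⟨U, hKU, hU, hUε⟩ := hK.exists_isOpen_lt_add (μ := volume)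
        (ε := (ε : ENNReal)) (by exact_mod_cast hε)
      obtain ⟨R, hR⟩ := hK.isBounded.subset_ball (0 : EuclideanSpace ℝ (Fin n))
      -- A smooth function equal to `1` on `K` and supported near it transfers the mean formula to
      -- sets.
      obtain ⟨f, hf, hf01, hfsupp, hf1⟩ := exists_contMDiff_support_eq_eq_one_iff
        (modelWithCornersSelf ℝ (EuclideanSpace ℝ (Fin n))) (n := ⊤)
        (hU.inter (Metric.isOpen_ball (x := (0 : EuclideanSpace ℝ (Fin n))) (ε := R)))
        hK.isClosed (Set.subset_inter hKU hR)
      have hfd := hf.contDiff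
      have hfs : HasCompactSupport f := HasCompactSupport.of_support_subset_isCompact
        (isCompact_closedBall (0 : EuclideanSpace ℝ (Fin n)) R)
        (hfsupp.subset.trans (Set.inter_subset_right.trans Metric.ball_subset_closedBall))
      have hfx : ∀ x, f x ∈ Set.Icc (0 : ℝ) 1 := fun x => hf01 ⟨x, rfl⟩
      obtain ⟨hXi, hXe⟩ := h.integrable_linearStat_and_integral_eq hr hfd hfs
      calc P.bind Ξ K = ∫⁻ ω, Ξ ω K ∂P := Measure.bind_apply hK.measurableSet hΞ.aemeasurable
        _ ≤ ∫⁻ ω, ENNReal.ofReal (∫ x, f x ∂(Ξ ω)) ∂P := by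
            refine lintegral_mono_ae ?_
            filter_upwards [h.integrable hfd.continuous hfs] with ω hω
            rw [ofReal_integral_eq_lintegral_ofReal hω (.of_forall fun x => (hfx x).1),
              ← lintegral_indicator_one hK.measurableSet]
            refine lintegral_mono fun x => ?_
            by_cases hx : x ∈ K
            · rw [Set.indicator_of_mem hx, (hf1 x).1 hx]; simp
            · rw [Set.indicator_of_notMem hx]; exact zero_le
        _ = ENNReal.ofReal (ballVol n r * ∫ x, f x) := by
            rw [← ofReal_integral_eq_lintegral_ofReal hXi
              (.of_forall fun ω => integral_nonneg fun x => (hfx x).1), hXe]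
        _ = ENNReal.ofReal (ballVol n r) * ∫⁻ x, ENNReal.ofReal (f x) := by
            rw [ENNReal.ofReal_mul ballVol_nonneg, ofReal_integral_eq_lintegral_ofReal
              (hfd.continuous.integrable_of_hasCompactSupport hfs)
              (.of_forall fun x => (hfx x).1)]
        _ ≤ ENNReal.ofReal (ballVol n r) * volume U := by
            gcongr
            rw [← lintegral_indicator_one hU.measurableSet]
            refine lintegral_mono fun x => ?_
            by_cases hx : x ∈ U
            · rw [Set.indicator_of_mem hx]
              simpa using (hfx x).2
            · have : f x = 0 := by
                by_contra hne
                exact hx (hfsupp.subset (Function.mem_support.2 hne)).1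
              rw [Set.indicator_of_notMem hx, this]; simp
        _ ≤ _ := by gcongr
    have hlim : Tendsto
        (fun ε : NNReal => ENNReal.ofReal (ballVol n r) * (volume K + (ε : ENNReal)))
        (𝓝[≠] 0) (𝓝 (ENNReal.ofReal (ballVol n r) * (volume K + ((0 : NNReal) : ENNReal)))) := by
      refine Tendsto.mono_left ?_ nhdsWithin_le_nhds
      refine ENNReal.Tendsto.const_mul ?_ (Or.inr ENNReal.ofReal_ne_top)
      exact ((ENNReal.continuous_coe.tendsto 0)).const_add _
    have := ge_of_tendsto hlim (by
      filter_upwards [self_mem_nhdsWithin] with ε hε using hle ε hε)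
    simpa using this
  -- Finiteness on compact sets gives inner regularity of the intensity measure. The bound on
  -- compact sets then extends to all measurable sets.
  have hfin : IsFiniteMeasureOnCompacts (P.bind Ξ) := ⟨fun {K} hK =>
    (hcomp K hK).trans_lt (ENNReal.mul_lt_top ENNReal.ofReal_lt_top hK.measure_lt_top)⟩
  refine Measure.le_iff.2 fun s hs => ?_
  rw [hs.measure_eq_iSup_isCompact]
  refine iSup_le fun K => iSup_le fun hKs => iSup_le fun hK => (hcomp K hK).trans ?_
  rw [Measure.smul_apply, smul_eq_mul]
  gcongr

end Intensity

/-! ### Continuity of the variance functional -/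

section VarianceFunctional
open scoped Topology
variable {n : ℕ} {r : ℝ}

lemma norm_mul_mul_ballKernel_sq_le (f : EuclideanSpace ℝ (Fin n) → ℝ)
    (z : EuclideanSpace ℝ (Fin n) × EuclideanSpace ℝ (Fin n)) :
    ‖f z.1 * f z.2 * ‖ballKernel n r (z.1 - z.2)‖ ^ 2‖ ≤ |f z.1| * |f z.2| * ballVol n r ^ 2 := by
  rw [norm_mul, norm_mul, norm_pow, norm_norm, Real.norm_eq_abs, Real.norm_eq_abs]
  gcongr
  exact norm_ballKernel_le _

lemma aestronglyMeasurable_mul_mul_ballKernel_sq {f : EuclideanSpace ℝ (Fin n) → ℝ}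
    (hf : AEStronglyMeasurable f volume) :
    AEStronglyMeasurable (fun z : EuclideanSpace ℝ (Fin n) × EuclideanSpace ℝ (Fin n) =>
      f z.1 * f z.2 * ‖ballKernel n r (z.1 - z.2)‖ ^ 2) (volume.prod volume) := by
  have hk := continuous_ballKernel (n := n) (r := r)
  exact (hf.comp_fst.mul hf.comp_snd).mul (Continuous.aestronglyMeasurable (by fun_prop))

lemma integrable_mul_mul_ballKernel_sq {f : EuclideanSpace ℝ (Fin n) → ℝ} (hf : Integrable f) :
    Integrable (fun z : EuclideanSpace ℝ (Fin n) × EuclideanSpace ℝ (Fin n) =>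
      f z.1 * f z.2 * ‖ballKernel n r (z.1 - z.2)‖ ^ 2) (volume.prod volume) :=
  ((hf.abs.mul_prod hf.abs).mul_const _).mono'
    (aestronglyMeasurable_mul_mul_ballKernel_sq hf.1)
    (.of_forall fun z => norm_mul_mul_ballKernel_sq_le f z)

lemma ballVariance_eq {f : EuclideanSpace ℝ (Fin n) → ℝ} (hf : Integrable f) :
    ballVariance r f = ballVol n r * (∫ x, f x ^ 2)
      - ∫ z : EuclideanSpace ℝ (Fin n) × EuclideanSpace ℝ (Fin n),
        f z.1 * f z.2 * ‖ballKernel n r (z.1 - z.2)‖ ^ 2 ∂(volume.prod volume) := by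
  rw [ballVariance, ← integral_prod (f := fun z : EuclideanSpace ℝ (Fin n) ×
    EuclideanSpace ℝ (Fin n) => f z.1 * f z.2 * ‖ballKernel n r (z.1 - z.2)‖ ^ 2)
    (integrable_mul_mul_ballKernel_sq hf)]

/-- Since the ball kernel is bounded, the double integrals are dominated by `|g| ⊗ |g|` and the
single ones by `g²`. -/
lemma tendsto_ballVariance {f : ℕ → EuclideanSpace ℝ (Fin n) → ℝ}
    {g : EuclideanSpace ℝ (Fin n) → ℝ} (hfm : ∀ k, AEStronglyMeasurable (f k) volume)
    (hg : Integrable g) (hg2 : Integrable fun x => g x ^ 2) (hfg : ∀ k x, |f k x| ≤ |g x|)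
    (hlim : ∀ x, Tendsto (fun k => f k x) atTop (𝓝 (g x))) :
    Tendsto (fun k => ballVariance r (f k)) atTop (𝓝 (ballVariance r g)) := by
  have hfi : ∀ k, Integrable (f k) := fun k => hg.mono (hfm k) (.of_forall (hfg k))
  simp only [fun k => ballVariance_eq (r := r) (hfi k), ballVariance_eq (r := r) hg]
  refine Tendsto.sub (Tendsto.const_mul _ ?_) ?_
  · refine tendsto_integral_of_dominated_convergence (fun x => g x ^ 2)
      (fun k => (hfm k).pow 2) hg2 (fun k => .of_forall fun x => ?_)
      (.of_forall fun x => (hlim x).pow 2)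
    rw [Real.norm_eq_abs, abs_pow, ← sq_abs (g x)]
    exact pow_le_pow_left₀ (abs_nonneg _) (hfg k x) 2
  · refine tendsto_integral_of_dominated_convergence
      (fun z : EuclideanSpace ℝ (Fin n) × EuclideanSpace ℝ (Fin n) =>
        |g z.1| * |g z.2| * ballVol n r ^ 2)
      (fun k => aestronglyMeasurable_mul_mul_ballKernel_sq (hfm k))
      ((hg.abs.mul_prod hg.abs).mul_const _) (fun k => .of_forall fun z => ?_)
      (.of_forall fun z => ((hlim z.1).mul (hlim z.2)).mul_const _)
    refine (norm_mul_mul_ballKernel_sq_le _ z).trans ?_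
    exact mul_le_mul_of_nonneg_right (mul_le_mul (hfg k z.1) (hfg k z.2) (abs_nonneg _)
      (abs_nonneg _)) (sq_nonneg _)

end VarianceFunctional

/-! ### Linear statistics of integrable functions -/

section IntegrableStatistics
open scoped Topology
variable {n : ℕ} {r : ℝ} {Ω : Type*} [MeasurableSpace Ω] {P : Measure Ω}
  {Ξ : Ω → Measure (EuclideanSpace ℝ (Fin n))} [IsProbabilityMeasure P]

/-- The intensity is absolutely continuous, so almost surely the process does not charge a given
Lebesgue null set. Functions may thus be replaced by measurable representatives. -/
lemma HasBallLaplace.ae_ae_of_ae (h : HasBallLaplace P Ξ r) (hr : 0 < r)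
    {p : EuclideanSpace ℝ (Fin n) → Prop} (hp : ∀ᵐ x, p x) : ∀ᵐ ω ∂P, ∀ᵐ x ∂(Ξ ω), p x := by
  have h1 : ∀ᵐ x ∂(P.bind Ξ), p x :=
    (h.bind_le hr).absolutelyContinuous.ae_le (Measure.ae_smul_measure hp _)
  exact Measure.ae_ae_of_ae_bind h.points.measurable.aemeasurable h1

lemma HasBallLaplace.lintegral_lintegral_enorm_le (h : HasBallLaplace P Ξ r) (hr : 0 < r)
    {f : EuclideanSpace ℝ (Fin n) → ℝ} (hf : Measurable f) :
    ∫⁻ ω, ∫⁻ x, ‖f x‖ₑ ∂(Ξ ω) ∂P ≤ ENNReal.ofReal (ballVol n r) * ∫⁻ x, ‖f x‖ₑ := by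
  rw [← Measure.lintegral_bind h.points.measurable.aemeasurable (by fun_prop)]
  refine (lintegral_mono' (h.bind_le hr) le_rfl).trans (le_of_eq ?_)
  rw [lintegral_smul_measure, smul_eq_mul]

/-- The expectation of `X(|f|)` is at most the intensity bound times `‖f‖₁`, hence finite. -/
theorem HasBallLaplace.ae_integrable (h : HasBallLaplace P Ξ r) (hr : 0 < r)
    {f : EuclideanSpace ℝ (Fin n) → ℝ} (hf : Integrable f) : ∀ᵐ ω ∂P, Integrable f (Ξ ω) := by
  have hm : Measurable (hf.1.mk f) := hf.1.stronglyMeasurable_mk.measurable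
  have h1 := h.lintegral_lintegral_enorm_le hr hm
  have h2 : ∫⁻ x, ‖hf.1.mk f x‖ₑ < ⊤ := (hf.congr hf.1.ae_eq_mk).2
  have h3 : ∀ᵐ ω ∂P, ∫⁻ x, ‖hf.1.mk f x‖ₑ ∂(Ξ ω) < ⊤ := by
    refine ae_lt_top ((Measure.measurable_lintegral (by fun_prop)).comp
      h.points.measurable) (h1.trans_lt ?_).ne
    exact ENNReal.mul_lt_top ENNReal.ofReal_lt_top h2
  filter_upwards [h3, h.ae_ae_of_ae hr hf.1.ae_eq_mk] with ω h4 h5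
  exact Integrable.congr ⟨hm.aestronglyMeasurable, h4⟩ (EventuallyEq.symm h5)

lemma HasBallLaplace.aemeasurable_of_integrable (h : HasBallLaplace P Ξ r) (hr : 0 < r)
    {f : EuclideanSpace ℝ (Fin n) → ℝ} (hf : Integrable f) :
    AEMeasurable (fun ω => ∫ x, f x ∂(Ξ ω)) P := by
  have hm : Measurable (hf.1.mk f) := hf.1.stronglyMeasurable_mk.measurable
  refine (aemeasurable_integral_of_ae_integrable h.points.measurable hm
    (h.ae_integrable hr (hf.congr hf.1.ae_eq_mk))).congr ?_
  filter_upwards [h.ae_ae_of_ae hr hf.1.ae_eq_mk] with ω h5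
  exact integral_congr_ae (EventuallyEq.symm h5)

lemma HasBallLaplace.lintegral_enorm_integral_le (h : HasBallLaplace P Ξ r) (hr : 0 < r)
    {f : EuclideanSpace ℝ (Fin n) → ℝ} (hf : Integrable f) :
    ∫⁻ ω, ‖∫ x, f x ∂(Ξ ω)‖ₑ ∂P ≤ ENNReal.ofReal (ballVol n r) * ∫⁻ x, ‖f x‖ₑ := by
  have hm : Measurable (hf.1.mk f) := hf.1.stronglyMeasurable_mk.measurable
  have h1 : ∫⁻ x, ‖f x‖ₑ = ∫⁻ x, ‖hf.1.mk f x‖ₑ :=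
    lintegral_congr_ae (by filter_upwards [hf.1.ae_eq_mk] with x hx; rw [hx])
  rw [h1]
  refine (lintegral_mono_ae ?_).trans (h.lintegral_lintegral_enorm_le hr hm)
  filter_upwards [h.ae_ae_of_ae hr hf.1.ae_eq_mk] with ω h5
  rw [integral_congr_ae h5]
  exact enorm_integral_le_lintegral_enorm _

lemma HasBallLaplace.aemeasurable_centeredStat_of_integrable (h : HasBallLaplace P Ξ r)
    (hr : 0 < r) {f : EuclideanSpace ℝ (Fin n) → ℝ} (hf : Integrable f) :
    AEMeasurable (centeredStat r Ξ f) P :=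
  (h.aemeasurable_of_integrable hr hf).sub_const _

/-- Centred statistics of an `L¹`-convergent sequence converge almost surely along a
subsequence. -/
lemma HasBallLaplace.exists_subseq_tendsto (h : HasBallLaplace P Ξ r) (hr : 0 < r)
    {f : ℕ → EuclideanSpace ℝ (Fin n) → ℝ} {g : EuclideanSpace ℝ (Fin n) → ℝ}
    (hf : ∀ k, Integrable (f k)) (hg : Integrable g)
    (hlim : Tendsto (fun k => ∫⁻ x, ‖f k x - g x‖ₑ) atTop (𝓝 0)) :
    ∃ ns : ℕ → ℕ, StrictMono ns ∧ ∀ᵐ ω ∂P,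
      Tendsto (fun k => centeredStat r Ξ (f (ns k)) ω) atTop (𝓝 (centeredStat r Ξ g ω)) := by
  have h1 : Tendsto (fun k => eLpNorm ((fun ω => ∫ x, f k x ∂(Ξ ω)) - fun ω => ∫ x, g x ∂(Ξ ω))
      1 P) atTop (𝓝 0) := by
    have h2 : Tendsto (fun k => ENNReal.ofReal (ballVol n r) * ∫⁻ x, ‖f k x - g x‖ₑ) atTop
        (𝓝 0) := by
      simpa using ENNReal.Tendsto.const_mul hlim (Or.inr ENNReal.ofReal_ne_top)
    refine tendsto_of_tendsto_of_tendsto_of_le_of_le tendsto_const_nhds h2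
      (fun _ => zero_le) fun k => ?_
    rw [eLpNorm_one_eq_lintegral_enorm]
    refine le_trans (lintegral_mono_ae ?_)
      (h.lintegral_enorm_integral_le hr ((hf k).sub hg))
    filter_upwards [h.ae_integrable hr (hf k), h.ae_integrable hr hg] with ω h3 h4
    simp only [Pi.sub_apply]
    rw [integral_sub h3 h4]
  obtain ⟨ns, hns, hae⟩ := (tendstoInMeasure_of_tendsto_eLpNorm one_ne_zero
    (fun k => (h.aemeasurable_of_integrable hr (hf k)).aestronglyMeasurable)
    (h.aemeasurable_of_integrable hr hg).aestronglyMeasurable h1).exists_seq_tendsto_ae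
  refine ⟨ns, hns, ?_⟩
  have h5 : Tendsto (fun k => ∫ x, f k x) atTop (𝓝 (∫ x, g x)) :=
    tendsto_integral_of_L1 g hg.1 (.of_forall hf) hlim
  filter_upwards [hae] with ω hω
  exact hω.sub ((h5.comp hns.tendsto_atTop).const_mul _)

/-- Fatou's lemma along the almost surely convergent subsequence. It carries variance bounds from
regular functions to `L¹` limits. -/
lemma HasBallLaplace.lintegral_sq_le_of_tendsto (h : HasBallLaplace P Ξ r) (hr : 0 < r)
    {f : ℕ → EuclideanSpace ℝ (Fin n) → ℝ} {g : EuclideanSpace ℝ (Fin n) → ℝ}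
    (hf : ∀ k, Integrable (f k)) (hg : Integrable g)
    (hlim : Tendsto (fun k => ∫⁻ x, ‖f k x - g x‖ₑ) atTop (𝓝 0))
    {D : ℕ → ENNReal} {C : ENNReal}
    (hD : ∀ k, ∫⁻ ω, ENNReal.ofReal (centeredStat r Ξ (f k) ω ^ 2) ∂P ≤ D k)
    (hDC : Tendsto D atTop (𝓝 C)) :
    ∫⁻ ω, ENNReal.ofReal (centeredStat r Ξ g ω ^ 2) ∂P ≤ C := by
  obtain ⟨ns, hns, hae⟩ := h.exists_subseq_tendsto hr hf hg hlim
  calc ∫⁻ ω, ENNReal.ofReal (centeredStat r Ξ g ω ^ 2) ∂P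
      = ∫⁻ ω, liminf (fun k => ENNReal.ofReal (centeredStat r Ξ (f (ns k)) ω ^ 2)) atTop ∂P := by
        refine lintegral_congr_ae ?_
        filter_upwards [hae] with ω hω
        exact (ENNReal.tendsto_ofReal (hω.pow 2)).liminf_eq.symm
    _ ≤ liminf (fun k => ∫⁻ ω, ENNReal.ofReal (centeredStat r Ξ (f (ns k)) ω ^ 2) ∂P) atTop :=
        lintegral_liminf_le' fun k => by
          have := h.aemeasurable_centeredStat_of_integrable hr (hf (ns k))
          fun_prop
    _ ≤ liminf (fun k => D (ns k)) atTop := liminf_le_liminf (.of_forall fun k => hD _)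
    _ = C := (hDC.comp hns.tendsto_atTop).liminf_eq

/-- The Gaussian approximation and the variance bound for smooth bounded integrable functions. -/
theorem HasBallLaplace.variance_and_charFun (h : HasBallLaplace P Ξ r) (hr : 0 < r)
    {f : EuclideanSpace ℝ (Fin n) → ℝ} (hf : ContDiff ℝ ((⊤ : ℕ∞) : WithTop ℕ∞) f)
    (hfi : Integrable f) {B : ℝ} (hfB : ∀ x, |f x| ≤ B) :
    ∫⁻ ω, ENNReal.ofReal (centeredStat r Ξ f ω ^ 2) ∂P ≤ ENNReal.ofReal (ballVariance r f) ∧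
    ∀ t : ℝ, 0 ≤ t → 192 * (B * t) ≤ 1 →
      ‖∫ ω, Complex.exp (Complex.I * t * centeredStat r Ξ f ω) ∂P
        - Real.exp (-(t ^ 2 * ballVariance r f / 2))‖ ≤ 40 * B * t ^ 3 * ballVariance r f := by
  have hB : 0 ≤ B := (abs_nonneg _).trans (hfB 0)
  -- The truncations `χ_k f` are dominated by `|f|` and keep the bound `B`. The compactly supported
  -- estimates therefore survive the limit with the same constants.
  let χ : ℕ → ContDiffBump (0 : EuclideanSpace ℝ (Fin n)) := fun k =>
    ⟨k + 1, k + 2, by positivity, by linarith⟩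
  set F : ℕ → EuclideanSpace ℝ (Fin n) → ℝ := fun k x => χ k x * f x with hF
  have hFc : ∀ k, ContDiff ℝ ((⊤ : ℕ∞) : WithTop ℕ∞) (F k) := fun k => (χ k).contDiff.mul hf
  have hFs : ∀ k, HasCompactSupport (F k) := fun k => (χ k).hasCompactSupport.mul_right
  have hFf : ∀ k x, |F k x| ≤ |f x| := fun k x => by
    rw [hF, abs_mul, abs_of_nonneg (χ k).nonneg]
    exact mul_le_of_le_one_left (abs_nonneg _) (χ k).le_one
  have hFlim : ∀ x, Tendsto (fun k => F k x) atTop (𝓝 (f x)) := fun x => by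
    refine tendsto_const_nhds.congr' ?_
    filter_upwards [eventually_ge_atTop ⌈‖x‖⌉₊] with k hk
    have h1 : x ∈ Metric.closedBall (0 : EuclideanSpace ℝ (Fin n)) (k + 1) := by
      rw [mem_closedBall_zero_iff]
      have : ‖x‖ ≤ k := (Nat.le_ceil _).trans (by exact_mod_cast hk)
      linarith
    simp only [hF]
    rw [(χ k).one_of_mem_closedBall h1, one_mul]
  have hFi : ∀ k, Integrable (F k) := fun k =>
    (hFc k).continuous.integrable_of_hasCompactSupport (hFs k)
  have hf2 : Integrable fun x => f x ^ 2 := by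
    simp only [sq]
    exact hfi.mul_bdd (c := B) hfi.1 (.of_forall hfB)
  have hV := tendsto_ballVariance (r := r) (fun k => (hFi k).1) hfi hf2 hFf hFlim
  have hL1 : Tendsto (fun k => ∫⁻ x, ‖F k x - f x‖ₑ) atTop (𝓝 0) := by
    simp only [← ofReal_norm]
    exact tendsto_lintegral_norm_of_dominated_convergence (bound := fun x => ‖f x‖)
      (fun k => (hFi k).1) hfi.norm.2 (fun k => .of_forall fun x => hFf k x)
      (.of_forall hFlim)
  refine ⟨h.lintegral_sq_le_of_tendsto hr hFi hfi hL1
    (fun k => (h.moments_of_hasCompactSupport hr (hFc k) (hFs k)).2.1)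
    (ENNReal.tendsto_ofReal hV), fun t ht hBt => ?_⟩
  obtain ⟨ns, hns, hae⟩ := h.exists_subseq_tendsto hr hFi hfi hL1
  have h1 : Tendsto (fun k => ∫ ω, Complex.exp (Complex.I * t * centeredStat r Ξ (F (ns k)) ω) ∂P)
      atTop (𝓝 (∫ ω, Complex.exp (Complex.I * t * centeredStat r Ξ f ω) ∂P)) := by
    refine tendsto_integral_of_dominated_convergence (fun _ => 1) (fun k => ?_)
      (integrable_const _) (fun k => .of_forall fun ω => ?_) ?_
    · have := h.aemeasurable_centeredStat_of_integrable hr (hFi (ns k))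
      exact AEMeasurable.aestronglyMeasurable (by fun_prop)
    · rw [show Complex.I * t * centeredStat r Ξ (F (ns k)) ω
        = ((t * centeredStat r Ξ (F (ns k)) ω : ℝ) : ℂ) * Complex.I by push_cast; ring,
        Complex.norm_exp_ofReal_mul_I]
    · filter_upwards [hae] with ω hω
      exact (Complex.continuous_exp.tendsto _).comp
        (((Complex.continuous_ofReal.tendsto _).comp hω).const_mul _)
  have hV' := hV.comp hns.tendsto_atTop
  have h2 : Tendsto (fun k => ((Real.exp (-(t ^ 2 * ballVariance r (F (ns k)) / 2)) : ℝ) : ℂ))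
      atTop (𝓝 ((Real.exp (-(t ^ 2 * ballVariance r f / 2)) : ℝ) : ℂ)) := by
    have : Continuous fun v : ℝ => ((Real.exp (-(t ^ 2 * v / 2)) : ℝ) : ℂ) := by fun_prop
    exact (this.tendsto _).comp hV'
  exact le_of_tendsto_of_tendsto (h1.sub h2).norm (hV'.const_mul (40 * B * t ^ 3))
    (.of_forall fun k => h.norm_charFun_sub_le_of_hasCompactSupport hr (hFc _) (hFs _) hB
      (fun x => (hFf _ x).trans (hfB x)) ht hBt)

end IntegrableStatistics

/-! ### Volume of a ball minus its translate -/

section BallShell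
open scoped Topology

/-- The volume of the part of a ball that leaves the ball under a translation. -/
noncomputable def shellVol (n : ℕ) (r : ℝ) (ζ : EuclideanSpace ℝ (Fin n)) : ℝ :=
  volume.real (Metric.closedBall 0 r \ Metric.closedBall ζ r)

lemma shellVol_nonneg {n : ℕ} {r : ℝ} {ζ : EuclideanSpace ℝ (Fin n)} : 0 ≤ shellVol n r ζ :=
  measureReal_nonneg

lemma ballVol_eq {n : ℕ} {r : ℝ} (hr : 0 ≤ r) : ballVol n r = ballVolume n * r ^ n := by
  rw [ballVol, ballVolume, measureReal_def, measureReal_def,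
    Measure.addHaar_closedBall volume 0 hr, Measure.addHaar_closedBall volume 0 zero_le_one,
    ENNReal.toReal_mul, ENNReal.toReal_ofReal (by positivity), finrank_euclideanSpace_fin]
  simp [mul_comm]

lemma shellVol_map {n : ℕ} (r : ℝ) (U : EuclideanSpace ℝ (Fin n) ≃ₗᵢ[ℝ] EuclideanSpace ℝ (Fin n))
    (ζ : EuclideanSpace ℝ (Fin n)) : shellVol n r (U ζ) = shellVol n r ζ := by
  have h := U.measurePreserving.measureReal_preimage
    (s := Metric.closedBall 0 r \ Metric.closedBall (U ζ) r)
    (measurableSet_closedBall.diff measurableSet_closedBall).nullMeasurableSet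
  rw [Set.preimage_sdiff, U.preimage_closedBall, U.preimage_closedBall, map_zero,
    U.symm_apply_apply] at h
  exact h.symm

/-- The reflection exchanging `ζ` with the vector of equal norm on the first axis preserves volume
and centred balls. -/
lemma shellVol_eq_single {m : ℕ} (r : ℝ) (ζ : EuclideanSpace ℝ (Fin (m + 1))) :
    shellVol (m + 1) r ζ = shellVol (m + 1) r (EuclideanSpace.single 0 ‖ζ‖) := by
  have h : ‖ζ‖ = ‖(EuclideanSpace.single 0 ‖ζ‖ : EuclideanSpace ℝ (Fin (m + 1)))‖ := by simp
  rw [← Submodule.reflection_sub h, shellVol_map]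

lemma volume_sum_sq_le {m : ℕ} {ρ : ℝ} (hρ : 0 ≤ ρ) :
    volume {b : Fin m → ℝ | ∑ i, b i ^ 2 ≤ ρ ^ 2} = ENNReal.ofReal (ballVol m ρ) := by
  have hs : MeasurableSet {b : Fin m → ℝ | ∑ i, b i ^ 2 ≤ ρ ^ 2} :=
    measurableSet_le (by fun_prop) (by fun_prop)
  rw [← (PiLp.volume_preserving_ofLp (Fin m)).measure_preimage hs.nullMeasurableSet, ballVol,
    ofReal_measureReal measure_closedBall_lt_top.ne, EuclideanSpace.closedBall_zero_eq _ hρ]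
  rfl

/-- Fubini's theorem along the direction of translation reduces the shell to lengths of
one-dimensional slices. -/
lemma shellVol_single_eq {m : ℕ} {r : ℝ} (hr : 0 ≤ r) (s : ℝ) :
    volume (Metric.closedBall 0 r \
      Metric.closedBall (EuclideanSpace.single 0 s : EuclideanSpace ℝ (Fin (m + 1))) r)
      = ∫⁻ b : Fin m → ℝ, volume
        {a : ℝ | a ^ 2 + ∑ i, b i ^ 2 ≤ r ^ 2 ∧ r ^ 2 < (a - s) ^ 2 + ∑ i, b i ^ 2} := by
  set S : Set (ℝ × (Fin m → ℝ)) :=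
    {p | p.1 ^ 2 + ∑ i, p.2 i ^ 2 ≤ r ^ 2 ∧ r ^ 2 < (p.1 - s) ^ 2 + ∑ i, p.2 i ^ 2} with hS
  have hSm : MeasurableSet S := by
    refine MeasurableSet.inter (s₁ := {p : ℝ × (Fin m → ℝ) | p.1 ^ 2 + ∑ i, p.2 i ^ 2 ≤ r ^ 2})
      (s₂ := {p : ℝ × (Fin m → ℝ) | r ^ 2 < (p.1 - s) ^ 2 + ∑ i, p.2 i ^ 2}) ?_ ?_
    · exact measurableSet_le (by fun_prop) (by fun_prop)
    · exact measurableSet_lt (by fun_prop) (by fun_prop)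
  have hmp := (volume_preserving_piFinSuccAbove (fun _ : Fin (m + 1) => ℝ) 0).comp
    (PiLp.volume_preserving_ofLp (Fin (m + 1)))
  have h1 := hmp.measure_preimage hSm.nullMeasurableSet
  rw [show (volume : Measure (ℝ × (Fin m → ℝ))) = volume.prod volume from rfl,
    Measure.prod_apply_symm hSm] at h1
  refine Eq.trans (congrArg _ ?_) h1
  ext x
  have h2 : ∀ y : EuclideanSpace ℝ (Fin (m + 1)), ‖y‖ ≤ r ↔ y 0 ^ 2 + ∑ i : Fin m, y i.succ ^ 2
      ≤ r ^ 2 := fun y => by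
    rw [← sq_le_sq₀ (norm_nonneg _) hr, EuclideanSpace.norm_sq_eq, Fin.sum_univ_succ]
    simp
  simp only [Set.mem_sdiff, mem_closedBall_iff_norm, h2, not_le,
    Set.mem_preimage, hS, Set.mem_ofPred_eq]
  simp [MeasurableEquiv.piFinSuccAbove, Fin.insertNthEquiv, Fin.tail]

/-- The ball meets the line in `[-ℓ, ℓ]`. What the translate misses lies in `[-ℓ, -ℓ + s)`. -/
lemma volume_slice_le {r c s : ℝ} (hs : 0 ≤ s) :
    volume {a : ℝ | a ^ 2 + c ≤ r ^ 2 ∧ r ^ 2 < (a - s) ^ 2 + c}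
      ≤ {c : ℝ | c ≤ r ^ 2}.indicator (fun _ => ENNReal.ofReal s) c := by
  by_cases hc : c ≤ r ^ 2
  · rw [Set.indicator_of_mem (by exact hc)]
    set ℓ := Real.sqrt (r ^ 2 - c) with hℓ
    have hℓ2 : ℓ ^ 2 = r ^ 2 - c := Real.sq_sqrt (by linarith)
    have hℓ0 : 0 ≤ ℓ := Real.sqrt_nonneg _
    calc _ ≤ volume (Set.Ico (-ℓ) (-ℓ + s)) := by
          refine measure_mono fun a ha => ?_
          have h1 : a ^ 2 ≤ ℓ ^ 2 := by linarith [ha.1]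
          have h2 : ℓ ^ 2 < (a - s) ^ 2 := by linarith [ha.2]
          have h3 := abs_le_of_sq_le_sq' h1 hℓ0
          refine ⟨h3.1, ?_⟩
          by_contra hcon
          push Not at hcon
          nlinarith
      _ = ENNReal.ofReal s := by rw [Real.volume_Ico]; congr 1; ring
  · rw [Set.indicator_of_notMem (by exact hc)]
    refine le_of_eq ?_
    convert measure_empty (μ := (volume : Measure ℝ))
    ext a
    simp only [Set.mem_ofPred_eq, Set.mem_empty_iff_false, iff_false, not_and]
    intro h1
    nlinarith [sq_nonneg a]

/-- The condition on `c` says `s ≤ 2ℓ`, so the whole interval `[-ℓ, -ℓ + s)` lies in the slice. -/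
lemma le_volume_slice {r c s : ℝ} (hs : 0 ≤ s) :
    {c : ℝ | c ≤ r ^ 2 - s ^ 2 / 4}.indicator (fun _ => ENNReal.ofReal s) c
      ≤ volume {a : ℝ | a ^ 2 + c ≤ r ^ 2 ∧ r ^ 2 < (a - s) ^ 2 + c} := by
  by_cases hc : c ≤ r ^ 2 - s ^ 2 / 4
  · rw [Set.indicator_of_mem (by exact hc)]
    set ℓ := Real.sqrt (r ^ 2 - c) with hℓ
    have hℓ2 : ℓ ^ 2 = r ^ 2 - c := Real.sq_sqrt (by nlinarith [sq_nonneg s])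
    have hℓs : s / 2 ≤ ℓ := Real.le_sqrt_of_sq_le (by nlinarith)
    calc ENNReal.ofReal s = volume (Set.Ico (-ℓ) (-ℓ + s)) := by
          rw [Real.volume_Ico]; congr 1; ring
      _ ≤ _ := by
          refine measure_mono fun a ha => ?_
          obtain ⟨h1, h2⟩ := ha
          constructor
          · nlinarith
          · nlinarith
  · rw [Set.indicator_of_notMem (by exact hc)]
    exact zero_le

lemma volume_shell_single_le {m : ℕ} {r s : ℝ} (hr : 0 ≤ r) (hs : 0 ≤ s) :
    volume (Metric.closedBall 0 r \
      Metric.closedBall (EuclideanSpace.single 0 s : EuclideanSpace ℝ (Fin (m + 1))) r)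
      ≤ ENNReal.ofReal (s * ballVol m r) := by
  rw [shellVol_single_eq hr, ENNReal.ofReal_mul hs, ← volume_sum_sq_le hr,
    ← lintegral_indicator_const (measurableSet_le (by fun_prop) (by fun_prop))]
  refine lintegral_mono fun b => ?_
  exact volume_slice_le hs

lemma le_volume_shell_single {m : ℕ} {r s : ℝ} (hr : 0 ≤ r) (hs : 0 ≤ s) (hsr : s ≤ 2 * r) :
    ENNReal.ofReal (s * ballVol m (Real.sqrt (r ^ 2 - s ^ 2 / 4)))
      ≤ volume (Metric.closedBall 0 r \
      Metric.closedBall (EuclideanSpace.single 0 s : EuclideanSpace ℝ (Fin (m + 1))) r) := by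
  rw [shellVol_single_eq hr, ENNReal.ofReal_mul hs, ← volume_sum_sq_le (Real.sqrt_nonneg _),
    ← lintegral_indicator_const (measurableSet_le (by fun_prop) (by fun_prop))]
  refine lintegral_mono fun b => ?_
  rw [Real.sq_sqrt (by nlinarith)]
  exact le_volume_slice hs

theorem shellVol_le {m : ℕ} {r : ℝ} (hr : 0 ≤ r) (ζ : EuclideanSpace ℝ (Fin (m + 1))) :
    shellVol (m + 1) r ζ ≤ ballVolume m * r ^ m * ‖ζ‖ := by
  have h0 : 0 ≤ ballVol m r := ballVol_nonneg
  rw [shellVol_eq_single, shellVol, measureReal_def, ← ballVol_eq hr, mul_comm]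
  exact ENNReal.toReal_le_of_le_ofReal (by positivity)
    (volume_shell_single_le hr (norm_nonneg ζ))

/-- The slices of full length `s` form a ball of radius `(r² - s²/4)^{1/2}` in dimension `m`, whose
volume divided by `r ^ m` tends to `ω_m`. -/
theorem tendsto_shellVol_div {m : ℕ} (ζ : EuclideanSpace ℝ (Fin (m + 1))) :
    Tendsto (fun r => shellVol (m + 1) r ζ / r ^ m) atTop (𝓝 (ballVolume m * ‖ζ‖)) := by
  set s := ‖ζ‖ with hs
  have hs0 : 0 ≤ s := norm_nonneg _
  have hlow : Tendsto
      (fun r : ℝ => ballVolume m * s * (Real.sqrt (1 - (s / 2) ^ 2 * (r⁻¹) ^ 2)) ^ m)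
      atTop (𝓝 (ballVolume m * s)) := by
    have h1 : Continuous fun x : ℝ =>
        ballVolume m * s * (Real.sqrt (1 - (s / 2) ^ 2 * x ^ 2)) ^ m := by
      fun_prop
    have := (h1.tendsto 0).comp tendsto_inv_atTop_zero
    simpa [Function.comp_def] using this
  refine tendsto_of_tendsto_of_tendsto_of_le_of_le' hlow tendsto_const_nhds ?_ ?_
  · filter_upwards [eventually_gt_atTop 0, eventually_ge_atTop (s / 2)] with r hr hrs
    rw [le_div_iff₀ (by positivity)]
    have h2 := le_volume_shell_single (m := m) hr.le hs0 (by linarith)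
    have h3 : s * ballVol m (Real.sqrt (r ^ 2 - s ^ 2 / 4)) ≤ shellVol (m + 1) r ζ := by
      rw [shellVol_eq_single, shellVol, measureReal_def]
      exact (ENNReal.ofReal_le_iff_le_toReal
        (measure_ne_top_of_subset Set.sdiff_subset measure_closedBall_lt_top.ne)).1 h2
    refine le_trans (le_of_eq ?_) h3
    rw [ballVol_eq (Real.sqrt_nonneg _), mul_assoc, ← mul_pow]
    have h4 : Real.sqrt (r ^ 2 - s ^ 2 / 4) = Real.sqrt (1 - (s / 2) ^ 2 * (r⁻¹) ^ 2) * r := by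
      rw [← Real.sqrt_sq hr.le, ← Real.sqrt_mul' _ (sq_nonneg r), Real.sqrt_sq hr.le]
      congr 1
      field_simp
      ring
    rw [h4]; ring
  · filter_upwards [eventually_gt_atTop 0] with r hr
    rw [div_le_iff₀ (by positivity)]
    refine (shellVol_le hr.le ζ).trans (le_of_eq ?_)
    ring

end BallShell

/-! ### The variance as a Fourier integral -/

section FourierVariance
open scoped Topology FourierTransform ComplexConjugate
variable {n : ℕ} {r : ℝ}

lemma continuous_fourier_of_integrable {f : EuclideanSpace ℝ (Fin n) → ℂ} (hf : Integrable f) :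
    Continuous (𝓕 f) :=
  VectorFourier.fourierIntegral_continuous Real.continuous_fourierChar
    (by exact continuous_inner) hf

lemma norm_fourier_le (f : EuclideanSpace ℝ (Fin n) → ℂ) (ξ : EuclideanSpace ℝ (Fin n)) :
    ‖𝓕 f ξ‖ ≤ ∫ x, ‖f x‖ :=
  VectorFourier.norm_fourierIntegral_le_integral_norm _ _ _ _ _

lemma norm_ballKernel_sq_eq (z : EuclideanSpace ℝ (Fin n)) :
    ((‖ballKernel n r z‖ ^ 2 : ℝ) : ℂ) =
      ∫ p : EuclideanSpace ℝ (Fin n) × EuclideanSpace ℝ (Fin n),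
        Complex.exp (((-2 * Real.pi * inner ℝ (p.1 - p.2) z : ℝ) : ℂ) * Complex.I)
        ∂((volume.restrict (Metric.closedBall 0 r)).prod
          (volume.restrict (Metric.closedBall 0 r))) := by
  rw [← Complex.normSq_eq_norm_sq, ← Complex.mul_conj]
  unfold ballKernel
  rw [← integral_conj, ← integral_prod_mul]
  refine integral_congr_ae (.of_forall fun p => ?_)
  simp only [← Complex.exp_conj, map_mul, Complex.conj_I, Complex.conj_ofReal, inner_sub_left]
  rw [← Complex.exp_add]
  congr 1
  push_cast; ring

/-- Both sides are the same fourfold integral of `g ⊗ g` against plane waves over two copies of the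
ball, integrated in different orders. -/
lemma integral_ballKernel_sq_eq_fourier {g : EuclideanSpace ℝ (Fin n) → ℝ} (hg : Integrable g) :
    ∫ z : EuclideanSpace ℝ (Fin n) × EuclideanSpace ℝ (Fin n),
        g z.1 * g z.2 * ‖ballKernel n r (z.1 - z.2)‖ ^ 2 ∂(volume.prod volume)
      = ∫ p : EuclideanSpace ℝ (Fin n) × EuclideanSpace ℝ (Fin n),
        ‖𝓕 (fun x => (g x : ℂ)) (p.1 - p.2)‖ ^ 2
        ∂((volume.restrict (Metric.closedBall 0 r)).prod
          (volume.restrict (Metric.closedBall 0 r))) := by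
  have := isFiniteMeasure_restrict_closedBall (0 : EuclideanSpace ℝ (Fin n)) r
  set ν := volume.restrict (Metric.closedBall (0 : EuclideanSpace ℝ (Fin n)) r) with hν
  have hgc : Integrable fun x => (g x : ℂ) := hg.ofReal
  have h1 : ∀ p : EuclideanSpace ℝ (Fin n) × EuclideanSpace ℝ (Fin n),
      ((‖𝓕 (fun x => (g x : ℂ)) (p.1 - p.2)‖ ^ 2 : ℝ) : ℂ)
      = ∫ z : EuclideanSpace ℝ (Fin n) × EuclideanSpace ℝ (Fin n),
        (g z.1 : ℂ) * (g z.2 : ℂ) * Complex.exp (((-2 * Real.pi *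
          inner ℝ (p.1 - p.2) (z.1 - z.2) : ℝ) : ℂ) * Complex.I) ∂(volume.prod volume) := by
    intro p
    rw [← Complex.normSq_eq_norm_sq, ← Complex.mul_conj, Real.fourier_eq', ← integral_conj,
      ← integral_prod_mul]
    refine integral_congr_ae (.of_forall fun z => ?_)
    simp only [smul_eq_mul, map_mul, ← Complex.exp_conj, Complex.conj_I, Complex.conj_ofReal,
      inner_sub_right]
    rw [mul_mul_mul_comm, ← Complex.exp_add, mul_comm]
    congr 2
    simp only [inner_sub_left, real_inner_comm p.1, real_inner_comm p.2]
    push_cast; ring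
  apply Complex.ofReal_injective
  rw [← integral_complex_ofReal, ← integral_complex_ofReal]
  simp only [h1]
  rw [integral_integral_swap]
  · refine integral_congr_ae (.of_forall fun z => ?_)
    simp only
    rw [integral_const_mul, Complex.ofReal_mul, norm_ballKernel_sq_eq]
    push_cast
    rfl
  · have h2 : Integrable (fun q : (EuclideanSpace ℝ (Fin n) × EuclideanSpace ℝ (Fin n)) ×
        EuclideanSpace ℝ (Fin n) × EuclideanSpace ℝ (Fin n) => (g q.2.1 : ℂ) * (g q.2.2 : ℂ))
        ((ν.prod ν).prod (volume.prod volume)) :=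
      (hgc.mul_prod hgc).comp_snd _
    refine h2.mul_bdd (c := 1) (Continuous.aestronglyMeasurable (by fun_prop))
      (.of_forall fun z => ?_)
    rw [Complex.norm_exp_ofReal_mul_I]

lemma shellVol_eq_sub (ζ : EuclideanSpace ℝ (Fin n)) :
    shellVol n r ζ = ballVol n r
      - volume.real (Metric.closedBall 0 r ∩ Metric.closedBall ζ r) := by
  have := measureReal_sdiff_add_inter (μ := volume) (s := Metric.closedBall 0 r)
    (measurableSet_closedBall (x := ζ) (ε := r)) measure_closedBall_lt_top.ne
  rw [shellVol, ballVol]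
  linarith

/-- The autocorrelation of a ball. -/
lemma integral_prod_closedBall_sub {F : EuclideanSpace ℝ (Fin n) → ℝ} (hF : Integrable F)
    (hFc : Continuous F) {C : ℝ} (hFC : ∀ x, ‖F x‖ ≤ C) :
    Integrable (fun ζ => F ζ * volume.real (Metric.closedBall 0 r ∩ Metric.closedBall ζ r)) ∧
    ∫ p : EuclideanSpace ℝ (Fin n) × EuclideanSpace ℝ (Fin n), F (p.1 - p.2)
        ∂((volume.restrict (Metric.closedBall 0 r)).prod
          (volume.restrict (Metric.closedBall 0 r)))
      = ∫ ζ, F ζ * volume.real (Metric.closedBall 0 r ∩ Metric.closedBall ζ r) := by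
  have := isFiniteMeasure_restrict_closedBall (0 : EuclideanSpace ℝ (Fin n)) r
  set B := Metric.closedBall (0 : EuclideanSpace ℝ (Fin n)) r with hB
  have hBm : MeasurableSet B := measurableSet_closedBall
  have h1 : Integrable (fun p : EuclideanSpace ℝ (Fin n) × EuclideanSpace ℝ (Fin n) =>
      F p.2 * B.indicator (fun _ => (1 : ℝ)) (p.1 - p.2)) ((volume.restrict B).prod volume) := by
    refine (hF.comp_snd _).mul_bdd (c := 1) ?_ (.of_forall fun p => ?_)
    · have : Measurable (B.indicator fun _ => (1 : ℝ)) := measurable_const.indicator hBm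
      exact (this.comp (measurable_fst.sub measurable_snd)).aestronglyMeasurable
    · refine (norm_indicator_le_norm_self _ _).trans (by simp)
  have h2 : ∀ ζ, ∫ ξ in B, F ζ * B.indicator (fun _ => (1 : ℝ)) (ξ - ζ)
      = F ζ * volume.real (B ∩ Metric.closedBall ζ r) := fun ζ => by
    rw [integral_const_mul]
    congr 1
    have h3 : (fun ξ => B.indicator (fun _ => (1 : ℝ)) (ξ - ζ))
        = (Metric.closedBall ζ r).indicator 1 := by
      funext ξ
      by_cases hx : ξ ∈ Metric.closedBall ζ r
      · rw [Set.indicator_of_mem hx, Set.indicator_of_mem]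
        · rfl
        · rw [mem_closedBall_iff_norm] at hx
          rwa [hB, mem_closedBall_zero_iff]
      · rw [Set.indicator_of_notMem hx, Set.indicator_of_notMem]
        rw [mem_closedBall_iff_norm] at hx
        rwa [hB, mem_closedBall_zero_iff]
    rw [h3, integral_indicator_one measurableSet_closedBall, measureReal_restrict_apply
      measurableSet_closedBall, Set.inter_comm]
  refine ⟨by simpa only [h2] using h1.integral_prod_right, ?_⟩
  rw [integral_prod _ (Integrable.of_bound (C := C)
    (Continuous.aestronglyMeasurable (by fun_prop)) (.of_forall fun p => hFC _))]
  simp only [← h2]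
  rw [← integral_integral_swap
    (f := fun ξ ζ => F ζ * B.indicator (fun _ => (1 : ℝ)) (ξ - ζ)) h1]
  refine integral_congr_ae (.of_forall fun ξ => ?_)
  simp only
  rw [← integral_indicator hBm, ← integral_sub_left_eq_self _ volume ξ]
  refine integral_congr_ae (.of_forall fun ζ => ?_)
  simp only
  by_cases hx : ξ - ζ ∈ B
  · rw [Set.indicator_of_mem hx, Set.indicator_of_mem hx, mul_one, sub_sub_cancel]
  · rw [Set.indicator_of_notMem hx, Set.indicator_of_notMem hx, mul_zero]

/-- The variance of a linear statistic in terms of the Fourier transform. -/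
theorem ballVariance_eq_integral_fourier {g : EuclideanSpace ℝ (Fin n) → ℝ} (hg : Integrable g)
    (hF : Integrable fun ξ => ‖𝓕 (fun x => (g x : ℂ)) ξ‖ ^ 2)
    (hP : ∫ x, g x ^ 2 = ∫ ξ, ‖𝓕 (fun x => (g x : ℂ)) ξ‖ ^ 2) :
    Integrable (fun ξ => ‖𝓕 (fun x => (g x : ℂ)) ξ‖ ^ 2 * shellVol n r ξ) ∧
    ballVariance r g = ∫ ξ, ‖𝓕 (fun x => (g x : ℂ)) ξ‖ ^ 2 * shellVol n r ξ := by
  have hc := continuous_fourier_of_integrable (hg.ofReal (𝕜 := ℂ))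
  obtain ⟨h1, h2⟩ := integral_prod_closedBall_sub (r := r) hF (by exact hc.norm.pow 2)
    (C := (∫ x, ‖(g x : ℂ)‖) ^ 2) fun ξ => by
      rw [norm_pow, norm_norm]
      exact pow_le_pow_left₀ (norm_nonneg _) (norm_fourier_le _ ξ) 2
  -- The ball volume times `∫ |ĝ|²` is the first term of the variance, and the overlap of the two
  -- balls gives the second.
  simp only [shellVol_eq_sub, mul_sub]
  refine ⟨(hF.mul_const _).sub h1, ?_⟩
  rw [integral_sub (hF.mul_const _) h1, integral_mul_const, ballVariance_eq hg,
    integral_ballKernel_sq_eq_fourier hg, h2, hP, mul_comm]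

end FourierVariance

/-! ### Plancherel and Sobolev regularity for integrable functions -/

section SobolevFourier
open scoped Topology FourierTransform SchwartzMap
variable {n : ℕ}

lemma integral_fourier_smul_eq_of_integrable (φ : 𝓢(EuclideanSpace ℝ (Fin n), ℂ))
    {g : EuclideanSpace ℝ (Fin n) → ℂ} (hg : Integrable g) :
    ∫ x, 𝓕 φ x • g x = ∫ ξ, φ ξ • 𝓕 g ξ := by
  have := VectorFourier.integral_fourierIntegral_smul_eq_flip (μ := volume) (ν := volume)
    (e := Real.fourierChar) (L := innerₗ (EuclideanSpace ℝ (Fin n)))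
    Real.continuous_fourierChar (by exact continuous_inner) φ.integrable hg
  rw [flip_innerₗ] at this
  exact this

lemma ae_eq_of_integral_schwartz_smul_eq {f g : EuclideanSpace ℝ (Fin n) → ℂ}
    (hf : LocallyIntegrable f) (hg : LocallyIntegrable g)
    (h : ∀ φ : 𝓢(EuclideanSpace ℝ (Fin n), ℂ), ∫ x, φ x • f x = ∫ x, φ x • g x) :
    f =ᵐ[volume] g := by
  refine ae_eq_of_integral_contDiff_smul_eq hf hg fun u hu hus => ?_
  have hof : ContDiff ℝ ((⊤ : ℕ∞) : WithTop ℕ∞) fun x : ℝ => (x : ℂ) :=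
    Complex.ofRealCLM.contDiff
  have := h (HasCompactSupport.toSchwartzMap (f := fun x => (u x : ℂ))
    (hus.comp_left (g := fun x : ℝ => (x : ℂ)) rfl) (hof.comp hu))
  simpa using this

/-- Plancherel's theorem for integrable functions with square integrable Fourier transform. -/
theorem plancherel_of_integrable {g : EuclideanSpace ℝ (Fin n) → ℂ} (hg : Integrable g)
    (hF : MemLp (𝓕 g) 2 volume) :
    MemLp g 2 volume ∧ ∫ x, ‖g x‖ ^ 2 = ∫ ξ, ‖𝓕 g ξ‖ ^ 2 := by
  set u : L2Space n := hF.toLp (𝓕 g) with hu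
  set v : L2Space n := 𝓕⁻ u with hv
  have huv : 𝓕 v = u := FourierTransform.fourier_fourierInv_eq u
  have hue : u =ᵐ[volume] 𝓕 g := hF.coeFn_toLp
  -- The `L²` inverse transform of `ĝ` and `g` itself are compared as tempered distributions, by
  -- testing against `ψ = 𝓕(𝓕⁻ψ)`.
  have hvg : v =ᵐ[volume] g := by
    refine ae_eq_of_integral_schwartz_smul_eq ((Lp.memLp v).locallyIntegrable one_le_two)
      hg.locallyIntegrable fun ψ => ?_
    have h1 : Lp.toTemperedDistribution v (𝓕 (𝓕⁻ ψ)) = Lp.toTemperedDistribution u (𝓕⁻ ψ) := by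
      rw [← TemperedDistribution.fourier_apply, Lp.fourier_toTemperedDistribution_eq, huv]
    rw [Lp.toTemperedDistribution_apply, Lp.toTemperedDistribution_apply] at h1
    have h2 : ∫ x, (𝓕⁻ ψ) x • u x = ∫ x, (𝓕⁻ ψ) x • 𝓕 g x :=
      integral_congr_ae (by filter_upwards [hue] with x hx; rw [hx])
    rw [h2, ← integral_fourier_smul_eq_of_integrable _ hg,
      FourierTransform.fourier_fourierInv_eq] at h1
    exact h1
  refine ⟨(Lp.memLp v).ae_eq hvg, ?_⟩
  have h3 := Lp.inner_fourier_eq v v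
  rw [huv, L2.inner_def, L2.inner_def] at h3
  have h4 : ∀ w : ℂ, inner ℂ w w = ((‖w‖ ^ 2 : ℝ) : ℂ) := fun w => by
    rw [inner_self_eq_norm_sq_to_K]; simp
  simp only [h4, integral_complex_ofReal] at h3
  have h5 := Complex.ofReal_injective h3
  rw [integral_congr_ae (g := fun ξ => ‖𝓕 g ξ‖ ^ 2)
    (by filter_upwards [hue] with x hx; rw [hx]), integral_congr_ae (g := fun ξ => ‖g ξ‖ ^ 2)
    (f := fun ξ => ‖v ξ‖ ^ 2) (by filter_upwards [hvg] with x hx; rw [hx])] at h5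
  exact h5.symm

/-- The Fourier transform of an integrable function in `H^s` is square integrable with the
Sobolev weight. -/
theorem memLp_weight_mul_fourier {s : ℝ} {g : EuclideanSpace ℝ (Fin n) → ℂ} (hg : Integrable g)
    (hs : TemperedDistribution.MemSobolev s 2 (Lp.toTemperedDistribution hg.toL1)) :
    MemLp (fun ξ => (((1 + ‖ξ‖ ^ 2) ^ (s / 2) : ℝ) : ℂ) * 𝓕 g ξ) 2 volume := by
  obtain ⟨f, hf⟩ := TemperedDistribution.memSobolev_iff_exists_smulLeftCLM_fourier.1 hs
  have hw : (fun x : EuclideanSpace ℝ (Fin n) =>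
      (((1 + ‖x‖ ^ 2) ^ (s / 2) : ℝ) : ℂ)).HasTemperateGrowth := by fun_prop
  have hcont : Continuous fun ξ : EuclideanSpace ℝ (Fin n) =>
      (((1 + ‖ξ‖ ^ 2) ^ (s / 2) : ℝ) : ℂ) * 𝓕 g ξ :=
    hw.1.continuous.mul (continuous_fourier_of_integrable hg)
  refine (Lp.memLp f).ae_eq (ae_eq_of_integral_schwartz_smul_eq
    -- The Sobolev condition gives an `L²` function equal to the weighted transform only as a
    -- distribution. Moving the weight and the transform onto the test function identifies it with
    -- the classical expression.
    ((Lp.memLp f).locallyIntegrable one_le_two) hcont.locallyIntegrable fun φ => ?_)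
  have h1 := DFunLike.congr_fun hf φ
  rw [TemperedDistribution.smulLeftCLM_apply_apply, TemperedDistribution.fourier_apply,
    Lp.toTemperedDistribution_apply, Lp.toTemperedDistribution_apply] at h1
  rw [← h1, integral_congr_ae (g := fun x => 𝓕 (SchwartzMap.smulLeftCLM ℂ
    (fun x : EuclideanSpace ℝ (Fin n) => (((1 + ‖x‖ ^ 2) ^ (s / 2) : ℝ) : ℂ)) φ) x • g x)
    (by filter_upwards [hg.coeFn_toL1] with x hx; rw [hx]),
    integral_fourier_smul_eq_of_integrable _ hg]
  refine integral_congr_ae (.of_forall fun ξ => ?_)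
  simp only [SchwartzMap.smulLeftCLM_apply_apply hw, smul_eq_mul]
  ring

end SobolevFourier

/-! ### Mollification with control of Fourier multipliers -/

section Mollification
open scoped Topology FourierTransform Convolution
variable {n : ℕ}

/-- A version of Scheffé's lemma. -/
lemma tendsto_lintegral_enorm_sub_of_integral_norm_le {X : Type*} [MeasurableSpace X]
    {ν : Measure X} {f : ℕ → X → ℝ} {g : X → ℝ} (hf : ∀ k, Integrable (f k) ν)
    (hg : Integrable g ν) (hle : ∀ k, ∫ x, ‖f k x‖ ∂ν ≤ ∫ x, ‖g x‖ ∂ν)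
    (hlim : ∀ᵐ x ∂ν, Tendsto (fun k => f k x) atTop (𝓝 (g x))) :
    Tendsto (fun k => ∫⁻ x, ‖f k x - g x‖ₑ ∂ν) atTop (𝓝 0) := by
  have hd : ∀ k, Integrable (fun x => f k x - g x) ν := fun k => (hf k).sub hg
  -- The triangle inequality places this integrand between `0` and `2|g|`, so no majorant for the `f
  -- k` is required.
  have h1 : Tendsto (fun k => ∫ x, (‖g x‖ + ‖f k x‖ - ‖f k x - g x‖) ∂ν) atTop
      (𝓝 (∫ x, 2 * ‖g x‖ ∂ν)) := by
    refine tendsto_integral_of_dominated_convergence (fun x => 2 * ‖g x‖)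
      (fun k => ((hg.norm.add (hf k).norm).sub (hd k).norm).1) (hg.norm.const_mul 2)
      (fun k => .of_forall fun x => ?_) ?_
    · have h2 := norm_sub_norm_le (f k x) (f k x - g x)
      rw [sub_sub_cancel] at h2
      have h3 := norm_sub_le (f k x) (g x)
      rw [Real.norm_of_nonneg (by linarith)]
      linarith
    · filter_upwards [hlim] with x hx
      have h2 := ((hx.norm).const_add ‖g x‖).sub ((hx.sub_const (g x)).norm)
      rw [sub_self, norm_zero, sub_zero, ← two_mul] at h2
      exact h2
  have h4 : Tendsto (fun k => ∫ x, ‖f k x - g x‖ ∂ν) atTop (𝓝 0) := by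
    have h5 : Tendsto (fun k => 2 * ∫ x, ‖g x‖ ∂ν
        - ∫ x, (‖g x‖ + ‖f k x‖ - ‖f k x - g x‖) ∂ν) atTop (𝓝 0) := by
      have := h1.const_sub (2 * ∫ x, ‖g x‖ ∂ν)
      rwa [integral_const_mul, sub_self] at this
    refine tendsto_of_tendsto_of_tendsto_of_le_of_le tendsto_const_nhds h5
      (fun k => integral_nonneg fun x => norm_nonneg _) fun k => ?_
    have h6 : Integrable (fun x => ‖g x‖ + ‖f k x‖) ν := hg.norm.add (hf k).norm
    simp only
    rw [integral_sub h6 (hd k).norm, integral_add hg.norm (hf k).norm]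
    linarith [hle k]
  have h6 := ENNReal.tendsto_ofReal h4
  rw [ENNReal.ofReal_zero] at h6
  refine h6.congr fun k => ?_
  rw [ofReal_integral_norm_eq_lintegral_enorm (hd k)]

/-- Mollification of integrable functions. -/
theorem exists_mollification {g : EuclideanSpace ℝ (Fin n) → ℝ} (hg : Integrable g) :
    ∃ (h : ℕ → EuclideanSpace ℝ (Fin n) → ℝ) (m : ℕ → EuclideanSpace ℝ (Fin n) → ℂ),
      (∀ k, ContDiff ℝ ((⊤ : ℕ∞) : WithTop ℕ∞) (h k)) ∧ (∀ k, Integrable (h k)) ∧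
      (∀ k, ∃ B, ∀ x, |h k x| ≤ B) ∧
      (∀ k ξ, 𝓕 (fun x => (h k x : ℂ)) ξ = m k ξ * 𝓕 (fun x => (g x : ℂ)) ξ) ∧
      (∀ k, Continuous (m k)) ∧ (∀ k ξ, ‖m k ξ‖ ≤ 1) ∧
      (∀ ξ, Tendsto (fun k => m k ξ) atTop (𝓝 1)) ∧
      Tendsto (fun k => ∫⁻ x, ‖h k x - g x‖ₑ) atTop (𝓝 0) := by
  -- The ratio of the radii is kept equal to `2`, as almost everywhere convergence of the
  -- convolutions requires.
  let φ : ℕ → ContDiffBump (0 : EuclideanSpace ℝ (Fin n)) := fun k =>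
    ⟨1 / (2 * (k + 1)), 1 / (k + 1), by positivity, by
      gcongr
      linarith [(Nat.cast_nonneg k : (0 : ℝ) ≤ k)]⟩
  set p : ℕ → EuclideanSpace ℝ (Fin n) → ℝ := fun k => (φ k).normed volume with hp
  have hp0 : ∀ k x, 0 ≤ p k x := fun k x => (φ k).nonneg_normed x
  have hpc : ∀ k, ContDiff ℝ ((⊤ : ℕ∞) : WithTop ℕ∞) (p k) := fun k => (φ k).contDiff_normed
  have hps : ∀ k, HasCompactSupport (p k) := fun k => (φ k).hasCompactSupport_normed
  have hpi : ∀ k, Integrable (p k) := fun k => (φ k).integrable_normed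
  have hp1 : ∀ k, ∫ x, p k x = 1 := fun k => (φ k).integral_normed
  have hout : Tendsto (fun k => (φ k).rOut) atTop (𝓝 0) :=
    tendsto_one_div_add_atTop_nhds_zero_nat (𝕜 := ℝ)
  set h : ℕ → EuclideanSpace ℝ (Fin n) → ℝ := fun k =>
    p k ⋆[ContinuousLinearMap.lsmul ℝ ℝ, volume] g with hh
  have hdef : ∀ k x, h k x = ∫ t, p k t * g (x - t) := fun k x => rfl
  have hhi : ∀ k, Integrable (h k) := fun k =>
    Integrable.integrable_convolution _ (hpi k) hg
  have hpci : ∀ k, Integrable fun x => (p k x : ℂ) := fun k => (hpi k).ofReal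
  refine ⟨h, fun k => 𝓕 fun x => (p k x : ℂ), fun k =>
    (hps k).contDiff_convolution_left _ (hpc k) hg.locallyIntegrable, hhi, fun k => ?_,
    fun k ξ => ?_, fun k => continuous_fourier_of_integrable (hpci k), fun k ξ => ?_, fun ξ => ?_,
    ?_⟩
  · obtain ⟨C, hC⟩ := (hps k).exists_bound_of_continuous (hpc k).continuous
    refine ⟨∫ t, C * ‖g t‖, fun x => ?_⟩
    rw [hdef, ← integral_sub_left_eq_self (fun t => C * ‖g t‖) volume x]
    refine norm_integral_le_of_norm_le (f := fun t => p k t * g (x - t))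
      ((hg.comp_sub_left x).norm.const_mul C) (.of_forall fun t => ?_)
    rw [norm_mul]
    gcongr
    exact hC t
  · have := Real.fourier_mul_convolution_eq (hpci k) (hg.ofReal (𝕜 := ℂ)) ξ
    refine Eq.trans (congrArg (fun u : EuclideanSpace ℝ (Fin n) → ℂ => 𝓕 u ξ) ?_) this
    funext x
    rw [hdef, ← integral_complex_ofReal]
    refine integral_congr_ae (.of_forall fun t => ?_)
    simp
  · refine (norm_fourier_le _ ξ).trans (le_of_eq ?_)
    rw [← hp1 k]
    refine integral_congr_ae (.of_forall fun x => ?_)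
    simp only [Complex.norm_real, Real.norm_of_nonneg (hp0 k x)]
  · rw [tendsto_iff_norm_sub_tendsto_zero]
    -- Mass one supported within `rOut` gives `|m(ξ) - 1| ≤ 2π · rOut · |ξ|`.
    have h0 : Tendsto (fun k => 2 * Real.pi * ((φ k).rOut * ‖ξ‖)) atTop (𝓝 0) := by
      simpa using (hout.mul_const ‖ξ‖).const_mul (2 * Real.pi)
    refine tendsto_of_tendsto_of_tendsto_of_le_of_le tendsto_const_nhds h0
      (fun k => norm_nonneg _) fun k => ?_
    have h1 : (1 : ℂ) = ∫ x, (p k x : ℂ) := by rw [integral_complex_ofReal, hp1]; simp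
    have hei : Integrable fun v : EuclideanSpace ℝ (Fin n) =>
        Complex.exp ((-2 * Real.pi * inner ℝ v ξ : ℝ) * Complex.I) • (p k v : ℂ) :=
      (hpci k).bdd_mul (c := 1) (Continuous.aestronglyMeasurable (by fun_prop))
        (.of_forall fun v => by rw [Complex.norm_exp_ofReal_mul_I])
    simp only
    rw [h1, Real.fourier_eq', ← integral_sub hei (hpci k)]
    refine (norm_integral_le_of_norm_le (((hpi k).const_mul (2 * Real.pi * ((φ k).rOut * ‖ξ‖))))
      (.of_forall fun v => ?_)).trans (le_of_eq ?_)
    · rw [smul_eq_mul, ← sub_one_mul, norm_mul, Complex.norm_real, Real.norm_of_nonneg (hp0 k v)]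
      by_cases hv : p k v = 0
      · rw [hv, mul_zero, mul_zero]
      · refine mul_le_mul_of_nonneg_right ?_ (hp0 k v)
        have hv' : v ∈ Metric.ball (0 : EuclideanSpace ℝ (Fin n)) (φ k).rOut := by
          rw [← (φ k).support_normed_eq (μ := volume)]
          exact hv
        have h2 := Real.norm_exp_I_mul_ofReal_sub_one_le (x := -2 * Real.pi * inner ℝ v ξ)
        rw [mul_comm] at h2
        refine h2.trans ?_
        rw [norm_mul, norm_mul, norm_neg, Real.norm_of_nonneg Real.pi_pos.le, Real.norm_ofNat]
        gcongr
        refine (norm_inner_le_norm v ξ).trans ?_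
        gcongr
        exact (mem_ball_zero_iff.1 hv').le
    · rw [integral_const_mul, hp1, mul_one]
  · refine tendsto_lintegral_enorm_sub_of_integral_norm_le hhi hg (fun k => ?_)
      (ContDiffBump.ae_convolution_tendsto_right_of_locallyIntegrable (K := 2) hout
        (.of_forall fun k => ?_) hg.locallyIntegrable)
    · have h1 : ∫ x, (p k ⋆[ContinuousLinearMap.lsmul ℝ ℝ, volume] fun x => ‖g x‖) x
          = ∫ x, ‖g x‖ := by
        rw [integral_convolution _ (hpi k) hg.norm, hp1]
        simp
      rw [← h1]
      refine integral_mono (hhi k).norm (Integrable.integrable_convolution _ (hpi k) hg.norm)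
        fun x => ?_
      refine (norm_integral_le_integral_norm _).trans (le_of_eq ?_)
      refine integral_congr_ae (.of_forall fun t => ?_)
      simp [abs_of_nonneg (hp0 k t)]
    · change 1 / ((k : ℝ) + 1) ≤ 2 * (1 / (2 * ((k : ℝ) + 1)))
      refine le_of_eq ?_
      field_simp

end Mollification

/-! ### Growth of the variance -/

section VarianceAsymptotics
open scoped Topology FourierTransform

lemma integrable_fourier_sq_of_memSobolev {n : ℕ} {g : EuclideanSpace ℝ (Fin n) → ℂ}
    (hg : Integrable g)
    (hs : TemperedDistribution.MemSobolev (1 / 2) 2 (Lp.toTemperedDistribution hg.toL1)) :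
    Integrable (fun ξ => ‖𝓕 g ξ‖ ^ 2) ∧ Integrable fun ξ => ‖𝓕 g ξ‖ ^ 2 * ‖ξ‖ := by
  have hc := continuous_fourier_of_integrable hg
  have h1 := memLp_weight_mul_fourier hg hs
  have h2 := (memLp_two_iff_integrable_sq_norm h1.1).1 h1
  have h3 : ∀ ξ : EuclideanSpace ℝ (Fin n),
      ‖(((1 + ‖ξ‖ ^ 2) ^ ((1 / 2 : ℝ) / 2) : ℝ) : ℂ) * 𝓕 g ξ‖ ^ 2
        = Real.sqrt (1 + ‖ξ‖ ^ 2) * ‖𝓕 g ξ‖ ^ 2 := fun ξ => by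
    rw [norm_mul, mul_pow, Complex.norm_real, Real.norm_of_nonneg (by positivity),
      ← Real.rpow_natCast, ← Real.rpow_mul (by positivity), Real.sqrt_eq_rpow]
    norm_num
  simp only [h3] at h2
  have h4 : ∀ ξ : EuclideanSpace ℝ (Fin n), 1 ≤ Real.sqrt (1 + ‖ξ‖ ^ 2) := fun ξ =>
    Real.one_le_sqrt.2 (by nlinarith [norm_nonneg ξ])
  have h5 : ∀ ξ : EuclideanSpace ℝ (Fin n), ‖ξ‖ ≤ Real.sqrt (1 + ‖ξ‖ ^ 2) := fun ξ =>
    Real.le_sqrt_of_sq_le (by linarith)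
  constructor
  · refine h2.mono' (Continuous.aestronglyMeasurable (by fun_prop)) (.of_forall fun ξ => ?_)
    rw [Real.norm_of_nonneg (by positivity)]
    exact le_mul_of_one_le_left (by positivity) (h4 ξ)
  · refine h2.mono' (Continuous.aestronglyMeasurable (by fun_prop)) (.of_forall fun ξ => ?_)
    rw [Real.norm_of_nonneg (by positivity), mul_comm]
    exact mul_le_mul_of_nonneg_right (h5 ξ) (by positivity)

/-- Rescaling frequencies by `2π` preserves the measure `|ĝ|² dξ`; only the weight `|ξ|` produces
the factor `2π`. -/
lemma limitVariance_eq {n : ℕ} (g : EuclideanSpace ℝ (Fin n) → ℝ) :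
    (limitVariance g : ℝ) = 2 * Real.pi * ∫ ξ, ‖𝓕 (fun x => (g x : ℂ)) ξ‖ ^ 2 * ‖ξ‖ := by
  have hpi : 0 < 2 * Real.pi := by positivity
  have h1 : ∀ ξ, unitaryFourier g ξ = (((2 * Real.pi) ^ (-(n : ℝ) / 2) : ℝ) : ℂ) *
      𝓕 (fun x => (g x : ℂ)) ((2 * Real.pi)⁻¹ • ξ) := fun ξ => by
    rw [unitaryFourier, Real.fourier_eq']
    congr 1
    refine integral_congr_ae (.of_forall fun x => ?_)
    simp only [smul_eq_mul, inner_smul_right]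
    rw [real_inner_comm]
    congr 2
    push_cast
    have : (Real.pi : ℂ) ≠ 0 := by exact_mod_cast Real.pi_ne_zero
    field_simp
  have h2 : ∀ ξ : EuclideanSpace ℝ (Fin n), ‖unitaryFourier g ξ‖ ^ 2 * ‖ξ‖
      = ((2 * Real.pi) ^ n)⁻¹ * (2 * Real.pi * (‖𝓕 (fun x => (g x : ℂ)) ((2 * Real.pi)⁻¹ • ξ)‖ ^ 2
        * ‖(2 * Real.pi)⁻¹ • ξ‖)) := fun ξ => by
    rw [h1, norm_mul, Complex.norm_real, Real.norm_of_nonneg (by positivity), mul_pow, norm_smul,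
      norm_inv, Real.norm_of_nonneg hpi.le, ← Real.rpow_natCast, ← Real.rpow_mul hpi.le,
      ← Real.rpow_natCast (2 * Real.pi) n, ← Real.rpow_neg hpi.le]
    have : -(n : ℝ) / 2 * ((2 : ℕ) : ℝ) = -n := by push_cast; ring
    rw [this]
    field_simp
  change ∫ ξ, ‖unitaryFourier g ξ‖ ^ 2 * ‖ξ‖ = _
  simp only [h2]
  rw [integral_const_mul, Measure.integral_comp_inv_smul volume (fun η : EuclideanSpace ℝ (Fin n) =>
    2 * Real.pi * (‖𝓕 (fun x => (g x : ℂ)) η‖ ^ 2 * ‖η‖)) (2 * Real.pi), finrank_euclideanSpace_fin,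
    abs_of_pos (by positivity), smul_eq_mul, ← mul_assoc, inv_mul_cancel₀ (by positivity), one_mul,
    integral_const_mul]

/-- Formulated with a bounded multiplier so as to cover both a mollification of `g` and the
difference of two of them. The shell bound gives the inequality and the majorant for the limit. -/
lemma ballVariance_of_fourier_eq_mul {m : ℕ} {g h : EuclideanSpace ℝ (Fin (m + 1)) → ℝ}
    {a : EuclideanSpace ℝ (Fin (m + 1)) → ℂ} (hh : Integrable h)
    (hF : Integrable fun ξ => ‖𝓕 (fun x => (g x : ℂ)) ξ‖ ^ 2)
    (hF1 : Integrable fun ξ => ‖𝓕 (fun x => (g x : ℂ)) ξ‖ ^ 2 * ‖ξ‖)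
    (ha : Continuous a) {C : ℝ} (haC : ∀ ξ, ‖a ξ‖ ≤ C)
    (hha : ∀ ξ, 𝓕 (fun x => (h x : ℂ)) ξ = a ξ * 𝓕 (fun x => (g x : ℂ)) ξ) :
    (∀ r, 0 < r → ballVariance r h ≤ ballVolume m * r ^ m *
      ∫ ξ, ‖a ξ‖ ^ 2 * (‖𝓕 (fun x => (g x : ℂ)) ξ‖ ^ 2 * ‖ξ‖)) ∧
    Tendsto (fun r => ballVariance r h / r ^ m) atTop (𝓝 (ballVolume m *
      ∫ ξ, ‖a ξ‖ ^ 2 * (‖𝓕 (fun x => (g x : ℂ)) ξ‖ ^ 2 * ‖ξ‖))) := by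
  set F : EuclideanSpace ℝ (Fin (m + 1)) → ℝ := fun ξ => ‖𝓕 (fun x => (g x : ℂ)) ξ‖ ^ 2 with hFdef
  have hF0 : ∀ ξ, 0 ≤ F ξ := fun ξ => by positivity
  have hnorm : ∀ ξ, ‖𝓕 (fun x => (h x : ℂ)) ξ‖ ^ 2 = ‖a ξ‖ ^ 2 * F ξ := fun ξ => by
    rw [hha, norm_mul, mul_pow]
  have ha2 : AEStronglyMeasurable (fun ξ => ‖a ξ‖ ^ 2) volume :=
    Continuous.aestronglyMeasurable (by fun_prop)
  have haC2 : ∀ ξ, ‖‖a ξ‖ ^ 2‖ ≤ C ^ 2 := fun ξ => by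
    rw [norm_pow, norm_norm]
    exact pow_le_pow_left₀ (norm_nonneg _) (haC ξ) 2
  have hi : Integrable fun ξ => ‖a ξ‖ ^ 2 * F ξ := hF.bdd_mul ha2 (.of_forall haC2)
  have hi1 : Integrable fun ξ => ‖a ξ‖ ^ 2 * (F ξ * ‖ξ‖) := hF1.bdd_mul ha2 (.of_forall haC2)
  have hhF : Integrable fun ξ => ‖𝓕 (fun x => (h x : ℂ)) ξ‖ ^ 2 := by simpa only [hnorm] using hi
  have hhc : Integrable fun x => (h x : ℂ) := hh.ofReal
  have hP : ∫ x, h x ^ 2 = ∫ ξ, ‖𝓕 (fun x => (h x : ℂ)) ξ‖ ^ 2 := by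
    rw [← (plancherel_of_integrable hhc ((memLp_two_iff_integrable_sq_norm
      (continuous_fourier_of_integrable hhc).aestronglyMeasurable).2 hhF)).2]
    simp
  have hV := fun r => ballVariance_eq_integral_fourier (r := r) hh hhF hP
  simp only [hnorm] at hV
  have hω : 0 ≤ ballVolume m := measureReal_nonneg
  constructor
  · intro r hr
    rw [(hV r).2, ← integral_const_mul]
    refine integral_mono (hV r).1 (hi1.const_mul _) fun ξ => ?_
    have := mul_le_mul_of_nonneg_left (shellVol_le hr.le ξ)
      (mul_nonneg (sq_nonneg ‖a ξ‖) (hF0 ξ))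
    refine this.trans (le_of_eq (by ring))
  · simp only [fun r => (hV r).2]
    rw [← integral_const_mul]
    simp only [← integral_div]
    refine tendsto_integral_filter_of_dominated_convergence
      (fun ξ => ballVolume m * (‖a ξ‖ ^ 2 * (F ξ * ‖ξ‖))) ?_ ?_ (hi1.const_mul _) ?_
    · exact .of_forall fun r => ((hV r).1.div_const _).1
    · filter_upwards [eventually_gt_atTop 0] with r hr
      refine .of_forall fun ξ => ?_
      have h0 := shellVol_nonneg (r := r) (ζ := ξ)
      rw [Real.norm_of_nonneg (div_nonneg (mul_nonneg (mul_nonneg (sq_nonneg _) (hF0 ξ)) h0)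
        (by positivity)), div_le_iff₀ (by positivity)]
      have := mul_le_mul_of_nonneg_left (shellVol_le hr.le ξ)
        (mul_nonneg (sq_nonneg ‖a ξ‖) (hF0 ξ))
      refine this.trans (le_of_eq (by ring))
    · refine .of_forall fun ξ => ?_
      have := (tendsto_shellVol_div ξ).const_mul (‖a ξ‖ ^ 2 * F ξ)
      simp only [mul_div_assoc]
      convert this using 2
      ring

/-- Dominated convergence for weighted squares of Fourier multipliers. -/
lemma tendsto_integral_norm_sq_mul {X : Type*} [MeasurableSpace X] {ν : Measure X} {G : X → ℝ}
    (hG : Integrable G ν) {a : ℕ → X → ℂ} {b : X → ℂ} {C : ℝ}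
    (ha : ∀ k, AEStronglyMeasurable (a k) ν) (haC : ∀ k x, ‖a k x‖ ≤ C)
    (hab : ∀ x, Tendsto (fun k => a k x) atTop (𝓝 (b x))) :
    Tendsto (fun k => ∫ x, ‖a k x‖ ^ 2 * G x ∂ν) atTop (𝓝 (∫ x, ‖b x‖ ^ 2 * G x ∂ν)) := by
  refine tendsto_integral_of_dominated_convergence (fun x => C ^ 2 * ‖G x‖)
    (fun k => ((ha k).norm.pow 2).mul hG.1) (hG.norm.const_mul _)
    (fun k => .of_forall fun x => ?_) (.of_forall fun x => ((hab x).norm.pow 2).mul_const _)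
  rw [norm_mul, norm_pow, norm_norm]
  exact mul_le_mul_of_nonneg_right (pow_le_pow_left₀ (norm_nonneg _) (haC k x) 2) (norm_nonneg _)

end VarianceAsymptotics

/-! ### Convergence of characteristic functions -/

section CentralLimit
open scoped Topology FourierTransform

/-- `|e^{isX} - e^{isY}| ≤ s|Z|`, and the mean of `|Z|` is at most the root of its second moment.
This is how the remainder of the mollification is discarded. -/
lemma norm_integral_cexp_sub_le {Ω : Type*} [MeasurableSpace Ω] {P : Measure Ω}
    [IsProbabilityMeasure P] {X Y Z : Ω → ℝ} (hX : AEMeasurable X P) (hY : AEMeasurable Y P)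
    (hZ : AEMeasurable Z P) (hXYZ : ∀ᵐ ω ∂P, X ω - Y ω = Z ω) {c : ℝ} (hc : 0 ≤ c)
    (hle : ∫⁻ ω, ENNReal.ofReal (Z ω ^ 2) ∂P ≤ ENNReal.ofReal c) {s : ℝ} (hs : 0 ≤ s) :
    ‖∫ ω, Complex.exp (Complex.I * s * X ω) ∂P - ∫ ω, Complex.exp (Complex.I * s * Y ω) ∂P‖
      ≤ s * Real.sqrt c := by
  have hexpi : ∀ {W : Ω → ℝ}, AEMeasurable W P →
      Integrable (fun ω => Complex.exp (Complex.I * s * W ω)) P := fun {W} hW => by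
    refine Integrable.of_bound (C := 1) (AEMeasurable.aestronglyMeasurable (by fun_prop))
      (.of_forall fun ω => ?_)
    rw [show Complex.I * s * W ω = ((s * W ω : ℝ) : ℂ) * Complex.I by push_cast; ring,
      Complex.norm_exp_ofReal_mul_I]
  have hsq : Integrable (fun ω => Z ω ^ 2) P :=
    (lintegral_ofReal_ne_top_iff_integrable (by fun_prop)
      (.of_forall fun ω => sq_nonneg _)).1 (hle.trans_lt ENNReal.ofReal_lt_top).ne
  have hZ2 : MemLp Z 2 P := (memLp_two_iff_integrable_sq hZ.aestronglyMeasurable).2 hsq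
  have hZi : Integrable Z P := hZ2.integrable one_le_two
  have h1 : ∫ ω, Z ω ^ 2 ∂P ≤ c := by
    rw [← ofReal_integral_eq_lintegral_ofReal hsq (.of_forall fun ω => sq_nonneg _)] at hle
    exact (ENNReal.ofReal_le_ofReal_iff hc).1 hle
  have h2 : ∫ ω, |Z ω| ∂P ≤ Real.sqrt c := by
    refine Real.le_sqrt_of_sq_le ?_
    have h3 := variance_nonneg (fun ω => |Z ω|) P
    rw [variance_eq_sub (X := fun ω => |Z ω|) hZ2.abs] at h3
    simp only [Pi.pow_apply, sq_abs] at h3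
    linarith
  rw [← integral_sub (hexpi hX) (hexpi hY)]
  refine (norm_integral_le_of_norm_le (hZi.abs.const_mul s) ?_).trans ?_
  · filter_upwards [hXYZ] with ω hω
    have h4 : Complex.exp (Complex.I * s * X ω) - Complex.exp (Complex.I * s * Y ω)
        = Complex.exp (((s * Y ω : ℝ) : ℂ) * Complex.I)
          * (Complex.exp (Complex.I * ((s * Z ω : ℝ) : ℂ)) - 1) := by
      rw [mul_sub, ← Complex.exp_add, mul_one, ← hω]
      push_cast
      congr 2 <;> ring
    rw [h4, norm_mul, Complex.norm_exp_ofReal_mul_I, one_mul]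
    refine Real.norm_exp_I_mul_ofReal_sub_one_le.trans (le_of_eq ?_)
    rw [norm_mul, Real.norm_of_nonneg hs, Real.norm_eq_abs]
  · rw [integral_const_mul]
    gcongr

variable {m : ℕ} {ι : Type*} {l : Filter ι} {Ω : ι → Type*} [∀ i, MeasurableSpace (Ω i)]
  {P : (i : ι) → Measure (Ω i)} [∀ i, IsProbabilityMeasure (P i)]
  {Ξ : (i : ι) → Ω i → Measure (EuclideanSpace ℝ (Fin (m + 1)))} {r : ι → ℝ}

/-- Convergence of the characteristic functions of centred and normalised linear statistics. -/
theorem tendsto_integral_cexp_centeredStat (hm : m ≠ 0) (hr : ∀ i, 0 < r i)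
    (hrl : Tendsto r l atTop) (hΞ : ∀ i, HasBallLaplace (P i) (Ξ i) (r i))
    {g : EuclideanSpace ℝ (Fin (m + 1)) → ℝ} (hg : Integrable g)
    (hF : Integrable fun ξ => ‖𝓕 (fun x => (g x : ℂ)) ξ‖ ^ 2)
    (hF1 : Integrable fun ξ => ‖𝓕 (fun x => (g x : ℂ)) ξ‖ ^ 2 * ‖ξ‖) {t : ℝ} (ht : 0 ≤ t) :
    Tendsto (fun i => ∫ ω, Complex.exp (Complex.I * (t / Real.sqrt (r i ^ m) : ℝ) *
        centeredStat (r i) (Ξ i) g ω) ∂(P i)) l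
      (𝓝 (Real.exp (-(t ^ 2 * (ballVolume m * ∫ ξ, ‖𝓕 (fun x => (g x : ℂ)) ξ‖ ^ 2 * ‖ξ‖) / 2)) :
        ℝ)) := by
  obtain ⟨h, a, hsm, hhi, hbd, hfour, hac, ha1, halim, hL1⟩ := exists_mollification hg
  choose B hB using hbd
  set F1 : EuclideanSpace ℝ (Fin (m + 1)) → ℝ :=
    fun ξ => ‖𝓕 (fun x => (g x : ℂ)) ξ‖ ^ 2 * ‖ξ‖ with hF1def
  have hω : 0 ≤ ballVolume m := measureReal_nonneg
  have hF10 : ∀ ξ, 0 ≤ F1 ξ := fun ξ => by positivity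
  set α : ℕ → ℝ := fun k => ∫ ξ, ‖1 - a k ξ‖ ^ 2 * F1 ξ with hα
  set β : ℕ → ℝ := fun k => ∫ ξ, ‖a k ξ‖ ^ 2 * F1 ξ with hβ
  have hα0 : ∀ k, 0 ≤ α k := fun k => integral_nonneg fun ξ =>
    mul_nonneg (sq_nonneg _) (hF10 ξ)
  have hsub2 : ∀ j k ξ, ‖a j ξ - a k ξ‖ ≤ 2 := fun j k ξ =>
    (norm_sub_le _ _).trans (by linarith [ha1 j ξ, ha1 k ξ])
  have hαlim : Tendsto α atTop (𝓝 0) := by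
    have := tendsto_integral_norm_sq_mul hF1 (a := fun k ξ => 1 - a k ξ) (b := fun _ => 1 - 1)
      (C := 2) (fun k => Continuous.aestronglyMeasurable (by have := hac k; fun_prop))
      (fun k ξ => (norm_sub_le _ _).trans (by rw [norm_one]; linarith [ha1 k ξ]))
      (fun ξ => (halim ξ).const_sub 1)
    simpa using this
  have hβlim : Tendsto β atTop (𝓝 (∫ ξ, F1 ξ)) := by
    have := tendsto_integral_norm_sq_mul hF1 (a := a) (b := fun _ => 1) (C := 1)
      (fun k => (hac k).aestronglyMeasurable) ha1 halim
    simpa using this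
  have hVlim := fun k => (ballVariance_of_fourier_eq_mul (hhi k) hF hF1 (hac k) (ha1 k)
    (hfour k)).2
  -- the variance of the remainder
  have hrem : ∀ i k, ∫⁻ ω, ENNReal.ofReal
      (centeredStat (r i) (Ξ i) (fun x => g x - h k x) ω ^ 2) ∂(P i)
      ≤ ENNReal.ofReal (ballVolume m * r i ^ m * α k) := fun i k => by
    -- The variance bound holds for smooth bounded functions only, so it is applied to `h j - h k`
    -- and Fatou's lemma is used as `j → ∞`.
    have hjk : ∀ j, Integrable fun x => h j x - h k x := fun j => (hhi j).sub (hhi k)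
    refine (hΞ i).lintegral_sq_le_of_tendsto (hr i) (f := fun j x => h j x - h k x) hjk
      (hg.sub (hhi k)) ?_ (D := fun j => ENNReal.ofReal (ballVolume m * r i ^ m *
        ∫ ξ, ‖a j ξ - a k ξ‖ ^ 2 * F1 ξ)) (fun j => ?_) ?_
    · simpa only [Pi.sub_apply, sub_sub_sub_cancel_right] using hL1
    · have hBjk : ∀ x, |h j x - h k x| ≤ B j + B k := fun x =>
        (abs_sub _ _).trans (add_le_add (hB j x) (hB k x))
      refine ((hΞ i).variance_and_charFun (hr i) ((hsm j).sub (hsm k)) (hjk j) hBjk).1.trans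
        (ENNReal.ofReal_le_ofReal ?_)
      refine (ballVariance_of_fourier_eq_mul (a := fun ξ => a j ξ - a k ξ) (hjk j) hF hF1
        ((hac j).sub (hac k)) (hsub2 j k) fun ξ => ?_).1 (r i) (hr i)
      rw [sub_mul, ← hfour, ← hfour, Real.fourier_eq', Real.fourier_eq', Real.fourier_eq',
        ← integral_sub]
      · refine integral_congr_ae (.of_forall fun x => ?_)
        simp only [smul_eq_mul]
        push_cast; ring
      all_goals
        refine ((hhi _).ofReal (𝕜 := ℂ)).bdd_mul (c := 1)
          (Continuous.aestronglyMeasurable (by fun_prop)) (.of_forall fun v => ?_)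
        rw [Complex.norm_exp_ofReal_mul_I]
    · refine ENNReal.tendsto_ofReal (Tendsto.const_mul _ ?_)
      exact tendsto_integral_norm_sq_mul hF1 (a := fun j ξ => a j ξ - a k ξ)
        (C := 2) (fun j => ((hac j).sub (hac k)).aestronglyMeasurable) (fun j => hsub2 j k)
        (fun ξ => (halim ξ).sub_const _)
  have hs0 : ∀ i, 0 ≤ t / Real.sqrt (r i ^ m) := fun i => by positivity
  have hsr : ∀ i, (t / Real.sqrt (r i ^ m)) ^ 2 = t ^ 2 / r i ^ m := fun i => by
    rw [div_pow, Real.sq_sqrt (pow_nonneg (hr i).le m)]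
  -- Here dimension at least two enters: `m ≠ 0` makes the variance scale `r ^ m` diverge.
  have hslim : Tendsto (fun i => t / Real.sqrt (r i ^ m)) l (𝓝 0) :=
    tendsto_const_nhds.div_atTop
      (Real.tendsto_sqrt_atTop.comp ((tendsto_pow_atTop hm).comp hrl))
  set S := ∫ ξ, F1 ξ with hS
  -- Three errors: replacing `g` by `h k`, uniformly in `i`; the Gaussian approximation, which
  -- vanishes as `r → ∞` for fixed `k` even though `B k` may be unbounded in `k`; and the mismatch
  -- of the two Gaussian variances.
  set R : ℕ → ι → ℝ := fun k i => t * Real.sqrt (ballVolume m * α k)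
    + (40 * B k * (t / Real.sqrt (r i ^ m)) * (t ^ 2 * (ballVariance (r i) (h k) / r i ^ m))
    + |Real.exp (-(t ^ 2 * (ballVariance (r i) (h k) / r i ^ m) / 2))
        - Real.exp (-(t ^ 2 * (ballVolume m * S) / 2))|) with hR
  set R' : ℕ → ℝ := fun k => t * Real.sqrt (ballVolume m * α k)
    + (40 * B k * 0 * (t ^ 2 * (ballVolume m * β k))
    + |Real.exp (-(t ^ 2 * (ballVolume m * β k) / 2))
        - Real.exp (-(t ^ 2 * (ballVolume m * S) / 2))|) with hR'
  have hRlim : ∀ k, Tendsto (R k) l (𝓝 (R' k)) := fun k => by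
    have hv := (hVlim k).comp hrl
    have hc : Continuous fun v : ℝ => |Real.exp (-(t ^ 2 * v / 2))
        - Real.exp (-(t ^ 2 * (ballVolume m * S) / 2))| := by fun_prop
    exact ((((hslim.const_mul (40 * B k)).mul (hv.const_mul (t ^ 2)))).add
      ((hc.tendsto _).comp hv)).const_add _
  have hR'lim : Tendsto R' atTop (𝓝 0) := by
    have hc1 : Continuous fun v : ℝ => |Real.exp (-(t ^ 2 * (ballVolume m * v) / 2))
        - Real.exp (-(t ^ 2 * (ballVolume m * S) / 2))| := by fun_prop
    have hc2 : Continuous fun v : ℝ => t * Real.sqrt (ballVolume m * v) := by fun_prop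
    have := ((hc2.tendsto _).comp hαlim).add ((hc1.tendsto _).comp hβlim)
    simpa [hR', Function.comp_def] using this
  have hbound : ∀ k, ∀ᶠ i in l, ‖∫ ω, Complex.exp (Complex.I * (t / Real.sqrt (r i ^ m) : ℝ) *
        centeredStat (r i) (Ξ i) g ω) ∂(P i)
      - (Real.exp (-(t ^ 2 * (ballVolume m * S) / 2)) : ℝ)‖ ≤ R k i := fun k => by
    have hev : ∀ᶠ i in l, 192 * (B k * (t / Real.sqrt (r i ^ m))) ≤ 1 := by
      have : Tendsto (fun i => 192 * (B k * (t / Real.sqrt (r i ^ m)))) l (𝓝 0) := by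
        simpa using (hslim.const_mul (B k)).const_mul 192
      exact this.eventually_le_const one_pos
    filter_upwards [hev] with i hi
    set s := t / Real.sqrt (r i ^ m) with hs
    have hrm : 0 < r i ^ m := pow_pos (hr i) m
    have h1 := norm_integral_cexp_sub_le (P := P i)
      ((hΞ i).aemeasurable_centeredStat_of_integrable (hr i) hg)
      ((hΞ i).aemeasurable_centeredStat_of_integrable (hr i) (hhi k))
      ((hΞ i).aemeasurable_centeredStat_of_integrable (hr i) (hg.sub (hhi k)))
      (by
        filter_upwards [(hΞ i).ae_integrable (hr i) hg, (hΞ i).ae_integrable (hr i) (hhi k)]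
          with ω h1 h2
        simp only [centeredStat, Pi.sub_apply]
        rw [integral_sub h1 h2, integral_sub hg (hhi k)]
        ring)
      (mul_nonneg (mul_nonneg hω hrm.le) (hα0 k)) (hrem i k) (hs0 i)
    have h2 := ((hΞ i).variance_and_charFun (hr i) (hsm k) (hhi k) (hB k)).2 s (hs0 i) hi
    have h3 : s * Real.sqrt (ballVolume m * r i ^ m * α k)
        = t * Real.sqrt (ballVolume m * α k) := by
      rw [mul_right_comm, Real.sqrt_mul' _ hrm.le, hs]
      have : Real.sqrt (r i ^ m) ≠ 0 := (Real.sqrt_pos.2 hrm).ne'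
      field_simp
    have h4 : s ^ 2 * ballVariance (r i) (h k) = t ^ 2 * (ballVariance (r i) (h k) / r i ^ m) := by
      rw [hs, hsr]; ring
    have h5 : 40 * B k * s ^ 3 * ballVariance (r i) (h k)
        = 40 * B k * s * (t ^ 2 * (ballVariance (r i) (h k) / r i ^ m)) := by
      rw [← h4]; ring
    rw [h3] at h1
    rw [h5, h4] at h2
    have h6 : ‖((Real.exp (-(t ^ 2 * (ballVariance (r i) (h k) / r i ^ m) / 2)) : ℝ) : ℂ)
        - (Real.exp (-(t ^ 2 * (ballVolume m * S) / 2)) : ℝ)‖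
        = |Real.exp (-(t ^ 2 * (ballVariance (r i) (h k) / r i ^ m) / 2))
        - Real.exp (-(t ^ 2 * (ballVolume m * S) / 2))| := by
      rw [← Complex.ofReal_sub, Complex.norm_real, Real.norm_eq_abs]
    refine (norm_sub_le_norm_sub_add_norm_sub _ _ _).trans
      (add_le_add h1 ((norm_sub_le_norm_sub_add_norm_sub _ _ _).trans (add_le_add h2 h6.le)))
  rw [tendsto_iff_norm_sub_tendsto_zero]
  refine tendsto_order.2 ⟨fun b hb => .of_forall fun i => hb.trans_le (norm_nonneg _),
    fun ε hε => ?_⟩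
  obtain ⟨k, hk⟩ := (hR'lim.eventually_lt_const hε).exists
  filter_upwards [hbound k, (hRlim k).eventually_lt_const hk] with i h1 h2
  exact h1.trans_lt h2

end CentralLimit

/-! ### Constants of the normalisation -/

section Normalisation
open scoped Topology

lemma sigmaConst_mul_rpow_eq {m : ℕ} {μ : ℝ} (hμ : 0 < μ) :
    sigmaConst (m + 1) * μ ^ ((((m + 1 : ℕ) : ℝ) - 1) / 2)
      = Real.sqrt (ballVolume m / (2 * Real.pi)) * Real.sqrt ((μ / (2 * Real.pi)) ^ m) := by
  have hω : 0 ≤ ballVolume m := measureReal_nonneg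
  have h1 : μ ^ ((((m + 1 : ℕ) : ℝ) - 1) / 2) = Real.sqrt (μ ^ m) := by
    rw [Real.sqrt_eq_rpow, ← Real.rpow_natCast, ← Real.rpow_mul hμ.le]
    congr 1
    push_cast; ring
  rw [h1, sigmaConst, Nat.add_sub_cancel, ← Real.sqrt_mul (by positivity),
    ← Real.sqrt_mul (by positivity)]
  congr 1
  rw [div_pow]
  field_simp
  ring

lemma ballVolume_pos (n : ℕ) : 0 < ballVolume n :=
  ENNReal.toReal_pos (Metric.measure_closedBall_pos volume _ one_pos).ne'
    measure_closedBall_lt_top.ne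

end Normalisation

/-- In terms of `r = μ/(2π)` the normalisation is `c · √(r^m)` with `c² = ω_m/(2π)`. The limiting
variance `ω_m ∫ |ĝ|²|ξ|` divided by `c²` is `2π ∫ |ĝ|²|ξ| = Σ²(g)`. -/
theorem mainTheorem8 {n : ℕ} (hn : 2 ≤ n)
    {Ω : Set.Ioi (0 : ℝ) → Type*} [∀ μ, MeasurableSpace (Ω μ)]
    (P : (μ : Set.Ioi (0 : ℝ)) → Measure (Ω μ)) [∀ μ, IsProbabilityMeasure (P μ)]
    (Ξ : (μ : Set.Ioi (0 : ℝ)) → Ω μ → Measure (EuclideanSpace ℝ (Fin n)))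
    (hΞ : ∀ μ, IsDeterminantalProcess (P μ) (Ξ μ) (freeLaplacianProjector n μ))
    (g : EuclideanSpace ℝ (Fin n) → ℝ) (hg : Integrable g)
    (hg' : TemperedDistribution.MemSobolev (1 / 2) 2
      (Lp.toTemperedDistribution (hg.ofReal (𝕜 := ℂ)).toL1)) :
    (∀ μ, ∀ᵐ ω ∂(P μ), Integrable g (Ξ μ ω)) ∧
    TendstoInDistribution
      (fun (μ : Set.Ioi (0 : ℝ)) (ω : Ω μ) =>
        ((∫ x, g x ∂(Ξ μ ω)) -
            (μ : ℝ) ^ n * ballVolume n / (2 * Real.pi) ^ n * ∫ x, g x) /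
          (sigmaConst n * (μ : ℝ) ^ (((n : ℝ) - 1) / 2)))
      atTop (id : ℝ → ℝ) P (gaussianReal 0 (limitVariance g)) := by
  obtain ⟨m, rfl⟩ : ∃ m, n = m + 1 := ⟨n - 1, by omega⟩
  have hm : m ≠ 0 := by omega
  have hpi : 0 < 2 * Real.pi := by positivity
  set r : Set.Ioi (0 : ℝ) → ℝ := fun μ => μ / (2 * Real.pi) with hr
  have hμ : ∀ μ : Set.Ioi (0 : ℝ), 0 < (μ : ℝ) := fun μ => μ.2
  have hr0 : ∀ μ, 0 < r μ := fun μ => div_pos (hμ μ) hpi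
  have hB : ∀ μ, HasBallLaplace (P μ) (Ξ μ) (r μ) := fun μ => (hΞ μ).hasBallLaplace (hμ μ)
  have hrl : Tendsto r atTop atTop :=
    (tendsto_comp_val_Ioi_atTop.2 tendsto_id).atTop_div_const hpi
  set c := Real.sqrt (ballVolume m / (2 * Real.pi)) with hc
  have hc0 : 0 < c := Real.sqrt_pos.2 (div_pos (ballVolume_pos m) hpi)
  have hZ : ∀ μ, (fun ω : Ω μ => ((∫ x, g x ∂(Ξ μ ω)) -
            (μ : ℝ) ^ (m + 1) * ballVolume (m + 1) / (2 * Real.pi) ^ (m + 1) * ∫ x, g x) /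
          (sigmaConst (m + 1) * (μ : ℝ) ^ ((((m + 1 : ℕ) : ℝ) - 1) / 2)))
      = fun ω => centeredStat (r μ) (Ξ μ) g ω / (c * Real.sqrt (r μ ^ m)) := fun μ => by
    funext ω
    rw [sigmaConst_mul_rpow_eq (hμ μ), centeredStat, ballVol_eq (hr0 μ).le]
    congr 3
    simp only [hr, div_pow]
    ring
  have hZm : ∀ μ, AEMeasurable (fun ω => centeredStat (r μ) (Ξ μ) g ω /
      (c * Real.sqrt (r μ ^ m))) (P μ) := fun μ =>
    ((hB μ).aemeasurable_centeredStat_of_integrable (hr0 μ) hg).div_const _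
  obtain ⟨hF, hF1⟩ := integrable_fourier_sq_of_memSobolev (hg.ofReal (𝕜 := ℂ)) hg'
  refine ⟨fun μ => (hB μ).ae_integrable (hr0 μ) hg, ?_⟩
  rw [funext hZ]
  have hchar : ∀ t : ℝ, 0 ≤ t → Tendsto (fun μ => charFun ((P μ).map fun ω =>
      centeredStat (r μ) (Ξ μ) g ω / (c * Real.sqrt (r μ ^ m))) t) atTop
      (nhds (charFun (gaussianReal 0 (limitVariance g)) t)) := fun t ht => by
    have h1 := tendsto_integral_cexp_centeredStat hm hr0 hrl hB hg hF hF1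
      (div_nonneg ht hc0.le)
    convert h1 using 1
    · funext μ
      rw [charFun_apply_real, integral_map (hZm μ)
        (Continuous.aestronglyMeasurable (by fun_prop))]
      refine integral_congr_ae (.of_forall fun ω => ?_)
      simp only
      congr 1
      push_cast
      rw [div_div]
      ring
    · rw [charFun_gaussianReal, limitVariance_eq, div_pow, Real.sq_sqrt (by
        have := ballVolume_pos m; positivity)]
      push_cast
      congr 2
      have h2 : (ballVolume m : ℂ) ≠ 0 := by exact_mod_cast (ballVolume_pos m).ne'
      field_simp
      ring
  have hcharall : ∀ t : ℝ, Tendsto (fun μ => charFun ((P μ).map fun ω =>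
      centeredStat (r μ) (Ξ μ) g ω / (c * Real.sqrt (r μ ^ m))) t) atTop
      (nhds (charFun (gaussianReal 0 (limitVariance g)) t)) := fun t => by
    -- Negative times follow by complex conjugation.
    rcases le_total 0 t with ht | ht
    · exact hchar t ht
    · have h1 := (Complex.continuous_conj.tendsto _).comp (hchar (-t) (by linarith))
      simpa only [Function.comp_def, ← charFun_neg, neg_neg] using h1
  refine ⟨hZm, aemeasurable_id, ?_⟩
  -- Lévy's continuity theorem is applied along sequences, which suffice because `atTop` on the
  -- parameter set is countably generated.
  refine tendsto_of_seq_tendsto fun u hu => ?_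
  refine ProbabilityMeasure.tendsto_iff_tendsto_charFun.2 fun t => ?_
  simp only [ProbabilityMeasure.coe_mk, Measure.map_id]
  exact (hcharall t).comp hu
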